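/- Let $K$ be a field, $d_1,\dots,d_k\ge 0$ integers, and let $\widetilde S=\mathbb P(\bigoplus_{i=1}^k\mathcal O(d_i))\to\mathbb P^1$ be the projective bundle with bihomogeneous coordinates $(s:t;\,z^{(1)}:\dots:z^{(k)})$, where $z^{(i)}$ has fibre degree $1$ and total degree $-d_i$ and $s,t$ have fibre degree $0$ and total degree $1$. Its image under $z^{(i)}_j=z^{(i)}s^{d_i-j}t^j$ $(0\le j\le d_i)$ is the rational normal scroll cut out by the $2\times2$ minors of the matrix $$\begin{pmatrix} z^{(1)}_0&\dots&z^{(1)}_{d_1-1}&\dots&z^{(k)}_0&\dots&z^{(k)}_{d_k-1}\\ z^{(1)}_1&\dots&z^{(1)}_{d_1}&\dots&z^{(k)}_1&\dots&z^{(k)}_{d_k}\end{pmatrix}.$$ Let $H$ be the hyperplane class and $R$ the ruling. Let $a\ge2$ and $b_1,\dots,b_l>0$ be integers, and let $P^{(1)},\dots,P^{(l)}$ be equations of divisors of type $aH-b_iR$ on $\widetilde S$, i.e. bihomogeneous polynomials of fibre degree $a$ and total degree $-b_i$, which define a non-empty complete intersection $V\subset\widetilde S$ of dimension $k-l\ge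 0$ (at each point of $V$ the local equations form a regular sequence). Let $X$ be the cone over $V$, i.e. the affine scheme $X=\operatorname{Spec}A$, $A=K[z^{(i)}_j]/I$, where $I$ is generated by the $2\times 2$ minors of the matrix and, for all $1\le i\le l$ and $0\le m\le b_i$, by the rolling factors equations $P^{(i)}_m$, i.e. the polynomials in the $z^{(i)}_j$ that express $s^{b_i-m}t^mP^{(i)}$. Let $T^2_X(\nu)$ be the part of degree $\nu$ of $T^2_X=\operatorname{coker}\bigl(\operatorname{Hom}(F,A)\to\operatorname{Hom}(\mathcal R/\mathcal R_0,A)\bigr)$, where $0\to\mathcal R\to F\to I\to0$ is a presentation of $I$ with $F$ a graded free $K[z^{(i)}_j]$-module, and $\mathcal R_0\subset\mathcal R$ is the submodule of Koszul relations. If $a>2$, then $\dim_K T^2_X(-a)=\sum_{i=1}^l(b_i-1)$. If $a=2$, then $\dim_K T^2_X(-2)\ge\sum_{i=1}^l(b_i-1)$. -/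

import Mathlib

open MvPolynomial

noncomputable section

/-! ### The graded pieces of the second cotangent module of an affine cone

`S` is a `K`-algebra graded by the subspaces `𝒮 m`, `m ∈ ℤ` (a polynomial ring with its standard
grading in the application), `I` an ideal of `S` (homogeneous in the application) and `A = S ⧸ I`.
For the presentation `0 → R → F → I → 0` of `I` by a graded free module `F`,
with `R₀ ⊆ R` the submodule of Koszul relations, `T²` is the cokernel of
`Hom(F, A) → Hom(R / R₀, A)`, and `T²(ν)` is its part of degree `ν`. To have an
object that depends on `I` only, `F` is taken free on *all* homogeneous elements of `I`;
as for every other graded presentation, `T²(ν)` is the same up to isomorphism. -/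

namespace Cotangent

variable {K S : Type*} [Field K] [CommRing S] [Algebra K S] (𝒮 : ℤ → Submodule K S) (I : Ideal S)

/-- The part of degree `m` of `A = S ⧸ I`. -/
def quotPart (m : ℤ) : Submodule K (S ⧸ I) :=
  (𝒮 m).map (Ideal.Quotient.mkₐ K I).toLinearMap

/-- A homogeneous element of `I`, together with a degree; it indexes a basis vector of `F`. -/
structure Gen where
  /-- the degree -/
  deg : ℤ
  /-- the element of the ideal -/
  elt : S
  mem : elt ∈ I
  homogeneous : elt ∈ 𝒮 deg

/-- The graded free module `F` with a basis vector of degree `p.deg` for each `p : Gen 𝒮 I`. -/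
abbrev Free : Type _ := Gen 𝒮 I →₀ S

variable {𝒮 I} in
/-- The basis vector of `F` that belongs to `p`; the map `F → I` sends it to `p.elt`. -/
def Free.basis (p : Gen 𝒮 I) : Free 𝒮 I := Finsupp.single p 1

variable {𝒮 I} in
/-- `r ∈ F` is homogeneous of degree `n`. -/
def Free.IsHomogeneousOfDegree (r : Free 𝒮 I) (n : ℤ) : Prop :=
  ∀ p : Gen 𝒮 I, r p ∈ 𝒮 (n - p.deg)

/-- The module `R` of relations: the kernel of `F → S`. -/
def relations : Submodule S (Free 𝒮 I) :=
  LinearMap.ker (Finsupp.linearCombination S (fun p : Gen 𝒮 I => p.elt))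

/-- `r` is one of the Koszul relations; they generate the submodule `R₀` of `R`. -/
def IsKoszul (r : relations 𝒮 I) : Prop :=
  ∃ p q : Gen 𝒮 I, (r : Free 𝒮 I) = p.elt • Free.basis q - q.elt • Free.basis p

/-- The part of degree `ν` of `Hom_S(R / R₀, A)`: the homomorphisms `R → A` of degree `ν` that
vanish on the Koszul relations. -/
def relHomPart (ν : ℤ) : Submodule K (relations 𝒮 I →ₗ[S] (S ⧸ I)) where
  carrier := {ψ | (∀ r, IsKoszul 𝒮 I r → ψ r = 0) ∧
    ∀ (n : ℤ) (r : relations 𝒮 I), (r : Free 𝒮 I).IsHomogeneousOfDegree n →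
      ψ r ∈ quotPart 𝒮 I (n + ν)}
  add_mem' hφ hψ := ⟨fun r hr => by simp [hφ.1 r hr, hψ.1 r hr],
    fun n r hr => add_mem (hφ.2 n r hr) (hψ.2 n r hr)⟩
  zero_mem' := ⟨fun _ _ => rfl, fun n r _ => zero_mem (quotPart 𝒮 I (n + ν))⟩
  smul_mem' c ψ hψ := ⟨fun r hr => by simp [hψ.1 r hr],
    fun n r hr => (quotPart 𝒮 I (n + ν)).smul_mem c (hψ.2 n r hr)⟩

/-- The homomorphisms `R → A` that are restrictions of homomorphisms `F → A` of degree `ν`. -/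
def inducedPart (ν : ℤ) : Submodule K (relations 𝒮 I →ₗ[S] (S ⧸ I)) where
  carrier := {ψ | ∃ φ : Free 𝒮 I →ₗ[S] (S ⧸ I),
    (∀ p : Gen 𝒮 I, φ (Free.basis p) ∈ quotPart 𝒮 I (p.deg + ν)) ∧
      ∀ r : relations 𝒮 I, ψ r = φ r}
  add_mem' := by
    rintro _ _ ⟨φ, hφ, h⟩ ⟨φ', hφ', h'⟩
    exact ⟨φ + φ', fun p => add_mem (hφ p) (hφ' p), fun r => by
      simp only [LinearMap.add_apply, h, h']⟩
  zero_mem' := ⟨0, fun p => zero_mem (quotPart 𝒮 I (p.deg + ν)), fun _ => rfl⟩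
  smul_mem' := by
    rintro c _ ⟨φ, hφ, h⟩
    exact ⟨c • φ, fun p => (quotPart 𝒮 I (p.deg + ν)).smul_mem c (hφ p), fun r => by
      simp only [LinearMap.smul_apply, h]⟩

/-- `T²(ν)`, the part of degree `ν` of `coker (Hom(F, A) → Hom(R / R₀, A))`: the image of
`relHomPart` in the quotient of all homomorphisms `R → A` by the induced ones, that is,
`relHomPart ⧸ inducedPart`. -/
def T2 (ν : ℤ) : Submodule K ((relations 𝒮 I →ₗ[S] (S ⧸ I)) ⧸ inducedPart 𝒮 I ν) :=
  (relHomPart 𝒮 I ν).map (inducedPart 𝒮 I ν).mkQ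

end Cotangent

/-! ### Rational normal scrolls, divisors on them, and rolling factors -/

namespace Scroll

variable (K : Type*) [Field K] {k : ℕ} (d : Fin k → ℕ)

/-- The coordinate ring of the affine space over `ℙⁿ`: it has the variables `z^{(i)}_j`,
`1 ≤ i ≤ k`, `0 ≤ j ≤ d_i`. -/
abbrev Amb : Type _ := MvPolynomial (Σ i : Fin k, Fin (d i + 1)) K

/-- The standard grading of the coordinate ring (`0` in negative degrees). -/
def grading (m : ℤ) : Submodule K (Amb K d) := weightedHomogeneousSubmodule K (fun _ => (1 : ℤ)) m

/-- The matrix of the scroll, with the columns `(z^{(i)}_j, z^{(i)}_{j+1})`, `0 ≤ j < d_i`. -/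
def matrix : Matrix (Fin 2) (Σ i : Fin k, Fin (d i)) (Amb K d) :=
  ![fun c => X ⟨c.1, c.2.castSucc⟩, fun c => X ⟨c.1, c.2.succ⟩]

/-- The `2 × 2` minor on the columns `α`, `β`. -/
def minor (α β : Σ i : Fin k, Fin (d i)) : Amb K d :=
  matrix K d 0 α * matrix K d 1 β - matrix K d 1 α * matrix K d 0 β

/-- The ring of bihomogeneous coordinates `s`, `t`, `z^{(1)}`, …, `z^{(k)}` on the projective
bundle `S̃ = ℙ(⊕ 𝒪(d_i))` over `ℙ¹` whose image is the scroll. -/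
abbrev Cox (k : ℕ) : Type _ := MvPolynomial (Fin 2 ⊕ Fin k) K

/-- The coordinate `s` on `ℙ¹`. -/
def s (k : ℕ) : Cox K k := X (Sum.inl 0)

/-- The coordinate `t` on `ℙ¹`. -/
def t (k : ℕ) : Cox K k := X (Sum.inl 1)

/-- The fibre coordinate `z^{(i)}`. -/
def z (i : Fin k) : Cox K k := X (Sum.inr i)

/-- The bidegrees of the coordinates: degree in the fibre coordinates, and total degree, where
`s`, `t` count with degree `1` and `z^{(i)}` with degree `-d_i`. -/
def bidegree : Fin 2 ⊕ Fin k → ℤ × ℤ :=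
  Sum.elim (fun _ => (0, 1)) (fun i => (1, -(d i : ℤ)))

/-- The map `S̃ → ℙⁿ` in coordinates: `z^{(i)}_j = z^{(i)} s^{d_i - j} t^j`. -/
def pullback : Amb K d →ₐ[K] Cox K k :=
  aeval fun v => z K v.1 * s K k ^ (d v.1 - (v.2 : ℕ)) * t K k ^ (v.2 : ℕ)

variable {K}

/-- `P` is an equation of a divisor of type `aH - bR` on `S̃`. -/
def IsDivisorEquation (a b : ℕ) (P : Cox K k) : Prop :=
  IsWeightedHomogeneous (bidegree d) P ((a : ℤ), -(b : ℤ))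

/-- `Q` is a point of the common zero locus `V` of the `P_i` on `S̃`, in Cox coordinates: a prime
that contains all the `P_i` and contains neither `(s, t)` nor `(z^{(1)}, …, z^{(k)})`. -/
structure IsPointOf {l : ℕ} (P : Fin l → Cox K k) (Q : Ideal (Cox K k)) : Prop where
  isPrime : Q.IsPrime
  mem : ∀ i, P i ∈ Q
  base : ¬ (s K k ∈ Q ∧ t K k ∈ Q)
  fibre : ¬ ∀ i : Fin k, z K i ∈ Q

/-- The `l` divisors `P_i = 0` form a (non-empty) complete intersection `V` of dimension `k - l`
on `S̃`: their local equations form a regular sequence at each point of `V`. The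
assumption `l ≤ k` follows from the other two and is listed for convenience. -/
structure IsCompleteIntersection {l : ℕ} (P : Fin l → Cox K k) : Prop where
  le_dim : l ≤ k
  nonempty : ∃ Q : Ideal (Cox K k), IsPointOf P Q
  regular : ∀ (Q : Ideal (Cox K k)) [Q.IsPrime], IsPointOf P Q →
    RingTheory.Sequence.IsRegular (Localization.AtPrime Q)
      (List.ofFn fun i => algebraMap (Cox K k) (Localization.AtPrime Q) (P i))

/-- The ideal of the cone over `V` in rolling factors format: it is generated by the minors of the
matrix of the scroll and by the rolling factors equations `P^{(i)}_m`, `0 ≤ m ≤ b_i`, that is,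
the polynomials in the `z^{(i)}_j` that express `s^{b_i - m} t^m P^{(i)}`. All expressions are
taken; two of them differ by an element of the ideal of the scroll. -/
def coneIdeal {l : ℕ} (b : Fin l → ℕ) (P : Fin l → Cox K k) : Ideal (Amb K d) :=
  Ideal.span ({f | ∃ α β, f = minor K d α β} ∪
    {f | ∃ i m, m ≤ b i ∧ pullback K d f = s K k ^ (b i - m) * t K k ^ m * P i})

/-- `T²_X(ν)` for the cone `X` over `V`. -/
abbrev T2Cone {l : ℕ} (b : Fin l → ℕ) (P : Fin l → Cox K k) (ν : ℤ) : Type _ :=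
  Cotangent.T2 (grading K d) (coneIdeal d b P) ν

end Scroll

end

/-! Write S for the ring of bihomogeneous coordinates and J = (P_1, …, P_l). Monomials of total
degree 0 in S are pulled back from the ambient space, and the minors generate the kernel of the
pullback. Hence A is the part of total degree 0 of S/J (`mem_coneIdeal_iff`), and relations among
the equations of X can be studied through syzygies in S.

Two facts about syzygies carry the argument. Those of s^b, s^(b-1)t, …, t^b are telescoping
(`exists_eq_of_sum_eq_zero`), and those of P_1, …, P_l are Koszul in total degrees at least -1
(`exists_koszul`). The second needs work, because the complete intersection condition says nothing
at the irrelevant loci. Along z = 0 it is replaced by a depth argument, since the z^{(i)} form a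
regular sequence of length k ≥ l. Along s = t = 0 it is replaced by the vanishing of local
cohomology in total degrees at least -1 (`partialIdeal_saturated`), which goes back to the
cohomology of line bundles on the projective line.

Let Q_{i,m} be the coefficients of the rolling factors equations in a relation. Modulo J one has
Q_{i,m} = t N_{i,m+1} - s N_{i,m} with N_{i,0} = N_{i,b_i+1} = 0, where N has total degree -1 and is
unique modulo J. The maps sending a relation to t N_{i,m+1} are homomorphisms of degree -a that
vanish on Koszul relations (`couplingHom`). For m = 0 the map is induced, for m = b_i it is zero,
and b_i - 1 maps remain for each i. Testing on relations between consecutive rolling factors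
equations, where an induced map gives constants times the entries of a column, shows that they are
independent modulo induced maps (`eq_zero_of_sum_couplingHom_mem`).

For a > 2 they span. A homomorphism ψ of degree -a vanishes on the linear relations among the
minors, and all relations among the minors follow from these and the Koszul ones
(`IsMinorSymbol.sum_smul_eq_zero`). So, up to an induced map, ψ depends only on the Q_{i,m} modulo
Koszul relations, and is determined by its values on the consecutive relations. These values are x
times the lower plus y times the upper entry of the column, with x and y independent of the column
(`IsReducedHom.exists_apply_colRelation`), and this exhibits ψ as a combination of couplings and
induced maps. For a = 2 only independence is proved. -/

noncomputable section

/-! ### Depth, associated primes and regular sequences in noetherian rings -/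

namespace Depth

open IsLocalRing RingTheory.Sequence CategoryTheory CategoryTheory.Abelian Pointwise

universe u

variable {R : Type u} [CommRing R] [IsNoetherianRing R] [IsLocalRing R]

/-- A regular element `x` moves each associated prime of `M` to a strictly larger associated
prime of `M / xM`. -/
lemma exists_lt_mem_associatedPrimes_quotSMulTop {M : Type u} [AddCommGroup M] [Module R M]
    [Module.Finite R M] {Q : Ideal R} (hQ : Q ∈ associatedPrimes R M) {x : R}
    (hx : x ∈ maximalIdeal R) (hreg : IsSMulRegular M x) :
    ∃ Q' ∈ associatedPrimes R (QuotSMulTop x M), Q < Q' := by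
  obtain ⟨hp, m, hm⟩ := isAssociatedPrime_iff.mp hQ
  have memQ : ∀ r, r ∈ Q ↔ r • m = 0 := fun r => by
    rw [hm]; simp [Submodule.mem_colon_singleton]
  have hm0 : m ≠ 0 := by
    rintro rfl
    exact hp.ne_top ((Ideal.eq_top_iff_one _).mpr ((memQ 1).mpr (by simp)))
  set N : Submodule R M := Submodule.torsionBySet R M (Q : Set R) with hN
  have hmN : m ∈ N := by
    rw [hN, Submodule.mem_torsionBySet_iff]
    rintro ⟨r, hr⟩
    exact (memQ r).mp hr
  -- If N were inside xM, then N = xN: as x is regular, Q kills y' whenever it kills x y'. Nakayama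
  -- would give N = 0, although m lies in N.
  have hnot : ¬ N ≤ x • (⊤ : Submodule R M) := by
    intro hle
    have hle' : N ≤ Ideal.span {x} • N := by
      intro y hy
      obtain ⟨y', -, rfl⟩ := Submodule.mem_smul_pointwise_iff_exists _ _ _ |>.mp (hle hy)
      rw [Submodule.ideal_span_singleton_smul]
      refine Submodule.smul_mem_pointwise_smul _ _ _ ?_
      rw [hN, Submodule.mem_torsionBySet_iff] at hy ⊢
      rintro ⟨r, hr⟩
      have := hy ⟨r, hr⟩
      simp only at this ⊢
      rw [smul_comm] at this
      exact hreg (by simpa using this)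
    have := Submodule.eq_bot_of_le_smul_of_le_jacobson_bot _ N (IsNoetherian.noetherian N) hle'
      (by
        rw [Ideal.span_singleton_le_iff_mem]
        exact IsLocalRing.maximalIdeal_le_jacobson _ hx)
    rw [this] at hmN
    exact hm0 (by simpa using hmN)
  obtain ⟨z, hzN, hz⟩ := SetLike.not_le_iff_exists.mp hnot
  obtain ⟨Q', hQ', hle⟩ := exists_le_isAssociatedPrime_of_isNoetherianRing R
    (Submodule.Quotient.mk z : QuotSMulTop x M)
    (by simpa [Submodule.Quotient.mk_eq_zero] using hz)
  refine ⟨Q', hQ', lt_of_le_of_ne ?_ ?_⟩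
  · intro r hr
    apply hle
    rw [Submodule.mem_colon_singleton, ← Submodule.Quotient.mk_smul]
    rw [hN, Submodule.mem_torsionBySet_iff] at hzN
    have := hzN ⟨r, hr⟩
    simp only at this
    simp [this]
  · rintro rfl
    have hxQ : x ∈ Q := by
      apply hle
      rw [Submodule.mem_colon_singleton, ← Submodule.Quotient.mk_smul, Submodule.mem_bot,
        Submodule.Quotient.mk_eq_zero]
      exact Submodule.smul_mem_pointwise_smul _ _ _ trivial
    exact hm0 (hreg (by simpa using (memQ x).mp hxQ))

/-- The length of a regular sequence on `M` is at most the dimension of `R / Q`, for each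
associated prime `Q` of `M`. -/
lemma length_le_coheight {rs : List R} {M : Type u} [AddCommGroup M] [Module R M]
    [Module.Finite R M] (hrs : IsWeaklyRegular M rs) (hmem : ∀ r ∈ rs, r ∈ maximalIdeal R)
    {Q : PrimeSpectrum R} (hQ : Q.asIdeal ∈ associatedPrimes R M) :
    (rs.length : ℕ∞) ≤ Order.coheight Q := by
  induction rs generalizing M Q with
  | nil => simp
  | cons x rs ih =>
    rw [isWeaklyRegular_cons_iff] at hrs
    obtain ⟨Q', hQ', hlt⟩ := exists_lt_mem_associatedPrimes_quotSMulTop hQ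
      (hmem x (by simp)) hrs.1
    have h := ih hrs.2 (fun r hr => hmem r (by simp [hr])) (Q := ⟨Q', hQ'.1⟩) hQ'
    have h2 : Order.coheight (⟨Q', hQ'.1⟩ : PrimeSpectrum R) + 1 ≤ Order.coheight Q :=
      Order.coheight_add_one_le (show Q < ⟨Q', hQ'.1⟩ from hlt)
    refine le_trans ?_ h2
    push_cast [List.length_cons]
    gcongr

variable (R) in
/-- The vanishing of `Ext^i(κ, M)` for `i < n`. -/
def ExtVanish (M : Type u) [AddCommGroup M] [Module R M] (n : ℕ) : Prop :=
  ∀ i < n, Subsingleton (Ext (ModuleCat.of R (R ⧸ maximalIdeal R)) (ModuleCat.of R M) i)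

omit [IsNoetherianRing R] in
lemma support_residue :
    Module.support R (R ⧸ maximalIdeal R) = PrimeSpectrum.zeroLocus (maximalIdeal R : Set R) := by
  rw [Module.support_eq_zeroLocus, Ideal.annihilator_quotient]

omit [IsNoetherianRing R] in
lemma smul_top_lt_top (M : Type u) [AddCommGroup M] [Module R M] [Module.Finite R M]
    [Nontrivial M] : maximalIdeal R • (⊤ : Submodule R M) < ⊤ :=
  (Submodule.top_ne_ideal_smul_of_le_jacobson_annihilator
    (IsLocalRing.maximalIdeal_le_jacobson _)).symm.lt_top

-- In the long exact Ext sequence of 0 → M → M → M/xM → 0 the group of index i for M/xM sits between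
-- those of index i and i + 1 for M, so exactly one degree of vanishing is given up.
omit [IsNoetherianRing R] in
lemma ExtVanish.quotSMulTop {M : Type u} [AddCommGroup M] [Module R M] {n : ℕ} {x : R}
    (hx : IsSMulRegular M x) (h : ExtVanish R M (n + 1)) : ExtVanish R (QuotSMulTop x M) n := by
  intro i hi
  have zero1 := AddCommGrpCat.isZero_of_iff_subsingleton.mpr (h i (by omega))
  have zero2 := AddCommGrpCat.isZero_of_iff_subsingleton.mpr (h (i + 1) (by omega))
  have hx' : IsSMulRegular (ModuleCat.of R M) x := hx
  exact AddCommGrpCat.subsingleton_of_isZero <| ShortComplex.Exact.isZero_of_both_zeros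
    ((Ext.covariant_sequence_exact₃' (ModuleCat.of R (R ⧸ maximalIdeal R))
      hx'.smulShortComplex_shortExact) i (i + 1) rfl)
    (zero1.eq_zero_of_src _) (zero2.eq_zero_of_tgt _)

/-- Vanishing of Ext measures depth without naming a sequence. After division by the given sequence
xs it still yields some regular sequence of length n on the quotient, to which `length_le_coheight`
applies. -/
lemma ExtVanish.le_coheight {xs : List R} {M : Type u} [AddCommGroup M] [Module R M]
    [Module.Finite R M] {n : ℕ} (h : ExtVanish R M (n + xs.length)) (hxs : IsWeaklyRegular M xs)
    {Q : PrimeSpectrum R}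
    (hQ : Q.asIdeal ∈ associatedPrimes R (M ⧸ (Ideal.ofList xs • ⊤ : Submodule R M))) :
    (n : ℕ∞) ≤ Order.coheight Q := by
  induction xs generalizing M with
  | nil =>
    have e : (M ⧸ (Ideal.ofList ([] : List R) • ⊤ : Submodule R M)) ≃ₗ[R] M :=
      Submodule.quotEquivOfEqBot _ (by simp)
    rw [LinearEquiv.AssociatedPrimes.eq e] at hQ
    have : Nontrivial M := by
      by_contra hM
      rw [not_nontrivial_iff_subsingleton] at hM
      exact not_isAssociatedPrime_of_subsingleton hQ
    obtain ⟨rs, hlen, hmem, hreg⟩ := ModuleCat.exists_isRegular_of_exists_subsingleton_ext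
      (maximalIdeal R) n (ModuleCat.of R M) (smul_top_lt_top M)
      (ModuleCat.of R (R ⧸ maximalIdeal R)) support_residue (fun i hi => h i (by simpa using hi))
    rw [← hlen]
    exact length_le_coheight hreg.toIsWeaklyRegular hmem hQ
  | cons x xs ih =>
    rw [isWeaklyRegular_cons_iff] at hxs
    rw [LinearEquiv.AssociatedPrimes.eq (Submodule.quotOfListConsSMulTopEquivQuotSMulTopInner M x xs)] at hQ
    exact ih (ExtVanish.quotSMulTop hxs.1 (by simpa [add_assoc] using h)) hxs.2 hQ

lemma extVanish_of_isRegular {M : Type u} [AddCommGroup M] [Module R M]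
    [Module.Finite R M] {rs : List R} (hreg : IsRegular M rs)
    (hmem : ∀ r ∈ rs, r ∈ maximalIdeal R) : ExtVanish R M rs.length := by
  have : Nontrivial M := hreg.nontrivial
  exact ModuleCat.subsingleton_ext_of_exists_isRegular (maximalIdeal R)
    (ModuleCat.of R (R ⧸ maximalIdeal R)) support_residue.subset (ModuleCat.of R M)
    (smul_top_lt_top M) rs hmem hreg

omit [IsLocalRing R] in
/-- The dimension of `R_q / Q R_q` is at most the number of elements `rs` for which `q` is minimal
over `Q + (rs)`. -/
lemma coheight_map_le {q Q : Ideal R} [q.IsPrime] (rs : List R)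
    (hq : q ∈ (Q ⊔ Ideal.ofList rs).minimalPrimes)
    [hQ : (Q.map (algebraMap R (Localization.AtPrime q))).IsPrime] :
    Order.coheight (⟨Q.map (algebraMap R (Localization.AtPrime q)), hQ⟩ :
      PrimeSpectrum (Localization.AtPrime q)) ≤ rs.length := by
  classical
  set L := Localization.AtPrime q
  set Q' := Q.map (algebraMap R L) with hQ'
  have : IsLocalRing (L ⧸ Q') := IsLocalRing.of_surjective' (Ideal.Quotient.mk Q')
    Ideal.Quotient.mk_surjective
  have : IsNoetherianRing L := IsLocalization.isNoetherianRing q.primeCompl L inferInstance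
  -- Both sides are the dimension of L / Q'; the height of the maximal ideal is the form that
  -- Krull's height theorem bounds.
  have key : (Order.coheight (⟨Q', hQ⟩ : PrimeSpectrum L) : WithBot ℕ∞) =
      ((maximalIdeal (L ⧸ Q')).height : WithBot ℕ∞) := by
    rw [IsLocalRing.maximalIdeal_height_eq_ringKrullDim, ringKrullDim_quotient,
      Order.coheight_eq_krullDim_Ici]
    congr 1
  rw [WithBot.coe_inj.mp key]
  let f : R →+* L ⧸ Q' := (Ideal.Quotient.mk Q').comp (algebraMap R L)
  have hmin : maximalIdeal (L ⧸ Q') ∈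
      (Ideal.span ((rs.map f).toFinset : Set (L ⧸ Q'))).minimalPrimes := by
    refine ⟨⟨inferInstance, ?_⟩, ?_⟩
    · rw [Ideal.span_le]
      intro x hx
      simp only [List.coe_toFinset, List.mem_map, Set.mem_ofPred_eq] at hx
      obtain ⟨r, hr, rfl⟩ := hx
      have hrq : r ∈ q := hq.1.2 (Ideal.mem_sup_right (Ideal.subset_span hr))
      rw [SetLike.mem_coe, IsLocalRing.mem_maximalIdeal, mem_nonunits_iff]
      intro hu
      obtain ⟨w, hw⟩ := isUnit_iff_exists_inv.mp hu
      obtain ⟨x, rfl⟩ := Ideal.Quotient.mk_surjective w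
      have h1 : algebraMap R L r * x - 1 ∈ Q' := by
        rw [← Ideal.Quotient.eq_zero_iff_mem, map_sub, map_mul, map_one, sub_eq_zero]
        exact hw
      have h2 : algebraMap R L r ∈ maximalIdeal L :=
        (IsLocalization.AtPrime.to_map_mem_maximal_iff L q r).mpr hrq
      have h3 := sub_mem (Ideal.mul_mem_right x _ h2) (IsLocalRing.le_maximalIdeal hQ.ne_top h1)
      exact (maximalIdeal.isMaximal L).ne_top ((Ideal.eq_top_iff_one _).mpr (by simp at h3))
    · rintro p ⟨hp, hle⟩ -
      have hcomap : q ≤ p.comap f := by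
        refine hq.2 ⟨Ideal.IsPrime.comap f, sup_le ?_ ?_⟩ ?_
        · intro r hr
          have : f r = 0 := Ideal.Quotient.eq_zero_iff_mem.mpr (Ideal.mem_map_of_mem _ hr)
          rw [Ideal.mem_comap, this]
          exact zero_mem _
        · rw [Ideal.span_le]
          intro r hr
          exact hle (Ideal.subset_span (by simpa using ⟨r, hr, rfl⟩))
        · intro r hr
          by_contra hrq
          refine hp.ne_top (Ideal.eq_top_of_isUnit_mem _ hr ?_)
          exact ((IsLocalization.AtPrime.isUnit_to_map_iff L q r).mpr hrq).map (Ideal.Quotient.mk Q')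
      intro x hx
      obtain ⟨y, rfl⟩ := Ideal.Quotient.mk_surjective x
      obtain ⟨r, s, rfl⟩ := IsLocalization.exists_mk'_eq q.primeCompl y
      have hrq : r ∈ q := by
        by_contra hrq
        rw [IsLocalRing.mem_maximalIdeal, mem_nonunits_iff] at hx
        exact hx (((IsLocalization.AtPrime.isUnit_mk'_iff L q r s).mpr hrq).map _)
      rw [IsLocalization.mk'_eq_mul_mk'_one, map_mul]
      exact Ideal.mul_mem_right _ _ (hcomap hrq)
  refine (Ideal.height_le_card_of_mem_minimalPrimes_span_finset hmin).trans ?_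
  exact_mod_cast (List.toFinset_card_le (rs.map f)).trans (by simp)

omit [IsLocalRing R] in
/-- If each local ring of `Spec R` at a point of `V(P_1, …, P_l)` that specializes to `𝔪` has depth
at least `l`, then `P_1, …, P_l` is a regular sequence at `𝔪`. -/
theorem exists_notMem_mul_mem_of_depth (Ps : List R) (𝔪 : Ideal R) [𝔪.IsPrime]
    (hPs : ∀ r ∈ Ps, r ∈ 𝔪)
    (hdepth : ∀ (q : Ideal R) [q.IsPrime], q ≤ 𝔪 → (∀ r ∈ Ps, r ∈ q) →
      ∃ rs : List (Localization.AtPrime q), rs.length = Ps.length ∧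
        (∀ r ∈ rs, r ∈ maximalIdeal (Localization.AtPrime q)) ∧
        IsRegular (Localization.AtPrime q) rs)
    (j : ℕ) (hj : j < Ps.length) (y : R) (hy : Ps[j] * y ∈ Ideal.ofList (Ps.take j)) :
    ∃ u ∉ 𝔪, u * y ∈ Ideal.ofList (Ps.take j) := by
  induction j using Nat.strong_induction_on generalizing y with
  | _ j ih =>
  -- Otherwise (J : y) lies in 𝔪, and a minimal prime Q of it is associated to R/J and contains
  -- Ps[j]. Take q minimal over Q and the later members of Ps. The dimension of R_q / Q R_q is then
  -- at most length - (j + 1) by Krull, but at least length - j by the depth of R_q / J R_q.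
  by_contra! hcon
  set J := Ideal.ofList (Ps.take j) with hJ
  have hcolon : ∀ r, r ∈ Submodule.colon J {y} ↔ r * y ∈ J := fun r => by
    rw [Submodule.mem_colon_singleton, smul_eq_mul]
  have hle : Submodule.colon J {y} ≤ 𝔪 := by
    intro r hr
    by_contra hr'
    exact hcon r hr' ((hcolon r).mp hr)
  obtain ⟨Q, hQmin, hQm⟩ := Ideal.exists_minimalPrimes_le hle
  have hQprime : Q.IsPrime := hQmin.1.1
  have hann : Module.annihilator R (R ∙ (Ideal.Quotient.mk J y)) = Submodule.colon J {y} := by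
    ext r
    rw [Submodule.mem_annihilator_span_singleton, hcolon, ← Ideal.Quotient.eq_zero_iff_mem, map_mul]
    rfl
  have hQass : Q ∈ associatedPrimes R (R ⧸ J) := by
    have h1 : Q ∈ associatedPrimes R (R ∙ (Ideal.Quotient.mk J y)) := by
      apply Module.associatedPrimes.minimalPrimes_annihilator_subset_associatedPrimes
      rw [hann]
      exact hQmin
    exact associatedPrimes.subset_of_injective (Submodule.subtype_injective _) h1
  obtain ⟨-, w, hw⟩ := isAssociatedPrime_iff.mp hQass
  obtain ⟨v, rfl⟩ := Ideal.Quotient.mk_surjective w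
  have memQ : ∀ r, r ∈ Q ↔ r * v ∈ J := by
    intro r
    rw [hw, Submodule.mem_colon_singleton, Submodule.mem_bot, ← Ideal.Quotient.eq_zero_iff_mem,
      map_mul]
    rfl
  have hJQ : J ≤ Q := fun r hr => (memQ r).mpr (Ideal.mul_mem_right _ _ hr)
  have hPj : Ps[j] ∈ Q := hQmin.1.2 ((hcolon _).mpr hy)
  have hle2 : Q ⊔ Ideal.ofList (Ps.drop (j + 1)) ≤ 𝔪 := by
    refine sup_le hQm ?_
    rw [Ideal.span_le]
    intro r hr
    exact hPs r (List.mem_of_mem_drop hr)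
  obtain ⟨q, hqmin, hqm⟩ := Ideal.exists_minimalPrimes_le hle2
  have hqprime : q.IsPrime := hqmin.1.1
  have hQq : Q ≤ q := le_sup_left.trans hqmin.1.2
  have hPq : ∀ r ∈ Ps, r ∈ q := by
    intro r hr
    have h1 : Ps = Ps.take j ++ Ps[j] :: Ps.drop (j + 1) := by simp
    rw [h1, List.mem_append, List.mem_cons] at hr
    rcases hr with hr | rfl | hr
    · exact hQq (hJQ (Ideal.subset_span hr))
    · exact hQq hPj
    · exact hqmin.1.2 (Ideal.mem_sup_right (Ideal.subset_span hr))
  obtain ⟨rs, hlen, hmem, hreg⟩ := hdepth q hqm hPq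
  let L := Localization.AtPrime q
  have hQL : (Q.map (algebraMap R L)).IsPrime := by
    refine IsLocalization.isPrime_of_isPrime_disjoint q.primeCompl L Q hQprime ?_
    rw [Set.disjoint_left]
    exact fun r hr hr' => hr (hQq hr')
  -- The induction hypothesis gives multipliers outside 𝔪; they are outside q as well, hence units
  -- in L.
  have hweak : IsWeaklyRegular L ((Ps.take j).map (algebraMap R L)) := by
    constructor
    intro i hi
    rw [isSMulRegular_quotient_iff_mem_of_smul_mem]
    intro x hx
    simp only [List.length_map, List.length_take, lt_inf_iff] at hi
    rw [← List.map_take, smul_eq_mul, Ideal.mul_top, List.take_take, min_eq_left hi.1.le,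
      ← Ideal.map_ofList] at hx ⊢
    rw [List.getElem_map, List.getElem_take] at hx
    obtain ⟨r, s, rfl⟩ := IsLocalization.exists_mk'_eq q.primeCompl x
    rw [smul_eq_mul, IsLocalization.mul_mk'_eq_mk'_of_mul, IsLocalization.mk'_mem_map_algebraMap_iff]
      at hx
    rw [IsLocalization.mk'_mem_map_algebraMap_iff]
    obtain ⟨u, hu, hur⟩ := hx
    obtain ⟨u', hu', hur'⟩ := ih i hi.1 hi.2 (u * r) (by convert hur using 1; ring)
    refine ⟨u' * u, mul_mem (fun h => hu' (hqm h)) hu, by rwa [mul_assoc]⟩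
  have hass : Q.map (algebraMap R L) ∈ associatedPrimes L
      (L ⧸ (Ideal.ofList ((Ps.take j).map (algebraMap R L)) • ⊤ : Submodule L L)) := by
    rw [smul_eq_mul, Ideal.mul_top, ← Ideal.map_ofList, AssociatedPrimes.mem_iff,
      isAssociatedPrime_iff]
    refine ⟨hQL, Ideal.Quotient.mk _ (algebraMap R L v), ?_⟩
    ext x
    rw [Submodule.mem_colon_singleton, Submodule.mem_bot]
    change _ ↔ Ideal.Quotient.mk _ (x * algebraMap R L v) = 0
    rw [Ideal.Quotient.eq_zero_iff_mem]
    obtain ⟨r, s, rfl⟩ := IsLocalization.exists_mk'_eq q.primeCompl x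
    rw [mul_comm (IsLocalization.mk' _ _ _), IsLocalization.mul_mk'_eq_mk'_of_mul,
      IsLocalization.mk'_mem_map_algebraMap_iff, IsLocalization.mk'_mem_map_algebraMap_iff]
    refine exists_congr fun u => and_congr_right fun _ => ?_
    rw [memQ, mul_comm v, mul_assoc]
  have hext : ExtVanish L L ((Ps.length - j) + ((Ps.take j).map (algebraMap R L)).length) := by
    have := extVanish_of_isRegular hreg hmem
    rw [hlen] at this
    convert this using 1
    simp; omega
  have h1 := hext.le_coheight hweak (Q := ⟨_, hQL⟩) hass
  have h2 := coheight_map_le (Ps.drop (j + 1)) hqmin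
  have h3 := h1.trans h2
  rw [List.length_drop] at h3
  have h4 : Ps.length - j ≤ Ps.length - (j + 1) := by exact_mod_cast h3
  omega

end Depth
end

/-! ### The bigraded coordinate ring: monomials, column forms and syzygies of powers of s and t -/

noncomputable section

namespace Scroll

section Weighted

variable {K σ : Type*} [Field K]

lemma weightedHomogeneousComponent_mul_left {w : σ → ℤ} {g : MvPolynomial σ K} {m : ℤ}
    (hg : IsWeightedHomogeneous w g m) (n : ℤ) (f : MvPolynomial σ K) :
    weightedHomogeneousComponent w (m + n) (g * f) =
      g * weightedHomogeneousComponent w n f := by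
  induction f using MvPolynomial.induction_on' with
  | monomial v c =>
    have h1 : IsWeightedHomogeneous w (monomial v c) (Finsupp.weight w v) :=
      isWeightedHomogeneous_monomial w v c rfl
    rw [weightedHomogeneousComponent_of_mem (hg.mul h1), weightedHomogeneousComponent_of_mem h1]
    by_cases h : n = Finsupp.weight w v
    · simp [h]
    · simp [h]
  | add p q hp hq => rw [mul_add, map_add, map_add, hp, hq, mul_add]

lemma weightedHomogeneousComponent_mul_left' {w : σ → ℤ} {g : MvPolynomial σ K} {m : ℤ}
    (hg : IsWeightedHomogeneous w g m) (n : ℤ) (f : MvPolynomial σ K) :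
    weightedHomogeneousComponent w n (g * f) =
      g * weightedHomogeneousComponent w (n - m) f := by
  rw [← weightedHomogeneousComponent_mul_left hg, add_sub_cancel]

lemma IsWeightedHomogeneous.component_of_isWeightedHomogeneous {w w' : σ → ℤ}
    {f : MvPolynomial σ K} {n : ℤ} (hf : IsWeightedHomogeneous w f n) (m : ℤ) :
    IsWeightedHomogeneous w (weightedHomogeneousComponent w' m f) n := by
  classical
  intro v hv
  rw [coeff_weightedHomogeneousComponent] at hv
  split_ifs at hv with h
  · exact hf hv
  · exact absurd rfl hv

lemma IsWeightedHomogeneous.of_mul_left {w : σ → ℤ} {g f : MvPolynomial σ K} {m n : ℤ}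
    (hg : IsWeightedHomogeneous w g m) (hg0 : g ≠ 0) (h : IsWeightedHomogeneous w (g * f) (m + n)) :
    IsWeightedHomogeneous w f n := by
  have h1 := weightedHomogeneousComponent_mul_left hg n f
  rw [weightedHomogeneousComponent_eq_self h] at h1
  rw [mul_left_cancel₀ hg0 h1]
  exact weightedHomogeneousComponent_isWeightedHomogeneous _ _

lemma monomial_eq_mul_of_le {u v : σ →₀ ℕ} (h : u ≤ v) (c : K) :
    monomial v c = monomial u 1 * monomial (v - u) c := by
  rw [monomial_mul, one_mul, add_tsub_cancel_of_le h]

lemma weight_tsub {w : σ → ℤ} {u v : σ →₀ ℕ} (h : u ≤ v) :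
    Finsupp.weight w (v - u) = Finsupp.weight w v - Finsupp.weight w u := by
  rw [eq_sub_iff_add_eq, ← map_add, tsub_add_cancel_of_le h]

end Weighted

variable {K : Type*} [Field K] {k : ℕ}

/-- The weights that define the degree in the fibre coordinates. -/
def fibWeight (k : ℕ) : Fin 2 ⊕ Fin k → ℤ := Sum.elim (fun _ => 0) (fun _ => 1)

/-- The weights that define the total degree. -/
def totWeight (d : Fin k → ℕ) : Fin 2 ⊕ Fin k → ℤ := Sum.elim (fun _ => 1) (fun i => -(d i : ℤ))

/-- `f` is homogeneous of degree `n` in the fibre coordinates. -/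
abbrev Fib (n : ℤ) (f : Cox K k) : Prop := IsWeightedHomogeneous (fibWeight k) f n

/-- `f` is homogeneous of total degree `e`. -/
abbrev Tot (d : Fin k → ℕ) (e : ℤ) (f : Cox K k) : Prop := IsWeightedHomogeneous (totWeight d) f e

variable {d : Fin k → ℕ}

lemma weight_bidegree (d : Fin k → ℕ) (v : Fin 2 ⊕ Fin k →₀ ℕ) :
    Finsupp.weight (bidegree d) v =
      (Finsupp.weight (fibWeight k) v, Finsupp.weight (totWeight d) v) := by
  induction v using Finsupp.induction_linear with
  | zero => simp; rfl
  | add u v hu hv => simp only [map_add, hu, hv, Prod.mk_add_mk]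
  | single i n =>
    simp only [Finsupp.weight_single]
    rcases i with i | i <;> simp [bidegree, fibWeight, totWeight]

lemma IsDivisorEquation.fib {a b : ℕ} {P : Cox K k} (h : IsDivisorEquation d a b P) :
    Fib (a : ℤ) P := fun v hv => by
  have := h hv
  rw [weight_bidegree] at this
  exact (Prod.ext_iff.mp this).1

lemma IsDivisorEquation.tot {a b : ℕ} {P : Cox K k} (h : IsDivisorEquation d a b P) :
    Tot d (-(b : ℤ)) P := fun v hv => by
  have := h hv
  rw [weight_bidegree] at this
  exact (Prod.ext_iff.mp this).2

lemma fib_s : Fib 0 (s K k) := isWeightedHomogeneous_X _ _ _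
lemma fib_t : Fib 0 (t K k) := isWeightedHomogeneous_X _ _ _
lemma fib_z (i : Fin k) : Fib 1 (z K i) := isWeightedHomogeneous_X _ _ _
lemma tot_s (d : Fin k → ℕ) : Tot d 1 (s K k) := isWeightedHomogeneous_X _ _ _
lemma tot_t (d : Fin k → ℕ) : Tot d 1 (t K k) := isWeightedHomogeneous_X _ _ _
lemma tot_z (d : Fin k → ℕ) (i : Fin k) : Tot d (-(d i : ℤ)) (z K i) :=
  isWeightedHomogeneous_X _ _ _

lemma fib_st (p q : ℕ) : Fib 0 (s K k ^ p * t K k ^ q) := by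
  simpa using (fib_s.pow p).mul (fib_t (K := K).pow q)

lemma tot_st (d : Fin k → ℕ) (p q : ℕ) : Tot d (p + q) (s K k ^ p * t K k ^ q) := by
  simpa using ((tot_s d).pow p).mul ((tot_t (K := K) d).pow q)

lemma s_prime : Prime (s K k) := X_prime
lemma t_prime : Prime (t K k) := X_prime
lemma z_prime (i : Fin k) : Prime (z K i) := X_prime
lemma s_ne_zero : s K k ≠ 0 := s_prime.ne_zero
lemma t_ne_zero : t K k ≠ 0 := t_prime.ne_zero

lemma not_t_dvd_s : ¬ t K k ∣ s K k := by simp [s, t, X_dvd_X]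
lemma not_s_dvd_t : ¬ s K k ∣ t K k := by simp [s, t, X_dvd_X]
lemma not_t_dvd_z (i : Fin k) : ¬ t K k ∣ z K i := by simp [z, t, X_dvd_X]
lemma not_s_dvd_z (i : Fin k) : ¬ s K k ∣ z K i := by simp [z, s, X_dvd_X]

lemma st_eq_monomial (p q : ℕ) : s K k ^ p * t K k ^ q =
    monomial (Finsupp.single (Sum.inl 0) p + Finsupp.single (Sum.inl 1) q) 1 := by
  rw [s, t, X_pow_eq_monomial, X_pow_eq_monomial, monomial_mul, one_mul]

lemma single_add_single_le {v : Fin 2 ⊕ Fin k →₀ ℕ} {p q : ℕ} (hp : p ≤ v (Sum.inl 0))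
    (hq : q ≤ v (Sum.inl 1)) :
    Finsupp.single (Sum.inl 0) p + Finsupp.single (Sum.inl 1) q ≤ v := by
  intro x
  rcases x with x | x
  · fin_cases x <;> simpa
  · simp

lemma weight_tot_eq (d : Fin k → ℕ) (v : Fin 2 ⊕ Fin k →₀ ℕ) :
    Finsupp.weight (totWeight d) v =
      v (Sum.inl 0) + v (Sum.inl 1) - ∑ i, (d i : ℤ) * v (Sum.inr i) := by
  rw [Finsupp.weight_apply, Finsupp.sum_fintype _ _ (by simp), Fintype.sum_sum_type]
  simp [totWeight, Fin.sum_univ_two, mul_comm, sub_eq_add_neg]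

lemma weight_fib_eq (v : Fin 2 ⊕ Fin k →₀ ℕ) :
    Finsupp.weight (fibWeight k) v = ∑ i, (v (Sum.inr i) : ℤ) := by
  rw [Finsupp.weight_apply, Finsupp.sum_fintype _ _ (by simp), Fintype.sum_sum_type]
  simp [fibWeight]

lemma weight_tot_le (d : Fin k → ℕ) (v : Fin 2 ⊕ Fin k →₀ ℕ) :
    Finsupp.weight (totWeight d) v ≤ v (Sum.inl 0) + v (Sum.inl 1) := by
  rw [weight_tot_eq]
  have : 0 ≤ ∑ i, (d i : ℤ) * v (Sum.inr i) := Finset.sum_nonneg fun i _ => by positivity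
  omega

/-- Monomials of large total degree are divisible by `s ^ p` or by `t ^ q`. -/
lemma Tot.exists_eq_add {e : ℤ} {f : Cox K k} (hf : Tot d e f) (p q : ℕ) (h : (p + q : ℤ) ≤ e + 1) :
    ∃ f₁ f₂ : Cox K k, f = s K k ^ p * f₁ + t K k ^ q * f₂ ∧ Tot d (e - p) f₁ ∧
      Tot d (e - q) f₂ := by
  induction hf using IsWeightedHomogeneous.induction_on with
  | zero => exact ⟨0, 0, by simp, isWeightedHomogeneous_zero .., isWeightedHomogeneous_zero ..⟩
  | add f g hf hg ihf ihg =>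
    obtain ⟨f₁, f₂, h, h₁, h₂⟩ := ihf
    obtain ⟨g₁, g₂, h', h₁', h₂'⟩ := ihg
    exact ⟨f₁ + g₁, f₂ + g₂, by rw [h, h']; ring, h₁.add h₁', h₂.add h₂'⟩
  | monomial v r hr =>
    -- The z^{(i)} never raise the total degree, so the exponents of s and t add up to at least e ≥
    -- p + q - 1; hence one of them reaches its bound.
    have hle := weight_tot_le d v
    rw [hr] at hle
    rcases le_or_gt p (v (Sum.inl 0)) with hp | hp
    · have hu := single_add_single_le (v := v) (q := 0) hp (by simp)
      refine ⟨monomial (v - (Finsupp.single (Sum.inl 0) p + Finsupp.single (Sum.inl 1) 0)) r, 0, ?_,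
        isWeightedHomogeneous_monomial _ _ r ?_, isWeightedHomogeneous_zero ..⟩
      · rw [monomial_eq_mul_of_le hu, ← st_eq_monomial]; simp
      · rw [weight_tsub hu, hr, weight_tot_eq]; simp
    · have hu := single_add_single_le (v := v) (p := 0) (q := q) (by simp) (by omega)
      refine ⟨0, monomial (v - (Finsupp.single (Sum.inl 0) 0 + Finsupp.single (Sum.inl 1) q)) r, ?_,
        isWeightedHomogeneous_zero .., isWeightedHomogeneous_monomial _ _ r ?_⟩
      · rw [monomial_eq_mul_of_le hu, ← st_eq_monomial]; simp
      · rw [weight_tsub hu, hr, weight_tot_eq]; simp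

/-- The exponents of s and t in each monomial add up to at least b, so some s^(b-m) t^m divides it.
The choice of m uses as many factors t as possible. -/
lemma Tot.exists_eq_sum {e : ℤ} (he : 0 ≤ e) (b : ℕ) {f : Cox K k} (hf : Tot d (e + b) f) :
    ∃ c : ℕ → Cox K k, (∀ m, Tot d e (c m)) ∧
      f = ∑ m ∈ Finset.range (b + 1), s K k ^ (b - m) * t K k ^ m * c m := by
  induction hf using IsWeightedHomogeneous.induction_on with
  | zero => exact ⟨0, fun _ => isWeightedHomogeneous_zero .., by simp⟩
  | add f g hf hg ihf ihg =>
    obtain ⟨c, hc, h⟩ := ihf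
    obtain ⟨c', hc', h'⟩ := ihg
    refine ⟨c + c', fun m => (hc m).add (hc' m), ?_⟩
    rw [h, h', ← Finset.sum_add_distrib]
    simp [mul_add]
  | monomial v r hr =>
    have hle := weight_tot_le d v
    rw [hr] at hle
    set m := min (v (Sum.inl 1)) b with hm
    have hu := single_add_single_le (v := v) (p := b - m) (q := m) (by omega) (by omega)
    classical
    refine ⟨Pi.single m (monomial (v - (Finsupp.single (Sum.inl 0) (b - m) +
      Finsupp.single (Sum.inl 1) m)) r), fun n => ?_, ?_⟩
    rotate_left
    · rw [Finset.sum_eq_single m]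
      · rw [monomial_eq_mul_of_le hu, ← st_eq_monomial, Pi.single_eq_same]
      · intro n _ hn
        simp [hn]
      · simp [hm]
    · by_cases hn : n = m
      · rw [hn, Pi.single_eq_same]
        apply isWeightedHomogeneous_monomial
        rw [weight_tsub hu, hr, weight_tot_eq]
        simp
        omega
      · rw [Pi.single_eq_of_ne hn]
        exact isWeightedHomogeneous_zero ..

variable (K d) in
/-- The section `z^{(i)} s^{d_i - 1 - j} t^j` of total degree `-1` that belongs to a column. -/
def colForm (α : Σ i : Fin k, Fin (d i)) : Cox K k :=
  z K α.1 * (s K k ^ (d α.1 - 1 - α.2) * t K k ^ (α.2 : ℕ))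

lemma fib_colForm (α : Σ i : Fin k, Fin (d i)) : Fib 1 (colForm K d α) := by
  have := (fib_z α.1).mul (fib_st (K := K) (k := k) (d α.1 - 1 - α.2) α.2)
  rwa [add_zero] at this

lemma tot_colForm (α : Σ i : Fin k, Fin (d i)) : Tot d (-1) (colForm K d α) := by
  have := (tot_z d α.1).mul (tot_st (K := K) d (d α.1 - 1 - α.2) α.2)
  have h : -(d α.1 : ℤ) + (((d α.1 - 1 - α.2 : ℕ) : ℤ) + (α.2 : ℕ)) = -1 := by
    have := α.2.2
    omega
  rwa [h] at this

lemma colForm_ne_zero (α : Σ i : Fin k, Fin (d i)) : colForm K d α ≠ 0 :=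
  mul_ne_zero (z_prime _).ne_zero
    (mul_ne_zero (pow_ne_zero _ s_ne_zero) (pow_ne_zero _ t_ne_zero))

/-- Negative total degree forces a z^{(i)} with d_i > 0 into every monomial. The exponents of s and
t then add up to at least d_i - 1, which leaves room for a column form with cofactor of total degree
0. -/
lemma Tot.exists_eq_sum_colForm {f : Cox K k} (hf : Tot d (-1) f) :
    ∃ c : (Σ i : Fin k, Fin (d i)) → Cox K k, (∀ α, Tot d 0 (c α)) ∧
      f = ∑ α, colForm K d α * c α := by
  classical
  induction hf using IsWeightedHomogeneous.induction_on with
  | zero => exact ⟨0, fun _ => isWeightedHomogeneous_zero .., by simp⟩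
  | add f g hf hg ihf ihg =>
    obtain ⟨c, hc, h⟩ := ihf
    obtain ⟨c', hc', h'⟩ := ihg
    refine ⟨c + c', fun m => (hc m).add (hc' m), ?_⟩
    rw [h, h', ← Finset.sum_add_distrib]
    simp [mul_add]
  | monomial v r hr =>
    rw [weight_tot_eq] at hr
    have hpos : ∃ i, (d i : ℤ) * v (Sum.inr i) ≠ 0 := by
      by_contra! h
      simp [h] at hr
      omega
    obtain ⟨i, hi⟩ := hpos
    have hdi : 0 < d i := Nat.pos_of_ne_zero fun h => hi (by simp [h])
    have hvi : 0 < v (Sum.inr i) := Nat.pos_of_ne_zero fun h => hi (by simp [h])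
    have hle : (d i : ℤ) ≤ ∑ i, (d i : ℤ) * v (Sum.inr i) := by
      refine le_trans ?_ (Finset.single_le_sum (fun j _ => by positivity) (Finset.mem_univ i))
      exact le_mul_of_one_le_right (by positivity) (by exact_mod_cast hvi)
    set j := min (v (Sum.inl 1)) (d i - 1) with hj
    let α : Σ i : Fin k, Fin (d i) := ⟨i, ⟨j, by omega⟩⟩
    have hu : Finsupp.single (Sum.inr i) 1 + (Finsupp.single (Sum.inl 0) (d i - 1 - j) +
        Finsupp.single (Sum.inl 1) j) ≤ v := by
      intro x
      rcases x with x | x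
      · fin_cases x <;> simp [hj]
        omega
      · by_cases hx : i = x
        · subst hx; simp; omega
        · simp [hx]
    have hcol : colForm K d α = monomial (Finsupp.single (Sum.inr i) 1 +
        (Finsupp.single (Sum.inl 0) (d i - 1 - j) + Finsupp.single (Sum.inl 1) j)) 1 := by
      rw [colForm, st_eq_monomial, z, X, monomial_mul, one_mul]
    obtain ⟨c, heq⟩ : ∃ c, monomial v r = colForm K d α * c :=
      ⟨_, (monomial_eq_mul_of_le hu r).trans (by rw [hcol])⟩
    refine ⟨Pi.single α c, fun β => ?_, ?_⟩
    rotate_left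
    · rw [Finset.sum_eq_single α]
      · rw [Pi.single_eq_same]; exact heq
      · intro β _ hβ
        simp [hβ]
      · simp
    · by_cases hβ : β = α
      · rw [hβ, Pi.single_eq_same]
        refine IsWeightedHomogeneous.of_mul_left (tot_colForm α) (colForm_ne_zero α) ?_
        rw [← heq]
        exact isWeightedHomogeneous_monomial _ _ _ (by rw [weight_tot_eq]; simpa using hr)
      · rw [Pi.single_eq_of_ne hβ]
        exact isWeightedHomogeneous_zero ..

/-- The syzygies of `s^b, s^{b-1}t, …, t^b` are generated by the obvious ones. -/
lemma exists_eq_of_sum_eq_zero (b : ℕ) (Q : ℕ → Cox K k)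
    (h : ∑ m ∈ Finset.range (b + 1), s K k ^ (b - m) * t K k ^ m * Q m = 0) :
    ∃ N : ℕ → Cox K k, N 0 = 0 ∧ N (b + 1) = 0 ∧
      ∀ m ≤ b, Q m = t K k * N (m + 1) - s K k * N m := by
  induction b generalizing Q with
  | zero => exact ⟨0, rfl, rfl, fun m hm => by
      obtain rfl : m = 0 := by omega
      simpa using h⟩
  | succ b ih =>
    rw [Finset.sum_range_succ'] at h
    have h2 : ∀ m ∈ Finset.range (b + 1), s K k ^ (b + 1 - (m + 1)) * t K k ^ (m + 1) * Q (m + 1) =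
        t K k * (s K k ^ (b - m) * t K k ^ m * Q (m + 1)) := fun m _ => by
      rw [Nat.add_sub_add_right]; ring
    rw [Finset.sum_congr rfl h2, ← Finset.mul_sum] at h
    simp only [tsub_zero, pow_zero, mul_one] at h
    -- All terms after the first contain t, so Q 0 = t n for some n. Adding s n to Q 1 gives a
    -- syzygy of the next shorter length.
    have hdvd : t K k ∣ s K k ^ (b + 1) * Q 0 := by
      refine ⟨-∑ m ∈ Finset.range (b + 1), s K k ^ (b - m) * t K k ^ m * Q (m + 1), ?_⟩
      linear_combination h
    obtain ⟨n, hn⟩ := (t_prime.dvd_or_dvd hdvd).resolve_left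
      fun h' => not_t_dvd_s (t_prime.dvd_of_dvd_pow h')
    obtain ⟨N, hN0, hN1, hN⟩ := ih (fun m => Q (m + 1) + if m = 0 then s K k * n else 0) (by
      apply mul_left_cancel₀ (t_ne_zero (K := K) (k := k))
      simp only [mul_add, Finset.sum_add_distrib, mul_ite, mul_zero, Finset.sum_ite_eq',
        Finset.mem_range]
      simp only [Nat.zero_lt_succ, if_true, tsub_zero, pow_zero, mul_one]
      rw [hn] at h
      linear_combination h)
    refine ⟨fun m => match m with
      | 0 => 0
      | m + 1 => N m + if m = 0 then n else 0, rfl, by simp [hN1], fun m hm => ?_⟩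
    rcases m with _ | m
    · simp [hn, hN0]
    · have := hN m (by omega)
      simp only [Nat.add_eq_zero_iff, one_ne_zero, and_false, if_false, add_zero]
      split_ifs at this ⊢ with h0
      · linear_combination this
      · linear_combination this

end Scroll
end

/-! ### Regularity of the P_i off s = 0 or t = 0, and vanishing of local cohomology along (s, t) -/

noncomputable section

namespace Scroll

section Ideals

variable {K σ : Type*} [Field K]

/-- The components of the elements of an ideal generated by homogeneous elements lie in it. -/
lemma weightedHomogeneousComponent_mem_span {w : σ → ℤ} {T : Set (MvPolynomial σ K)}
    (hT : ∀ g ∈ T, ∃ m : ℤ, IsWeightedHomogeneous w g m) {f : MvPolynomial σ K}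
    (hf : f ∈ Ideal.span T) (n : ℤ) : weightedHomogeneousComponent w n f ∈ Ideal.span T := by
  induction hf using Submodule.span_induction generalizing n with
  | mem g hg =>
    obtain ⟨m, hm⟩ := hT g hg
    classical
    rw [weightedHomogeneousComponent_of_mem hm]
    split_ifs
    · exact Ideal.subset_span hg
    · exact zero_mem _
  | zero => simp
  | add f g _ _ hf hg => rw [map_add]; exact add_mem (hf n) (hg n)
  | smul r f _ hf =>
    rw [smul_eq_mul, mul_comm]
    induction r using MvPolynomial.induction_on' with
    | monomial v c =>
      rw [mul_comm, weightedHomogeneousComponent_mul_left'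
        (isWeightedHomogeneous_monomial w v c rfl)]
      exact Ideal.mul_mem_left _ _ (hf _)
    | add p q hp hq => rw [mul_add, map_add]; exact add_mem hp hq

lemma mem_of_forall_weightedHomogeneousComponent_mem {w : σ → ℤ}
    {N : Submodule K (MvPolynomial σ K)} {f : MvPolynomial σ K}
    (h : ∀ n, weightedHomogeneousComponent w n f ∈ N) : f ∈ N := by
  rw [← sum_weightedHomogeneousComponent w f,
    finsum_eq_sum _ (weightedHomogeneousComponent_finsupp f)]
  exact sum_mem fun n _ => h n

lemma X_mul_mem_span_X_image {T : Set σ} {i : σ} (hi : i ∉ T) {f : MvPolynomial σ K}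
    (h : X i * f ∈ Ideal.span (X '' T : Set (MvPolynomial σ K))) :
    f ∈ Ideal.span (X '' T : Set (MvPolynomial σ K)) := by
  rw [mem_ideal_span_X_image] at h ⊢
  intro m hm
  obtain ⟨j, hj, hmj⟩ := h (Finsupp.single i 1 + m) (by
    rw [mem_support_iff, coeff_X_mul]
    exact mem_support_iff.mp hm)
  refine ⟨j, hj, ?_⟩
  have : i ≠ j := fun h => hi (h ▸ hj)
  simpa [this] using hmj

/-- Used for the variables z^{(i)}: it provides the depth at primes that contain all of them. -/
lemma isWeaklyRegular_X {n : ℕ} {f : Fin n → σ} (hf : Function.Injective f) :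
    RingTheory.Sequence.IsWeaklyRegular (MvPolynomial σ K)
      (List.ofFn fun i => (X (f i) : MvPolynomial σ K)) := by
  constructor
  intro i hi
  rw [isSMulRegular_quotient_iff_mem_of_smul_mem]
  intro x hx
  simp only [List.length_ofFn] at hi
  have h1 : Ideal.ofList ((List.ofFn fun i => (X (f i) : MvPolynomial σ K)).take i) =
      Ideal.span (X '' (f '' {j | j.1 < i})) := by
    refine congrArg Ideal.span (Set.ext fun x => ?_)
    simp only [List.mem_take_iff_getElem, List.getElem_ofFn, Set.mem_image, Set.mem_ofPred_eq,
      List.length_ofFn]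
    constructor
    · rintro ⟨j, hj, rfl⟩
      exact ⟨_, ⟨⟨j, by omega⟩, by dsimp; omega, rfl⟩, rfl⟩
    · rintro ⟨-, ⟨j, hj, rfl⟩, rfl⟩
      exact ⟨j.1, by omega, rfl⟩
  rw [smul_eq_mul, Ideal.mul_top, h1] at hx ⊢
  rw [List.getElem_ofFn, smul_eq_mul] at hx
  refine X_mul_mem_span_X_image ?_ hx
  rintro ⟨j, hj, hji⟩
  have := hf hji
  subst this
  simp at hj

end Ideals

variable {K : Type*} [Field K] {k l : ℕ}

/-- The ideal generated by `P_1, …, P_j`. -/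
def partialIdeal (P : Fin l → Cox K k) (j : ℕ) : Ideal (Cox K k) :=
  Ideal.ofList ((List.ofFn P).take j)

lemma partialIdeal_zero (P : Fin l → Cox K k) : partialIdeal P 0 = ⊥ := by simp [partialIdeal]

lemma partialIdeal_succ (P : Fin l → Cox K k) (j : Fin l) :
    partialIdeal P (j + 1) = Ideal.span {P j} ⊔ partialIdeal P j := by
  have h : (j : ℕ) < (List.ofFn P).length := by simp
  rw [partialIdeal, ← List.take_concat_get' _ _ h, Ideal.ofList_append, Ideal.ofList_singleton,
    List.getElem_ofFn, sup_comm]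
  rfl

lemma partialIdeal_eq (P : Fin l → Cox K k) : partialIdeal P l = Ideal.span (Set.range P) := by
  rw [partialIdeal, List.take_of_length_le (by simp)]
  refine congrArg Ideal.span (Set.ext fun x => ?_)
  simp [List.mem_ofFn]

lemma mem_of_mem_take {P : Fin l → Cox K k} {j : ℕ} {g : Cox K k}
    (hg : g ∈ (List.ofFn P).take j) : ∃ i, g = P i := by
  have := List.mem_of_mem_take hg
  rw [List.mem_ofFn] at this
  obtain ⟨i, hi⟩ := this
  exact ⟨i, hi.symm⟩

lemma fib_weight_nonneg (v : Fin 2 ⊕ Fin k →₀ ℕ) : 0 ≤ Finsupp.weight (fibWeight k) v := by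
  rw [weight_fib_eq]
  positivity

lemma Fib.eq_zero {n : ℤ} (hn : n < 0) {f : Cox K k} (hf : Fib n f) : f = 0 :=
  hf.eq_zero_of_no_monomials fun v => by have := fib_weight_nonneg v; omega

lemma component_zero_eq_zero_of_mem {f : Cox K k}
    (hf : f ∈ Ideal.span (X '' (Set.range Sum.inr) : Set (Cox K k))) :
    weightedHomogeneousComponent (fibWeight k) 0 f = 0 := by
  apply weightedHomogeneousComponent_eq_zero'
  intro v hv hw
  rw [mem_ideal_span_X_image] at hf
  obtain ⟨-, ⟨i, rfl⟩, hi⟩ := hf v hv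
  rw [weight_fib_eq] at hw
  have := (Finset.sum_eq_zero_iff_of_nonneg (fun i _ => by positivity)).mp hw i (Finset.mem_univ i)
  exact hi (by exact_mod_cast this)

lemma Fib.mem_span_z {n : ℤ} (hn : 0 < n) {f : Cox K k} (hf : Fib n f) :
    f ∈ Ideal.span (X '' (Set.range Sum.inr) : Set (Cox K k)) := by
  rw [mem_ideal_span_X_image]
  intro v hv
  by_contra! h
  have := hf (mem_support_iff.mp hv)
  rw [weight_fib_eq, Finset.sum_eq_zero] at this
  · omega
  · intro i _
    have := h (Sum.inr i) ⟨i, rfl⟩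
    exact_mod_cast this

section

variable {P : Fin l → Cox K k} {a : ℕ}

lemma component_mem_partialIdeal {w : Fin 2 ⊕ Fin k → ℤ}
    (hP : ∀ i, ∃ m : ℤ, IsWeightedHomogeneous w (P i) m) {j : ℕ} {f : Cox K k}
    (hf : f ∈ partialIdeal P j) (n : ℤ) :
    weightedHomogeneousComponent w n f ∈ partialIdeal P j := by
  refine weightedHomogeneousComponent_mem_span (fun g hg => ?_) hf n
  obtain ⟨i, rfl⟩ := mem_of_mem_take hg
  exact hP i

open RingTheory.Sequence in
/-- Away from `u = 0`, where `u = s` or `u = t`, the sequence `P_1, …, P_l` is regular. -/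
lemma IsCompleteIntersection.exists_pow_mul_mem (hV : IsCompleteIntersection P) (ha : 0 < a)
    (hP : ∀ i, Fib (a : ℤ) (P i)) {u : Cox K k} (hu : u = s K k ∨ u = t K k) (j : Fin l)
    {y : Cox K k} (hy : P j * y ∈ partialIdeal P j) : ∃ N : ℕ, u ^ N * y ∈ partialIdeal P j := by
  have hufib : Fib 0 u := by rcases hu with rfl | rfl; exacts [fib_s, fib_t]
  have homog : ∀ (n : ℤ) (y : Cox K k), Fib n y → P j * y ∈ partialIdeal P j →
      ∃ N : ℕ, u ^ N * y ∈ partialIdeal P j := by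
    intro n y hyn hy
    set 𝔞 := Submodule.colon (partialIdeal P j) {y} with h𝔞
    have mem𝔞 : ∀ r, r ∈ 𝔞 ↔ r * y ∈ partialIdeal P j := fun r => by
      rw [h𝔞, Submodule.mem_colon_singleton, smul_eq_mul]
    set Z := Ideal.span (X '' (Set.range Sum.inr) : Set (Cox K k)) with hZ
    -- A prime over 𝔞 + Z contains all P_i, as these have positive fibre degree. If it avoided u,
    -- the depth criterion would produce an element of 𝔞 outside it.
    have hrad : u ∈ (𝔞 ⊔ Z).radical := by
      rw [Ideal.radical_eq_sInf, Ideal.mem_sInf]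
      rintro 𝔪 ⟨hle, hprime⟩
      by_contra hu𝔪
      have hPm : ∀ i, P i ∈ 𝔪 := fun i =>
        hle (Ideal.mem_sup_right ((hP i).mem_span_z (by exact_mod_cast ha)))
      have hdepth : ∀ (q : Ideal (Cox K k)) [q.IsPrime], q ≤ 𝔪 → (∀ r ∈ List.ofFn P, r ∈ q) →
          ∃ rs : List (Localization.AtPrime q), rs.length = (List.ofFn P).length ∧
            (∀ r ∈ rs, r ∈ IsLocalRing.maximalIdeal (Localization.AtPrime q)) ∧
            IsRegular (Localization.AtPrime q) rs := by
        intro q hq hq𝔪 hPq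
        have hPq' : ∀ i, P i ∈ q := fun i => hPq _ (by rw [List.mem_ofFn]; exact ⟨i, rfl⟩)
        -- Over z = 0 the condition on V is silent, and l of the k variables z^{(i)} serve as
        -- regular sequence. Elsewhere q is a point of V and the P_i themselves serve.
        by_cases hz : ∀ i, z K i ∈ q
        · have hmem : ∀ r ∈ (List.ofFn fun i : Fin l => z K (Fin.castLE hV.le_dim i)).map
              (algebraMap (Cox K k) (Localization.AtPrime q)),
              r ∈ IsLocalRing.maximalIdeal (Localization.AtPrime q) := by
            intro r hr
            rw [List.mem_map] at hr
            obtain ⟨r, hr, rfl⟩ := hr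
            rw [List.mem_ofFn] at hr
            obtain ⟨i, rfl⟩ := hr
            exact (IsLocalization.AtPrime.to_map_mem_maximal_iff _ q _).mpr (hz _)
          refine ⟨_, ?_, hmem, ?_⟩
          · simp
          · refine (IsLocalRing.isRegular_iff_isWeaklyRegular_of_subset_maximalIdeal hmem).mpr ?_
            refine IsWeaklyRegular.of_isLocalization _ q.primeCompl (isWeaklyRegular_X ?_)
            exact Sum.inr_injective.comp (Fin.castLE_injective _)
        · refine ⟨_, by simp, ?_, hV.regular q ⟨hq, hPq', ?_, hz⟩⟩
          · intro r hr
            rw [List.mem_ofFn] at hr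
            obtain ⟨i, rfl⟩ := hr
            exact (IsLocalization.AtPrime.to_map_mem_maximal_iff _ q _).mpr (hPq' i)
          · rintro ⟨hs, ht⟩
            rcases hu with rfl | rfl
            exacts [hu𝔪 (hq𝔪 hs), hu𝔪 (hq𝔪 ht)]
      obtain ⟨w, hw, hwy⟩ := Depth.exists_notMem_mul_mem_of_depth (List.ofFn P) 𝔪
        (fun r hr => by
          rw [List.mem_ofFn] at hr
          obtain ⟨i, rfl⟩ := hr
          exact hPm i) hdepth j (by simp) y (by rw [List.getElem_ofFn]; exact hy)
      exact hw (hle (Ideal.mem_sup_left ((mem𝔞 w).mpr hwy)))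
    obtain ⟨N, hN⟩ := hrad
    obtain ⟨A, hA, B, hB, hAB⟩ := Submodule.mem_sup.mp hN
    refine ⟨N, ?_⟩
    -- Every term of B contains some z^{(i)}, so u^N is the component of A of fibre degree 0. As y
    -- is homogeneous of fibre degree n, the component of A y in degree n is u^N y.
    have h0 : weightedHomogeneousComponent (fibWeight k) 0 A = u ^ N := by
      have h1 : Fib 0 (u ^ N) := by simpa using hufib.pow N
      rw [← weightedHomogeneousComponent_eq_self h1, ← hAB, map_add,
        component_zero_eq_zero_of_mem hB, add_zero]
    have h2 := component_mem_partialIdeal (fun i => ⟨_, hP i⟩) ((mem𝔞 A).mp hA) n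
    rwa [mul_comm, weightedHomogeneousComponent_mul_left' hyn, sub_self, h0, mul_comm] at h2
  -- The y with the desired property form a subspace, so the homogeneous components suffice.
  let T : Submodule K (Cox K k) :=
    { carrier := {y | ∃ N : ℕ, u ^ N * y ∈ partialIdeal P j}
      zero_mem' := ⟨0, by simp⟩
      add_mem' := by
        rintro x y ⟨N, hN⟩ ⟨M, hM⟩
        refine ⟨N + M, ?_⟩
        rw [show u ^ (N + M) * (x + y) = u ^ M * (u ^ N * x) + u ^ N * (u ^ M * y) by ring]
        exact add_mem (Ideal.mul_mem_left _ _ hN) (Ideal.mul_mem_left _ _ hM)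
      smul_mem' := by
        rintro c x ⟨N, hN⟩
        refine ⟨N, ?_⟩
        rw [mul_smul_comm, smul_eq_C_mul]
        exact Ideal.mul_mem_left _ _ hN }
  change y ∈ T
  refine mem_of_forall_weightedHomogeneousComponent_mem (w := fibWeight k) fun n => ?_
  refine homog n _ (weightedHomogeneousComponent_isWeightedHomogeneous _ _) ?_
  rw [← weightedHomogeneousComponent_mul_left (hP j)]
  exact component_mem_partialIdeal (fun i => ⟨_, hP i⟩) hy _

end

section

variable {P : Fin l → Cox K k} {a : ℕ} {d : Fin k → ℕ} {b : Fin l → ℕ}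

lemma exists_sub_mul_mem_partialIdeal (hPt : ∀ i, Tot d (-(b i : ℤ)) (P i)) (j : Fin l) {e : ℤ}
    {f : Cox K k} (hf : Tot d e f) (h : f ∈ partialIdeal P (j + 1)) :
    ∃ x, Tot d (e + b j) x ∧ f - P j * x ∈ partialIdeal P j := by
  rw [partialIdeal_succ, Ideal.mem_span_singleton_sup] at h
  obtain ⟨x, y, hy, hxy⟩ := h
  refine ⟨weightedHomogeneousComponent (totWeight d) (e + b j) x,
    weightedHomogeneousComponent_isWeightedHomogeneous _ _, ?_⟩
  have h1 := component_mem_partialIdeal (w := totWeight d) (fun i => ⟨_, hPt i⟩) hy e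
  have h2 : y = f - P j * x := by rw [← hxy]; ring
  rw [h2, map_sub, weightedHomogeneousComponent_eq_self hf,
    weightedHomogeneousComponent_mul_left' (hPt j), sub_neg_eq_add] at h1
  exact h1

/-- In total degrees at least `-1`, the quotients by `P_1, …, P_j` satisfy the vanishing of the
local cohomology along `(s, t)`. -/
lemma partialIdeal_saturated (hreg : ∀ u : Cox K k, u = s K k ∨ u = t K k → ∀ (j : Fin l)
      (y : Cox K k), P j * y ∈ partialIdeal P j → ∃ N : ℕ, u ^ N * y ∈ partialIdeal P j)
    (hPt : ∀ i, Tot d (-(b i : ℤ)) (P i)) (j : ℕ) (hj : j ≤ l) :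
    (∀ (e : ℤ), -1 ≤ e → ∀ (y : Cox K k), Tot d e y → ∀ (N : ℕ),
      s K k ^ N * y ∈ partialIdeal P j → t K k ^ N * y ∈ partialIdeal P j →
        y ∈ partialIdeal P j) ∧
    (∀ (e : ℤ), -1 ≤ e → ∀ (N : ℕ) (x x' : Cox K k), Tot d (e + N) x → Tot d (e + N) x' →
      t K k ^ N * x - s K k ^ N * x' ∈ partialIdeal P j →
      ∃ w, Tot d e w ∧ x - s K k ^ N * w ∈ partialIdeal P j ∧
        x' - t K k ^ N * w ∈ partialIdeal P j) := by
  induction j with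
  | zero =>
    simp only [partialIdeal_zero, Ideal.mem_bot]
    constructor
    · intro e he y hy N h1 h2
      exact (mul_eq_zero.mp h1).resolve_left (pow_ne_zero _ s_ne_zero)
    · intro e he N x x' hx hx' h
      rw [sub_eq_zero] at h
      obtain ⟨w, hw⟩ := s_prime.pow_dvd_of_dvd_mul_left N
        (fun h' => not_s_dvd_t (s_prime.dvd_of_dvd_pow h')) (Dvd.intro _ h.symm)
      refine ⟨w, ?_, sub_eq_zero.mpr hw, ?_⟩
      · have hsN : Tot d N (s K k ^ N) := by simpa using (tot_s d).pow N
        refine IsWeightedHomogeneous.of_mul_left hsN (pow_ne_zero _ s_ne_zero) ?_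
        rw [← hw, add_comm]
        exact hx
      · rw [sub_eq_zero]
        apply mul_left_cancel₀ (pow_ne_zero N (s_ne_zero (K := K) (k := k)))
        rw [← h, hw]
        ring
  | succ j ih =>
    obtain ⟨ih0, ih1⟩ := ih (by omega)
    set p : Fin l := ⟨j, by omega⟩ with hp
    have hsucc : partialIdeal P (j + 1) = Ideal.span {P p} ⊔ partialIdeal P j :=
      partialIdeal_succ P p
    have hmono : partialIdeal P j ≤ partialIdeal P (j + 1) := hsucc ▸ le_sup_right
    have hPmem : P p ∈ partialIdeal P (j + 1) :=
      hsucc ▸ Ideal.mem_sup_left (Ideal.mem_span_singleton_self _)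
    have tots : ∀ N : ℕ, Tot d N (s K k ^ N) := fun N => by simpa using (tot_s d).pow N
    have tott : ∀ N : ℕ, Tot d N (t K k ^ N) := fun N => by simpa using (tot_t d).pow N
    -- Regularity holds only up to powers of s and of t; the vanishing of H^0 for j removes these
    -- powers.
    have reg : ∀ (e : ℤ), -1 ≤ e → ∀ y : Cox K k, Tot d e y → P p * y ∈ partialIdeal P j →
        y ∈ partialIdeal P j := by
      intro e he y hy h
      obtain ⟨N, hN⟩ := hreg _ (Or.inl rfl) p y h
      obtain ⟨M, hM⟩ := hreg _ (Or.inr rfl) p y h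
      refine ih0 e he y hy (N + M) ?_ ?_
      · rw [add_comm, pow_add, mul_assoc]; exact Ideal.mul_mem_left _ _ hN
      · rw [pow_add, mul_assoc]; exact Ideal.mul_mem_left _ _ hM
    constructor
    · intro e he y hy N h1 h2
      obtain ⟨x, hx, hx'⟩ := exists_sub_mul_mem_partialIdeal hPt p ((tots N).mul hy) h1
      obtain ⟨x', hx'', hx'''⟩ := exists_sub_mul_mem_partialIdeal hPt p ((tott N).mul hy) h2
      have e1 : (N : ℤ) + e + b p = (e + b p) + N := by ring
      rw [e1] at hx hx''
      have hb : -1 ≤ e + b p := by omega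
      -- The connecting map: s^N y ≡ P x and t^N y ≡ P x' make (x, x') a cocycle modulo the previous
      -- ideal. By the vanishing of H^1 in degree e + b_p it comes from some w, and y - P w is then
      -- torsion.
      have h3 : P p * (t K k ^ N * x - s K k ^ N * x') ∈ partialIdeal P j := by
        have := sub_mem (Ideal.mul_mem_left _ (s K k ^ N) hx''') (Ideal.mul_mem_left _ (t K k ^ N) hx')
        convert this using 1
        ring
      have h4 := reg (N + (e + b p + N)) (by omega) _
        (((tott N).mul hx).sub ((tots N).mul hx'')) h3
      obtain ⟨w, hw, hw1, hw2⟩ := ih1 _ hb N x x' hx hx'' h4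
      have h5 : y - P p * w ∈ partialIdeal P j := by
        refine ih0 e he _ (hy.sub ?_) N ?_ ?_
        · have := (hPt p).mul hw
          rwa [neg_add_cancel_comm_assoc] at this
        · have := add_mem hx' (Ideal.mul_mem_left _ (P p) hw1)
          convert this using 1
          ring
        · have := add_mem hx''' (Ideal.mul_mem_left _ (P p) hw2)
          convert this using 1
          ring
      rw [← sub_add_cancel y (P p * w)]
      exact add_mem (hmono h5) (Ideal.mul_mem_right _ _ hPmem)
    · intro e he N x x' hx hx' h
      have hT : Tot d (N + (e + N)) (t K k ^ N * x - s K k ^ N * x') :=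
        ((tott N).mul hx).sub ((tots N).mul hx')
      obtain ⟨y, hy, hyj⟩ := exists_sub_mul_mem_partialIdeal hPt p hT h
      -- Vanishing of H^2: the total degree of y is 2N + e + b_p ≥ 2N - 1, so each monomial contains
      -- s^N or t^N. The bound -1 ≤ e enters here. The two parts of y correct x and x' to a cocycle
      -- for j.
      obtain ⟨y₁, y₂, hy12, hy₁, hy₂⟩ := hy.exists_eq_add N N (by
        have : (0 : ℤ) ≤ b p := by positivity
        omega)
      have hdeg : -(b p : ℤ) + (N + (e + N) + b p - N) = e + N := by ring
      have hP1 := (hPt p).mul hy₁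
      have hP2 := (hPt p).mul hy₂
      rw [hdeg] at hP1 hP2
      obtain ⟨w, hw, hw1, hw2⟩ := ih1 e he N (x - P p * y₂) (x' + P p * y₁) (hx.sub hP2)
        (hx'.add hP1) (by
          convert hyj using 1
          rw [hy12]
          ring)
      refine ⟨w, hw, ?_, ?_⟩
      · have := add_mem (hmono hw1) (Ideal.mul_mem_right y₂ _ hPmem)
        convert this using 1
        ring
      · have := sub_mem (hmono hw2) (Ideal.mul_mem_right y₁ _ hPmem)
        convert this using 1
        ring

end

end Scroll
end

/-! ### Koszul syzygies of the equations of V -/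

noncomputable section

namespace Scroll

variable {K : Type*} [Field K] {k l : ℕ} {P : Fin l → Cox K k} {a : ℕ} {d : Fin k → ℕ}
  {b : Fin l → ℕ}

/-- The ideal of `V` in the ring of bihomogeneous coordinates. -/
def idealOf (P : Fin l → Cox K k) : Ideal (Cox K k) := Ideal.span (Set.range P)

lemma mem_idealOf (i : Fin l) : P i ∈ idealOf P := Ideal.subset_span ⟨i, rfl⟩

lemma component_mem_idealOf {w : Fin 2 ⊕ Fin k → ℤ}
    (hP : ∀ i, ∃ m : ℤ, IsWeightedHomogeneous w (P i) m) {f : Cox K k}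
    (hf : f ∈ idealOf P) (n : ℤ) :
    weightedHomogeneousComponent w n f ∈ idealOf P := by
  refine weightedHomogeneousComponent_mem_span (fun g hg => ?_) hf n
  obtain ⟨i, rfl⟩ := hg
  exact hP i

/-- The generators have fibre degree a, and their cofactors would need negative fibre degree. -/
lemma Fib.eq_zero_of_mem (hP : ∀ i, Fib (a : ℤ) (P i)) {n : ℤ} (hn : n < a) {f : Cox K k}
    (hf : Fib n f) (h : f ∈ idealOf P) : f = 0 := by
  obtain ⟨c, hc⟩ := (Ideal.mem_span_range_iff_exists_fun).mp h
  rw [← weightedHomogeneousComponent_eq_self hf, ← hc, map_sum]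
  refine Finset.sum_eq_zero fun i _ => ?_
  rw [mul_comm, weightedHomogeneousComponent_mul_left' (hP i),
    Fib.eq_zero (by omega) (weightedHomogeneousComponent_isWeightedHomogeneous (n - a) (c i)),
    mul_zero]

/-- Homogeneous elements of the ideal of `V` have homogeneous coefficients. -/
lemma exists_eq_sum_of_mem_idealOf (hPt : ∀ i, Tot d (-(b i : ℤ)) (P i)) {e : ℤ} {f : Cox K k}
    (hf : Tot d e f) (h : f ∈ idealOf P) :
    ∃ c : Fin l → Cox K k, (∀ i, Tot d (e + b i) (c i)) ∧ f = ∑ i, P i * c i := by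
  obtain ⟨c, hc⟩ := (Ideal.mem_span_range_iff_exists_fun).mp h
  refine ⟨fun i => weightedHomogeneousComponent (totWeight d) (e + b i) (c i),
    fun i => weightedHomogeneousComponent_isWeightedHomogeneous _ _, ?_⟩
  rw [← weightedHomogeneousComponent_eq_self hf, ← hc, map_sum]
  refine Finset.sum_congr rfl fun i _ => ?_
  rw [mul_comm, weightedHomogeneousComponent_mul_left' (hPt i), sub_neg_eq_add]

lemma exists_fib_eq_sum_of_mem_idealOf (hPf : ∀ i, Fib (a : ℤ) (P i))
    (hPt : ∀ i, Tot d (-(b i : ℤ)) (P i)) {n e : ℤ} {f : Cox K k}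
    (hfn : Fib n f) (hf : Tot d e f) (h : f ∈ idealOf P) :
    ∃ c : Fin l → Cox K k, (∀ i, Tot d (e + b i) (c i)) ∧ (∀ i, Fib (n - a) (c i)) ∧
      f = ∑ i, P i * c i := by
  obtain ⟨c, hc, hfc⟩ := exists_eq_sum_of_mem_idealOf hPt hf h
  refine ⟨fun i => weightedHomogeneousComponent (fibWeight k) (n - a) (c i),
    fun i => IsWeightedHomogeneous.component_of_isWeightedHomogeneous (hc i) _,
    fun i => weightedHomogeneousComponent_isWeightedHomogeneous _ _, ?_⟩
  rw [← weightedHomogeneousComponent_eq_self hfn, hfc, map_sum]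
  exact Finset.sum_congr rfl fun i _ => weightedHomogeneousComponent_mul_left' (hPf i) _ _

lemma exists_eq_sum_of_mem_partialIdeal (hPt : ∀ i, Tot d (-(b i : ℤ)) (P i)) {j : ℕ} (hj : j ≤ l)
    {e : ℤ} {f : Cox K k} (hf : Tot d e f) (h : f ∈ partialIdeal P j) :
    ∃ c : Fin l → Cox K k, (∀ i, j ≤ i.1 → c i = 0) ∧ (∀ i, Tot d (e + b i) (c i)) ∧
      f = ∑ i, c i * P i := by
  induction j generalizing f with
  | zero =>
    rw [partialIdeal_zero, Ideal.mem_bot] at h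
    exact ⟨0, fun _ _ => rfl, fun i => isWeightedHomogeneous_zero .., by simp [h]⟩
  | succ j ih =>
    set p : Fin l := ⟨j, by omega⟩
    obtain ⟨x, hx, hfx⟩ := exists_sub_mul_mem_partialIdeal hPt p hf h
    have hPx := (hPt p).mul hx
    rw [neg_add_cancel_comm_assoc] at hPx
    obtain ⟨c, hc0, hc, hsum⟩ := ih (by omega) (hf.sub hPx) hfx
    refine ⟨c + Pi.single p x, fun i hi => ?_, fun i => ?_, ?_⟩
    · have : i ≠ p := by rintro rfl; simp [p] at hi
      simp [hc0 i (by omega), this]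
    · by_cases hip : i = p
      · subst hip
        simpa using (hc p).add hx
      · simpa [hip] using hc i
    · simp only [Pi.add_apply, add_mul, Finset.sum_add_distrib, ← hsum]
      rw [Finset.sum_eq_single p (fun i _ hi => by simp [hi]) (by simp)]
      simp
      ring

section

variable (ha : 0 < a) (hP : ∀ i, IsDivisorEquation d a (b i) (P i))
  (hV : IsCompleteIntersection P)
include ha hP hV

lemma saturated {j : ℕ} (hj : j ≤ l) {e : ℤ} (he : -1 ≤ e) {y : Cox K k} (hy : Tot d e y) (N : ℕ)
    (hs : s K k ^ N * y ∈ partialIdeal P j) (ht : t K k ^ N * y ∈ partialIdeal P j) :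
    y ∈ partialIdeal P j :=
  (partialIdeal_saturated (fun _ hu j _ hy =>
    hV.exists_pow_mul_mem ha (fun i => (hP i).fib) hu j hy) (fun i => (hP i).tot) j hj).1
      e he y hy N hs ht

lemma mem_idealOf_of_pow_mul_mem {e : ℤ} (he : -1 ≤ e) {y : Cox K k} (hy : Tot d e y) (N : ℕ)
    (hs : s K k ^ N * y ∈ idealOf P) (ht : t K k ^ N * y ∈ idealOf P) : y ∈ idealOf P := by
  rw [idealOf, ← partialIdeal_eq] at hs ht ⊢
  exact saturated ha hP hV le_rfl he hy N hs ht

lemma mem_partialIdeal_of_mul_mem (j : Fin l) {e : ℤ} (he : -1 ≤ e) {y : Cox K k}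
    (hy : Tot d e y) (h : P j * y ∈ partialIdeal P j) : y ∈ partialIdeal P j := by
  obtain ⟨N, hN⟩ := hV.exists_pow_mul_mem ha (fun i => (hP i).fib) (Or.inl rfl) j h
  obtain ⟨M, hM⟩ := hV.exists_pow_mul_mem ha (fun i => (hP i).fib) (Or.inr rfl) j h
  refine saturated ha hP hV j.2.le he hy (N + M) ?_ ?_
  · rw [add_comm, pow_add, mul_assoc]; exact Ideal.mul_mem_left _ _ hN
  · rw [pow_add, mul_assoc]; exact Ideal.mul_mem_left _ _ hM

/-- In total degrees at least `-1` the syzygies of `P_1, …, P_l` are the Koszul ones. -/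
lemma exists_koszul {e : ℤ} (he : -1 ≤ e) {m : Fin l → Cox K k}
    (hm : ∀ i, Tot d (b i + e) (m i)) (h : ∑ i, P i * m i = 0) :
    ∃ B : Fin l → Fin l → Cox K k, (∀ i i', Tot d (b i + b i' + e) (B i i')) ∧
      ∀ i, m i = ∑ i', (B i i' - B i' i) * P i' := by
  suffices H : ∀ j ≤ l, ∀ m : Fin l → Cox K k, (∀ i, j ≤ i.1 → m i = 0) →
      (∀ i, Tot d (b i + e) (m i)) → ∑ i, P i * m i = 0 →
      ∃ B : Fin l → Fin l → Cox K k, (∀ i i', Tot d (b i + b i' + e) (B i i')) ∧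
        ∀ i, m i = ∑ i', (B i i' - B i' i) * P i' from
    H l le_rfl m (fun i hi => absurd i.2 (by omega)) hm h
  clear hm h m
  intro j
  induction j with
  | zero =>
    intro _ m hm0 _ _
    exact ⟨0, fun _ _ => isWeightedHomogeneous_zero .., fun i => by simp [hm0 i (by omega)]⟩
  | succ j ih =>
    intro hj m hm0 hm h
    set p : Fin l := ⟨j, by omega⟩ with hp
    -- Here p is the last index where m can be nonzero, so P_p m_p lies in the ideal of the earlier
    -- equations, and so does m_p. Writing m_p = ∑ c_i P_i and subtracting Koszul syzygies with
    -- entries c_i clears position p.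
    have hmem : P p * m p ∈ partialIdeal P j := by
      rw [← Finset.add_sum_erase _ _ (Finset.mem_univ p), add_eq_zero_iff_eq_neg] at h
      rw [h]
      refine neg_mem (sum_mem fun i hi => ?_)
      have hip : i ≠ p := Finset.ne_of_mem_erase hi
      by_cases hij : i.1 < j
      · refine Ideal.mul_mem_right _ _ (Ideal.subset_span ?_)
        change P i ∈ (List.ofFn P).take j
        rw [List.mem_take_iff_getElem]
        exact ⟨i, by simpa using hij, by simp⟩
      · have : i.1 ≠ j := fun h => hip (Fin.ext h)
        rw [hm0 i (by omega), mul_zero]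
        exact zero_mem _
    have hbp : -1 ≤ b p + e := by omega
    have hmp := mem_partialIdeal_of_mul_mem ha hP hV p hbp (hm p) hmem
    obtain ⟨c, hc0, hc, hsum⟩ := exists_eq_sum_of_mem_partialIdeal (fun i => (hP i).tot)
      (by omega) (hm p) hmp
    have hcp : c p = 0 := hc0 p le_rfl
    obtain ⟨B, hB, hmB⟩ := ih (by omega) (fun i => m i + P p * c i - if i = p then m p else 0)
      (fun i hi => by
        by_cases hip : i = p
        · subst hip; simp [hcp]
        · have : i.1 ≠ j := fun h => hip (Fin.ext h)
          simp [hip, hc0 i hi, hm0 i (by omega)])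
      (fun i => by
        refine ((hm i).add ?_).sub ?_
        · have := (hP p).tot.mul (hc i)
          convert this using 1
          ring
        · split_ifs with hip
          · exact hip ▸ hm p
          · exact isWeightedHomogeneous_zero ..)
      (by
        have h2 : ∑ i, P i * (P p * c i) = P p * m p := by
          rw [hsum, Finset.mul_sum]
          exact Finset.sum_congr rfl fun i _ => by ring
        simp only [mul_sub, mul_add, Finset.sum_sub_distrib, Finset.sum_add_distrib, h, h2]
        simp)
    refine ⟨fun i i' => B i i' + if i = p then c i' else 0, fun i i' => (hB i i').add ?_,
      fun i => ?_⟩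
    · split_ifs with hip
      · have := hc i'
        rw [hip]
        convert this using 1
        ring
      · exact isWeightedHomogeneous_zero ..
    · have h1 : ∑ i', (if i = p then c i' else 0) * P i' = if i = p then m p else 0 := by
        split_ifs
        · exact hsum.symm
        · simp
      have h2 : ∑ i', (if i' = p then c i else 0) * P i' = c i * P p := by simp
      have h3 := hmB i
      have h4 : ∑ i', (B i i' + (if i = p then c i' else 0) -
          (B i' i + if i' = p then c i else 0)) * P i' =
          ∑ i', (B i i' - B i' i) * P i' + ∑ i', (if i = p then c i' else 0) * P i' -
            ∑ i', (if i' = p then c i else 0) * P i' := by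
        rw [← Finset.sum_add_distrib, ← Finset.sum_sub_distrib]
        exact Finset.sum_congr rfl fun i' _ => by ring
      rw [h4, ← h3, h1, h2]
      ring

/-- There are no syzygies of `P_1, …, P_l` in fibre degrees less than `a`. -/
lemma eq_zero_of_sum_eq_zero {e n : ℤ} (he : -1 ≤ e) (hn : n < a) {m : Fin l → Cox K k}
    (hm : ∀ i, Tot d (b i + e) (m i)) (hmn : ∀ i, Fib n (m i)) (h : ∑ i, P i * m i = 0)
    (i : Fin l) : m i = 0 := by
  obtain ⟨B, -, hB⟩ := exists_koszul ha hP hV he hm h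
  refine (hmn i).eq_zero_of_mem (fun i => (hP i).fib) hn ?_
  rw [hB i]
  exact sum_mem fun i' _ => Ideal.mul_mem_left _ _ (mem_idealOf i')

/-- If P_i vanished, s^{b_i} in position i would be a nonzero syzygy of fibre degree 0 < a. -/
lemma ne_zero (i : Fin l) : P i ≠ 0 := by
  intro h0
  have h1 := eq_zero_of_sum_eq_zero ha hP hV (e := 0) (n := 0) (by omega) (by omega)
    (m := Pi.single i (s K k ^ b i)) (fun j => by
      by_cases hj : j = i
      · subst hj; simpa using (tot_s d).pow (b j)
      · simp only [Pi.single_eq_of_ne hj]; exact isWeightedHomogeneous_zero ..)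
    (fun j => by
      by_cases hj : j = i
      · subst hj; simpa using (fib_s (K := K)).pow (b j)
      · simp only [Pi.single_eq_of_ne hj]; exact isWeightedHomogeneous_zero ..)
    (by rw [Finset.sum_eq_single i (fun j _ hj => by simp [hj]) (by simp), h0, zero_mul]) i
  simp only [Pi.single_eq_same] at h1
  exact pow_ne_zero _ s_ne_zero h1

/-- Elements of total degree `-1` are determined modulo the ideal of `V` by the differences
`t N_{m+1} - s N_m`. -/
lemma mem_idealOf_of_differences {c : ℕ} {N : ℕ → Cox K k} (hN : ∀ m, Tot d (-1) (N m))
    (h0 : N 0 ∈ idealOf P) (h1 : N (c + 1) ∈ idealOf P)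
    (h : ∀ m ≤ c, t K k * N (m + 1) - s K k * N m ∈ idealOf P) {m : ℕ} (hm : m ≤ c + 1) :
    N m ∈ idealOf P := by
  -- Telescoping upwards from N_0 controls t^m N_m, and downwards from N_{c+1} controls s^(c+1-m)
  -- N_m. Saturation in total degree -1, the lowest one available, then gives N_m itself.
  have ht : ∀ m ≤ c + 1, t K k ^ m * N m ∈ idealOf P := by
    intro m
    induction m with
    | zero => intro _; simpa using h0
    | succ m ih =>
      intro hm
      have h2 := add_mem (Ideal.mul_mem_left _ (t K k ^ m) (h m (by omega)))
        (Ideal.mul_mem_left _ (s K k) (ih (by omega)))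
      convert h2 using 1
      ring
  have hs : ∀ j ≤ c + 1, s K k ^ j * N (c + 1 - j) ∈ idealOf P := by
    intro j
    induction j with
    | zero => intro _; simpa using h1
    | succ j ih =>
      intro hj
      obtain ⟨m, hm⟩ : ∃ m, c + 1 - j = m + 1 := ⟨c - j, by omega⟩
      have hm' : c + 1 - (j + 1) = m := by omega
      have h2 := ih (by omega)
      rw [hm] at h2
      have h3 := sub_mem (Ideal.mul_mem_left _ (t K k) h2)
        (Ideal.mul_mem_left _ (s K k ^ j) (h m (by omega)))
      rw [hm']
      convert h3 using 1
      ring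
  refine mem_idealOf_of_pow_mul_mem ha hP hV le_rfl (hN m) (c + 1) ?_ ?_
  · have := Ideal.mul_mem_left _ (s K k ^ m) (hs (c + 1 - m) (by omega))
    rw [Nat.sub_sub_self hm, ← mul_assoc, ← pow_add] at this
    rwa [Nat.add_sub_cancel' hm] at this
  · have := Ideal.mul_mem_left _ (t K k ^ (c + 1 - m)) (ht m hm)
    rw [← mul_assoc, ← pow_add] at this
    rwa [Nat.sub_add_cancel hm] at this

end

end Scroll
end

/-! ### Relations among the minors, by rewriting of monomials -/

noncomputable section

namespace Scroll

variable {K : Type*} [Field K] {k : ℕ} {d : Fin k → ℕ}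

variable (d) in
/-- The index set of the variables `z^{(i)}_j`. -/
abbrev Var : Type := Σ i : Fin k, Fin (d i + 1)

variable (d) in
/-- The index set of the columns of the matrix of the scroll. -/
abbrev Col : Type := Σ i : Fin k, Fin (d i)

/-- The variable in the upper row of a column. -/
def Col.top (α : Col d) : Var d := ⟨α.1, α.2.castSucc⟩

/-- The variable in the lower row of a column. -/
def Col.bot (α : Col d) : Var d := ⟨α.1, α.2.succ⟩

lemma minor_eq (α β : Col d) :
    minor K d α β = X α.top * X β.bot - X α.bot * X β.top := rfl

lemma top_injective : Function.Injective (Col.top (d := d)) := by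
  rintro ⟨i, j⟩ ⟨i', j'⟩ h
  simp only [Col.top, Sigma.mk.injEq] at h
  obtain ⟨rfl, h⟩ := h
  simpa using h

lemma bot_injective : Function.Injective (Col.bot (d := d)) := by
  rintro ⟨i, j⟩ ⟨i', j'⟩ h
  simp only [Col.bot, Sigma.mk.injEq] at h
  obtain ⟨rfl, h⟩ := h
  simpa using h

lemma top_ne_bot_self (α : Col d) : α.top ≠ α.bot := by
  rcases α with ⟨i, j⟩
  simp [Col.top, Col.bot, Fin.ext_iff]

section Order

/-- The position of a column in a linear order of the columns. -/
def colIndex (α : Col d) : ℕ := α.1 * ∑ i, d i + α.2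

/-- A convex function on the variables. -/
def varHeight (x : Var d) : ℕ := 2 * (x.1 * ∑ i, d i) * x.2 + x.2 * x.2

/-- The slope of `varHeight` along a column increases strictly with `colIndex`. This is why
exchanging the diagonals of a minor always changes the height in the same direction. -/
lemma varHeight_bot (α : Col d) : varHeight α.bot = varHeight α.top + (2 * colIndex α + 1) := by
  simp only [varHeight, Col.bot, Col.top, colIndex, Fin.val_succ, Fin.val_castSucc]
  ring

/-- Every second index is less than the sum of the d_i, so the two indices are digits in that base.
-/
lemma colIndex_injective : Function.Injective (colIndex (d := d)) := by
  rintro ⟨i, j⟩ ⟨i', j'⟩ h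
  simp only [colIndex] at h
  have hj : (j : ℕ) < ∑ i, d i :=
    j.2.trans_le (Finset.single_le_sum (fun _ _ => Nat.zero_le _) (Finset.mem_univ i))
  have hj' : (j' : ℕ) < ∑ i, d i :=
    j'.2.trans_le (Finset.single_le_sum (fun _ _ => Nat.zero_le _) (Finset.mem_univ i'))
  have h1 := congrArg (· % ∑ i, d i) h
  have h2 := congrArg (· / ∑ i, d i) h
  simp only [Nat.mul_add_mod_of_lt hj, Nat.mul_add_mod_of_lt hj'] at h1
  have hpos : 0 < ∑ i, d i := by omega
  simp only [mul_comm _ (∑ i, d i), Nat.mul_add_div hpos, Nat.div_eq_of_lt hj,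
    Nat.div_eq_of_lt hj', add_zero] at h2
  have : i = i' := Fin.ext h2
  subst this
  have : j = j' := Fin.ext h1
  rw [this]

lemma colIndex_of_bot_eq_top {α β : Col d} (h : α.bot = β.top) :
    colIndex β = colIndex α + 1 := by
  rcases α with ⟨i, j⟩
  rcases β with ⟨i', j'⟩
  simp only [Col.top, Col.bot, Sigma.mk.injEq] at h
  obtain ⟨rfl, h⟩ := h
  have := congrArg Fin.val (eq_of_heq h)
  simp at this
  simp [colIndex, ← this]
  ring

/-- The height of a monomial, which decreases when a diagonal of a minor is replaced by the other
diagonal. -/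
def height (v : Var d →₀ ℕ) : ℕ := Finsupp.weight varHeight v

/-- The exponent of the diagonal `z_{α, 0} z_{β, 1}`. -/
def diag (α β : Col d) : Var d →₀ ℕ := Finsupp.single α.top 1 + Finsupp.single β.bot 1

lemma height_lt {α β : Col d} (h : colIndex α < colIndex β) (u : Var d →₀ ℕ) :
    height (u + diag β α) < height (u + diag α β) := by
  simp only [height, diag, map_add, Finsupp.weight_single, varHeight_bot, one_smul]
  omega

end Order

lemma monomial_mul_minor (u : Var d →₀ ℕ) (α β : Col d) :
    monomial u 1 * minor K d α β = monomial (u + diag α β) 1 - monomial (u + diag β α) 1 := by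
  rw [minor_eq, diag, diag, X, X, X, X, monomial_mul, monomial_mul, mul_sub, monomial_mul,
    monomial_mul]
  simp [add_comm]

section Syzygies

variable {E : Type*} [AddCommGroup E] [Module (Amb K d) E] (e : Col d → Col d → E)

open Classical in
/-- A lift to `E` of the reduction of a monomial to normal form. -/
def reductionPath (v : Var d →₀ ℕ) : E :=
  if h : ∃ p : Col d × Col d, colIndex p.1 < colIndex p.2 ∧ diag p.1 p.2 ≤ v then
    (monomial (v - diag h.choose.1 h.choose.2) (1 : K) : Amb K d) • e h.choose.1 h.choose.2 +
      reductionPath (v - diag h.choose.1 h.choose.2 + diag h.choose.2 h.choose.1)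
  else 0
termination_by height v
decreasing_by
  have := height_lt h.choose_spec.1 (v - diag h.choose.1 h.choose.2)
  rwa [tsub_add_cancel_of_le h.choose_spec.2] at this

variable {e}

/-- The value of the symbols `e α β` on the relations among the minors. -/
structure IsMinorSymbol (e : Col d → Col d → E) : Prop where
  antisymm : ∀ α β, e α β = - e β α
  self : ∀ α, e α α = 0
  top : ∀ α β γ, (X α.top : Amb K d) • e β γ - (X β.top : Amb K d) • e α γ +
    (X γ.top : Amb K d) • e α β = 0
  bot : ∀ α β γ, (X α.bot : Amb K d) • e β γ - (X β.bot : Amb K d) • e α γ +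
    (X γ.bot : Amb K d) • e α β = 0
  koszul : ∀ α β γ δ, minor K d α β • e γ δ = minor K d γ δ • e α β

variable (K e) in
/-- The path that starts with a given reduction step. -/
def pathVia (u : Var d →₀ ℕ) (α β : Col d) : E :=
  (monomial u (1 : K) : Amb K d) • e α β + reductionPath (K := K) e (u + diag β α)

lemma monomial_add_single_smul (u : Var d →₀ ℕ) (x : Var d) (y : E) :
    (monomial (u + Finsupp.single x 1) (1 : K) : Amb K d) • y =
      (monomial u (1 : K) : Amb K d) • (X x : Amb K d) • y := by
  rw [smul_smul, X, monomial_mul, one_mul]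

/-- The monomial has two competing first steps, (α, β) and (α, γ). Their results are joined by the
step (β, γ) at smaller height, and the linear relation of the lower row closes the triangle. -/
lemma pathVia_eq_of_same_top (he : IsMinorSymbol (K := K) e) {w : Var d →₀ ℕ} {α β γ : Col d}
    (hαβ : colIndex α < colIndex β) (hβγ : colIndex β < colIndex γ)
    (ih : ∀ u : Var d →₀ ℕ, ∀ α' β', colIndex α' < colIndex β' → height (u + diag α' β') <
      height (w + Finsupp.single γ.bot 1 + diag α β) →
      reductionPath (K := K) e (u + diag α' β') = pathVia K e u α' β') :
    pathVia K e (w + Finsupp.single γ.bot 1) α β =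
      pathVia K e (w + Finsupp.single β.bot 1) α γ := by
  have h1 := ih (w + Finsupp.single α.bot 1) β γ hβγ (by
    have := height_lt hαβ (w + Finsupp.single γ.bot 1)
    convert this using 2
    simp only [diag]; abel)
  have h2 := congrArg (fun y => (monomial w (1 : K) : Amb K d) • y) (he.bot α β γ)
  simp only [smul_add, smul_sub, smul_zero, ← monomial_add_single_smul] at h2
  have e1 : w + Finsupp.single α.bot 1 + diag β γ = w + Finsupp.single γ.bot 1 + diag β α := by
    simp only [diag]; abel
  have e2 : w + Finsupp.single α.bot 1 + diag γ β = w + Finsupp.single β.bot 1 + diag γ α := by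
    simp only [diag]; abel
  simp only [pathVia] at h1 ⊢
  rw [e1, e2] at h1
  rw [h1, ← sub_eq_zero, ← h2]
  abel

/-- The mirror image: the results of the steps (α, γ) and (β, γ) are joined by (α, β), and the upper
row closes the triangle. -/
lemma pathVia_eq_of_same_bot (he : IsMinorSymbol (K := K) e) {w : Var d →₀ ℕ} {α β γ : Col d}
    (hαβ : colIndex α < colIndex β) (hβγ : colIndex β < colIndex γ)
    (ih : ∀ u : Var d →₀ ℕ, ∀ α' β', colIndex α' < colIndex β' → height (u + diag α' β') <
      height (w + Finsupp.single β.top 1 + diag α γ) →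
      reductionPath (K := K) e (u + diag α' β') = pathVia K e u α' β') :
    pathVia K e (w + Finsupp.single β.top 1) α γ =
      pathVia K e (w + Finsupp.single α.top 1) β γ := by
  have h1 := ih (w + Finsupp.single γ.top 1) α β hαβ (by
    have := height_lt hβγ (w + Finsupp.single α.top 1)
    convert this using 2
    · simp only [diag]; abel
    · simp only [diag]; abel)
  have h2 := congrArg (fun y => (monomial w (1 : K) : Amb K d) • y) (he.top α β γ)
  simp only [smul_add, smul_sub, smul_zero, ← monomial_add_single_smul] at h2
  have e1 : w + Finsupp.single γ.top 1 + diag α β = w + Finsupp.single α.top 1 + diag γ β := by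
    simp only [diag]; abel
  have e2 : w + Finsupp.single γ.top 1 + diag β α = w + Finsupp.single β.top 1 + diag γ α := by
    simp only [diag]; abel
  simp only [pathVia] at h1 ⊢
  rw [e1, e2] at h1
  rw [h1, ← sub_eq_zero, ← neg_eq_zero, ← h2]
  abel

/-- The steps use different variables, so each can follow the other. The two ways around the square
agree by the Koszul relation. -/
lemma pathVia_eq_of_disjoint (he : IsMinorSymbol (K := K) e) {w : Var d →₀ ℕ} {α β γ δ : Col d}
    (hαβ : colIndex α < colIndex β) (hγδ : colIndex γ < colIndex δ)
    (ih : ∀ u : Var d →₀ ℕ, ∀ α' β', colIndex α' < colIndex β' → height (u + diag α' β') <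
      height (w + diag γ δ + diag α β) →
      reductionPath (K := K) e (u + diag α' β') = pathVia K e u α' β') :
    pathVia K e (w + diag γ δ) α β = pathVia K e (w + diag α β) γ δ := by
  have h1 := ih (w + diag δ γ) α β hαβ (by
    have := height_lt hγδ (w + diag α β)
    convert this using 2 <;> abel)
  have h2 := ih (w + diag β α) γ δ hγδ (by
    have := height_lt hαβ (w + diag γ δ)
    convert this using 2
    abel)
  have h3 := congrArg (fun y => (monomial w (1 : K) : Amb K d) • y) (he.koszul α β γ δ)
  simp only [smul_smul, monomial_mul_minor, sub_smul] at h3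
  simp only [pathVia] at h1 h2 ⊢
  rw [add_right_comm w (diag δ γ), add_right_comm w (diag δ γ)] at h1
  rw [add_right_comm w (diag γ δ), h2, h1]
  have h4 : ∀ p q r s T : E, p - q = r - s → r + (q + T) = p + (s + T) := by
    intro p q r s T h
    rw [sub_eq_sub_iff_add_eq_add] at h
    rw [← add_assoc, ← add_assoc, ← h]
  exact h4 _ _ _ _ _ h3

lemma single_le_of_ne {v w : Var d →₀ ℕ} {x : Var d} (h : w ≤ v) (hx : w x = 0) (hv : v x ≠ 0) :
    w + Finsupp.single x 1 ≤ v := by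
  intro y
  by_cases hxy : x = y
  · subst hxy
    simp only [Finsupp.add_apply, hx, Finsupp.single_eq_same]
    omega
  · simpa [Finsupp.single_eq_of_ne' hxy] using h y

lemma ne_zero_of_diag_le {v : Var d →₀ ℕ} {α β : Col d} (h : diag α β ≤ v) :
    v α.top ≠ 0 ∧ v β.bot ≠ 0 := by
  have h1 := h α.top
  have h2 := h β.bot
  simp only [diag, Finsupp.add_apply, Finsupp.single_eq_same] at h1 h2
  omega

/-- A diamond lemma: `reductionPath` takes an arbitrary first step, and induction on the height
shows that any other first step gives the same value. The two steps may share both variables, one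
variable in the same or in opposite roles, or none. -/
lemma reductionPath_eq (he : IsMinorSymbol (K := K) e) (u : Var d →₀ ℕ) {α β : Col d}
    (hαβ : colIndex α < colIndex β) :
    reductionPath (K := K) e (u + diag α β) = pathVia K e u α β := by
  obtain ⟨n, hn⟩ : ∃ n, n = height (u + diag α β) := ⟨_, rfl⟩
  induction n using Nat.strong_induction_on generalizing u α β with
  | _ n ih =>
  have ih' : ∀ v : Var d →₀ ℕ, height v = n → ∀ u : Var d →₀ ℕ, ∀ α' β', colIndex α' < colIndex β' →
      height (u + diag α' β') < height v →
      reductionPath (K := K) e (u + diag α' β') = pathVia K e u α' β' :=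
    fun v hv u α' β' h h' => ih _ (hv ▸ h') u h rfl
  set v := u + diag α β with hv
  -- any two first steps from `v` give the same result
  have key : ∀ γ δ, colIndex γ < colIndex δ → diag γ δ ≤ v →
      pathVia K e u α β = pathVia K e (v - diag γ δ) γ δ := by
    intro γ δ hγδ hle
    have hleα : diag α β ≤ v := by rw [hv]; exact le_add_self
    obtain ⟨hα, hβ⟩ := ne_zero_of_diag_le hleα
    obtain ⟨hγ, hδ⟩ := ne_zero_of_diag_le hle
    have hu : ∀ w', v = w' + diag α β → u = w' := fun w' h => add_right_cancel (hv.symm.trans h)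
    have hu' : ∀ w', v = w' + diag γ δ → v - diag γ δ = w' := fun w' h => by
      rw [h, add_tsub_cancel_right]
    have hne : ∀ {x y : Col d}, colIndex x < colIndex y → x.top ≠ y.bot := fun h h' => by
      have := colIndex_of_bot_eq_top h'.symm
      omega
    -- the three-variable cases
    have same_top : ∀ {x y y' : Col d}, colIndex x < colIndex y → colIndex x < colIndex y' →
        v x.top ≠ 0 → v y.bot ≠ 0 → v y'.bot ≠ 0 → y ≠ y' →
        ∃ w, v = w + Finsupp.single y'.bot 1 + diag x y ∧
          v = w + Finsupp.single y.bot 1 + diag x y' ∧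
          pathVia K e (w + Finsupp.single y'.bot 1) x y =
            pathVia K e (w + Finsupp.single y.bot 1) x y' := by
      intro x y y' h h' hx hy hy' hyy'
      have hle : Finsupp.single x.top 1 + Finsupp.single y.bot 1 + Finsupp.single y'.bot 1 ≤ v := by
        refine single_le_of_ne (single_le_of_ne (by simpa [Nat.one_le_iff_ne_zero] using hx) ?_ hy)
          ?_ hy'
        · simp [hne h]
        · simp [hne h', bot_injective.ne hyy']
      obtain ⟨w, hw⟩ := exists_add_of_le hle
      have hw1 : v = w + Finsupp.single y'.bot 1 + diag x y := by
        rw [hw, diag]; abel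
      have hw2 : v = w + Finsupp.single y.bot 1 + diag x y' := by
        rw [hw, diag]; abel
      refine ⟨w, hw1, hw2, ?_⟩
      rcases lt_trichotomy (colIndex y) (colIndex y') with hlt | heq | hlt
      · refine pathVia_eq_of_same_top he h hlt (ih' _ ?_)
        rw [← hw1, hn]
      · exact absurd (colIndex_injective heq) hyy'
      · refine (pathVia_eq_of_same_top he h' hlt (ih' _ ?_)).symm
        rw [← hw2, hn]
    have same_bot : ∀ {x x' y : Col d}, colIndex x < colIndex y → colIndex x' < colIndex y →
        v x.top ≠ 0 → v x'.top ≠ 0 → v y.bot ≠ 0 → x ≠ x' →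
        ∃ w, v = w + Finsupp.single x'.top 1 + diag x y ∧
          v = w + Finsupp.single x.top 1 + diag x' y ∧
          pathVia K e (w + Finsupp.single x'.top 1) x y =
            pathVia K e (w + Finsupp.single x.top 1) x' y := by
      intro x x' y h h' hx hx' hy hxx'
      have hle : Finsupp.single x.top 1 + Finsupp.single x'.top 1 + Finsupp.single y.bot 1 ≤ v := by
        refine single_le_of_ne (single_le_of_ne (by simpa [Nat.one_le_iff_ne_zero] using hx) ?_ hx')
          ?_ hy
        · simp [top_injective.ne hxx']
        · simp [hne h, hne h']
      obtain ⟨w, hw⟩ := exists_add_of_le hle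
      have hw1 : v = w + Finsupp.single x'.top 1 + diag x y := by
        rw [hw, diag]; abel
      have hw2 : v = w + Finsupp.single x.top 1 + diag x' y := by
        rw [hw, diag]; abel
      refine ⟨w, hw1, hw2, ?_⟩
      rcases lt_trichotomy (colIndex x) (colIndex x') with hlt | heq | hlt
      · refine pathVia_eq_of_same_bot he hlt h' (ih' _ ?_)
        rw [← hw1, hn]
      · exact absurd (colIndex_injective heq) hxx'
      · refine (pathVia_eq_of_same_bot he hlt h (ih' _ ?_)).symm
        rw [← hw2, hn]
    by_cases h1 : α = γ
    · subst h1
      by_cases h2 : β = δ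
      · subst h2
        rw [hu' u hv]
      · obtain ⟨w, hw1, hw2, h⟩ := same_top hαβ hγδ hα hβ hδ h2
        rwa [hu _ hw1, hu' _ hw2]
    by_cases h2 : β = δ
    · subst h2
      obtain ⟨w, hw1, hw2, h⟩ := same_bot hαβ hγδ hα hγ hβ h1
      rwa [hu _ hw1, hu' _ hw2]
    -- Neighbouring columns of a block: only three variables occur and there is no common diagonal
    -- end. The step (α, δ) shares its top with (α, β) and its bottom with (γ, δ), so it links the
    -- two; in the opposite case (γ, β) does.
    by_cases h3 : β.bot = γ.top
    · have h3' := colIndex_of_bot_eq_top h3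
      have hβδ : β ≠ δ := h2
      obtain ⟨w, hw1, hw2, h⟩ := same_top hαβ (y' := δ) (by omega) hα hβ hδ hβδ
      obtain ⟨w', hw1', hw2', h'⟩ := same_bot (x := α) (x' := γ) (y := δ) (by omega) hγδ hα hγ hδ h1
      rw [hu _ hw1, hu' _ hw2', h, ← h']
      congr 1
      exact add_right_cancel (hw2.symm.trans hw1')
    by_cases h4 : δ.bot = α.top
    · have h4' := colIndex_of_bot_eq_top h4
      obtain ⟨w, hw1, hw2, h⟩ := same_top (x := γ) (y := δ) (y' := β) hγδ (by omega) hγ hδ hβ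
        (Ne.symm h2)
      obtain ⟨w', hw1', hw2', h'⟩ := same_bot (x := γ) (x' := α) (y := β) (by omega) hαβ hγ hα hβ
        (Ne.symm h1)
      rw [hu _ hw2', hu' _ hw1, h, ← h']
      congr 1
      exact add_right_cancel (hw1'.symm.trans hw2)
    have hle4 : Finsupp.single α.top 1 + Finsupp.single β.bot 1 + Finsupp.single γ.top 1 +
        Finsupp.single δ.bot 1 ≤ v := by
      refine single_le_of_ne (single_le_of_ne hleα ?_ hγ) ?_ hδ
      · simp [top_injective.ne h1, h3]
      · simp [bot_injective.ne h2, Ne.symm h4, hne hγδ]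
    obtain ⟨w, hw⟩ := exists_add_of_le hle4
    have hw1 : v = w + diag γ δ + diag α β := by rw [hw, diag, diag]; abel
    have hw2 : v = w + diag α β + diag γ δ := by rw [hw, diag, diag]; abel
    rw [hu _ hw1, hu' _ hw2]
    exact pathVia_eq_of_disjoint he hαβ hγδ (ih' _ (by rw [← hw1, hn]))
  have hex : ∃ p : Col d × Col d, colIndex p.1 < colIndex p.2 ∧ diag p.1 p.2 ≤ v :=
    ⟨(α, β), hαβ, by rw [hv]; exact le_add_self⟩
  rw [reductionPath, dif_pos hex]
  exact (key _ _ hex.choose_spec.1 hex.choose_spec.2).symm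

/-- A multiple of a symbol is the difference of values attached to the two monomials of the
corresponding multiple of the minor. This turns `reductionPath` into a potential. -/
lemma monomial_smul_symbol (he : IsMinorSymbol (K := K) e) (u : Var d →₀ ℕ) (α β : Col d) :
    (monomial u (1 : K) : Amb K d) • e α β =
      reductionPath (K := K) e (u + diag α β) - reductionPath (K := K) e (u + diag β α) := by
  rcases lt_trichotomy (colIndex α) (colIndex β) with h | h | h
  · rw [reductionPath_eq he u h, pathVia, add_sub_cancel_right]
  · rw [colIndex_injective h, he.self, smul_zero, sub_self]
  · rw [he.antisymm, smul_neg, reductionPath_eq he u h, pathVia, sub_add_cancel_right]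

/-- The relations among the minors of the matrix of a scroll follow from the linear relations
and the Koszul relations. -/
theorem IsMinorSymbol.sum_smul_eq_zero [Module K E] [IsScalarTower K (Amb K d) E]
    (he : IsMinorSymbol (K := K) e) (c : Col d → Col d → Amb K d)
    (h : ∑ α, ∑ β, c α β * minor K d α β = 0) : ∑ α, ∑ β, c α β • e α β = 0 := by
  -- The linear extension of the potential carries g times a minor to g times its symbol, so a
  -- relation among the minors goes to T 0 = 0.
  let T : Amb K d →ₗ[K] E := (basisMonomials (Var d) K).constr K (reductionPath (K := K) e)
  have hT : ∀ v, T (monomial v 1) = reductionPath (K := K) e v := fun v => by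
    have := (basisMonomials (Var d) K).constr_basis K (reductionPath (K := K) e) v
    rwa [coe_basisMonomials] at this
  have key : ∀ (g : Amb K d) (α β : Col d), T (g * minor K d α β) = g • e α β := by
    intro g α β
    induction g using MvPolynomial.induction_on' with
    | monomial u c =>
      have : (monomial u c : Amb K d) = c • monomial u 1 := by rw [smul_monomial]; simp
      rw [this, smul_mul_assoc, map_smul, monomial_mul_minor, map_sub, hT, hT, smul_assoc,
        monomial_smul_symbol he]
    | add p q hp hq => rw [add_mul, map_add, hp, hq, add_smul]
  simp only [← key, ← map_sum, h, map_zero]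

end Syzygies

end Scroll
end

/-! ### The scroll and the cone as parts of total degree zero -/

noncomputable section

namespace Scroll

variable {K : Type*} [Field K] {k l : ℕ} {d : Fin k → ℕ}

/-- The exponent of the image of a variable under the pullback. -/
def varExp (x : Var d) : Fin 2 ⊕ Fin k →₀ ℕ :=
  Finsupp.single (Sum.inr x.1) 1 +
    (Finsupp.single (Sum.inl 0) (d x.1 - x.2) + Finsupp.single (Sum.inl 1) (x.2 : ℕ))

/-- The exponent of the image of a monomial under the pullback. -/
def pullExp : (Var d →₀ ℕ) →+ (Fin 2 ⊕ Fin k →₀ ℕ) := Finsupp.weight varExp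

lemma pullExp_single (x : Var d) (n : ℕ) : pullExp (Finsupp.single x n) = n • varExp x :=
  Finsupp.weight_single ..

lemma pullback_X (x : Var d) : pullback K d (X x) = monomial (varExp x) 1 := by
  rw [pullback, aeval_X, mul_assoc, st_eq_monomial, z, X, monomial_mul, one_mul, varExp]

lemma pullback_monomial (v : Var d →₀ ℕ) (c : K) :
    pullback K d (monomial v c) = monomial (pullExp v) c := by
  have h : ∀ v : Var d →₀ ℕ, pullback K d (monomial v 1) = monomial (pullExp v) 1 := by
    intro v
    induction v using Finsupp.induction_linear with
    | zero => simp only [map_zero, monomial_zero', map_one]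
    | add u v hu hv =>
      rw [← one_mul (1 : K), ← monomial_mul, map_mul, hu, hv, monomial_mul, map_add]
    | single x n =>
      rw [← X_pow_eq_monomial, map_pow, pullback_X, monomial_pow, pullExp_single, one_pow]
  rw [← mul_one c, ← smul_eq_mul, ← smul_monomial, map_smul, h, smul_monomial]

lemma pullback_top (α : Col d) : pullback K d (X α.top) = s K k * colForm K d α := by
  have := α.2.2
  rw [pullback, aeval_X, colForm]
  simp only [Col.top, Fin.val_castSucc]
  rw [show d α.1 - (α.2 : ℕ) = d α.1 - 1 - α.2 + 1 by omega]
  ring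

lemma pullback_bot (α : Col d) : pullback K d (X α.bot) = t K k * colForm K d α := by
  have := α.2.2
  rw [pullback, aeval_X, colForm]
  simp only [Col.bot, Fin.val_succ]
  rw [show d α.1 - ((α.2 : ℕ) + 1) = d α.1 - 1 - α.2 by omega]
  ring

lemma pullback_minor (α β : Col d) : pullback K d (minor K d α β) = 0 := by
  simp only [minor_eq, map_sub, map_mul, pullback_top, pullback_bot]
  ring

lemma weight_fib_varExp (x : Var d) : Finsupp.weight (fibWeight k) (varExp x) = 1 := by
  simp only [varExp, map_add, Finsupp.weight_single, fibWeight, Sum.elim_inl, Sum.elim_inr,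
    smul_zero, one_smul, add_zero]

lemma weight_tot_varExp (x : Var d) : Finsupp.weight (totWeight d) (varExp x) = 0 := by
  have := x.2.2
  simp only [varExp, map_add, Finsupp.weight_single, totWeight, Sum.elim_inl, Sum.elim_inr,
    mul_one, one_smul, nsmul_eq_mul]
  omega

lemma weight_pullExp {w : Fin 2 ⊕ Fin k → ℤ} {c : ℤ}
    (h : ∀ x : Var d, Finsupp.weight w (varExp x) = c) (v : Var d →₀ ℕ) :
    Finsupp.weight w (pullExp v) = Finsupp.weight (fun _ => c) v := by
  induction v using Finsupp.induction_linear with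
  | zero => simp
  | add u v hu hv => simp only [map_add, hu, hv]
  | single x n => rw [pullExp_single, map_nsmul, h, Finsupp.weight_single]

lemma pullback_isWeightedHomogeneous {w : Fin 2 ⊕ Fin k → ℤ} {c : ℤ}
    (h : ∀ x : Var d, Finsupp.weight w (varExp x) = c) {n : ℤ} {f : Amb K d}
    (hf : IsWeightedHomogeneous (fun _ => c) f n) : IsWeightedHomogeneous w (pullback K d f) n := by
  induction hf using IsWeightedHomogeneous.induction_on with
  | zero => rw [map_zero]; exact isWeightedHomogeneous_zero ..
  | add f g hf hg ihf ihg => rw [map_add]; exact ihf.add ihg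
  | monomial v c hv =>
    rw [pullback_monomial]
    exact isWeightedHomogeneous_monomial _ _ _ (by rw [weight_pullExp h, hv])

lemma fib_pullback {n : ℤ} {f : Amb K d} (hf : f ∈ grading K d n) : Fib n (pullback K d f) :=
  pullback_isWeightedHomogeneous weight_fib_varExp hf

lemma tot_pullback (f : Amb K d) : Tot d 0 (pullback K d f) :=
  pullback_isWeightedHomogeneous weight_tot_varExp (fun v _ => by simp [Finsupp.weight_apply])

lemma mul_mem_grading {m n : ℤ} {f g : Amb K d} (hf : f ∈ grading K d m) (hg : g ∈ grading K d n) :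
    f * g ∈ grading K d (m + n) := IsWeightedHomogeneous.mul hf hg

lemma X_mem_grading (x : Var d) : (X x : Amb K d) ∈ grading K d 1 := isWeightedHomogeneous_X _ _ _

lemma minor_mem_grading (α β : Col d) : minor K d α β ∈ grading K d 2 :=
  sub_mem (mul_mem_grading (X_mem_grading _) (X_mem_grading _))
    (mul_mem_grading (X_mem_grading _) (X_mem_grading _))

lemma eq_zero_of_mem_grading {n : ℤ} (hn : n < 0) {f : Amb K d} (hf : f ∈ grading K d n) :
    f = 0 :=
  IsWeightedHomogeneous.eq_zero_of_no_monomials hf fun v => by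
    have : (0 : ℤ) ≤ Finsupp.weight (fun _ : Var d => (1 : ℤ)) v := by
      rw [Finsupp.weight_apply]
      exact Finset.sum_nonneg fun _ _ => by positivity
    rintro rfl
    exact absurd this (not_le.mpr hn)

lemma varExp_le {u : Fin 2 ⊕ Fin k →₀ ℕ} {i : Fin k} {j : ℕ} (hj : j ≤ d i)
    (h : u (Sum.inr i) ≠ 0) (hs : d i - j ≤ u (Sum.inl 0)) (ht : j ≤ u (Sum.inl 1)) :
    varExp (⟨i, j, by omega⟩ : Var d) ≤ u := by
  classical
  rintro (y | y)
  · fin_cases y <;> simp [varExp, hs, ht]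
  · by_cases hy : i = y
    · subst hy; simp [varExp]; omega
    · simp [varExp, hy]

/-- The monomials of total degree zero are pulled back from the ambient space. -/
lemma exists_pullExp_eq {u : Fin 2 ⊕ Fin k →₀ ℕ} (hu : Finsupp.weight (totWeight d) u = 0) :
    ∃ v : Var d →₀ ℕ, pullExp v = u := by
  obtain ⟨n, hn⟩ : ∃ n : ℕ, ∑ i, u (Sum.inr i) = n := ⟨_, rfl⟩
  induction n generalizing u with
  | zero =>
    have h0 : ∀ i, u (Sum.inr i) = 0 := fun i =>
      (Finset.sum_eq_zero_iff.mp hn) i (Finset.mem_univ i)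
    rw [weight_tot_eq] at hu
    simp only [h0, Nat.cast_zero, mul_zero, Finset.sum_const_zero, sub_zero] at hu
    refine ⟨0, ?_⟩
    rw [map_zero]
    ext (y | y)
    · fin_cases y <;> simp <;> omega
    · simp [h0]
  | succ n ih =>
    obtain ⟨i, hi⟩ : ∃ i, u (Sum.inr i) ≠ 0 := by
      by_contra! h
      simp [h] at hn
    have hd : d i ≤ u (Sum.inl 0) + u (Sum.inl 1) := by
      have hsum : (d i : ℤ) * u (Sum.inr i) ≤ ∑ i, (d i : ℤ) * u (Sum.inr i) :=
        Finset.single_le_sum (f := fun i => (d i : ℤ) * u (Sum.inr i))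
          (fun _ _ => by positivity) (Finset.mem_univ i)
      have h1 : (d i : ℤ) * 1 ≤ (d i : ℤ) * u (Sum.inr i) := by
        gcongr
        exact_mod_cast Nat.one_le_iff_ne_zero.mpr hi
      rw [weight_tot_eq] at hu
      omega
    -- Split off a variable of block i with as many factors t as possible, at most d_i; the
    -- remaining factors come from s, and d_i ≤ u_s + u_t ensures that there are enough.
    have hle : varExp (⟨i, min (d i) (u (Sum.inl 1)), by omega⟩ : Var d) ≤ u :=
      varExp_le (by omega) hi (by omega) (by omega)
    obtain ⟨w, hw⟩ := exists_add_of_le hle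
    rw [hw, map_add, weight_tot_varExp, zero_add] at hu
    have hwn : ∑ i, w (Sum.inr i) = n := by
      have h1 : ∑ i', varExp (⟨i, min (d i) (u (Sum.inl 1)), by omega⟩ : Var d) (Sum.inr i') = 1 := by
        classical
        simp [varExp, Finsupp.single_apply]
      have h2 : ∑ i', u (Sum.inr i') = _ := Finset.sum_congr rfl fun i' _ =>
        DFunLike.congr_fun hw (Sum.inr i')
      simp only [Finsupp.add_apply, Finset.sum_add_distrib] at h2
      omega
    obtain ⟨v, hv⟩ := ih hu hwn
    exact ⟨Finsupp.single _ 1 + v, by rw [map_add, pullExp_single, one_smul, hv, ← hw]⟩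

/-- The elements of total degree zero are pulled back from the ambient space. -/
lemma exists_pullback_eq {f : Cox K k} (hf : Tot d 0 f) : ∃ g : Amb K d, pullback K d g = f := by
  induction hf using IsWeightedHomogeneous.induction_on with
  | zero => exact ⟨0, map_zero _⟩
  | add f g hf hg ihf ihg =>
    obtain ⟨f', rfl⟩ := ihf
    obtain ⟨g', rfl⟩ := ihg
    exact ⟨f' + g', map_add ..⟩
  | monomial u c hu =>
    obtain ⟨v, rfl⟩ := exists_pullExp_eq hu
    exact ⟨monomial v c, pullback_monomial ..⟩

lemma pullback_component (n : ℤ) (f : Amb K d) :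
    pullback K d (weightedHomogeneousComponent (fun _ => (1 : ℤ)) n f) =
      weightedHomogeneousComponent (fibWeight k) n (pullback K d f) := by
  induction f using MvPolynomial.induction_on' with
  | monomial v c =>
    have h1 : IsWeightedHomogeneous (fun _ : Var d => (1 : ℤ)) (monomial v c)
        (Finsupp.weight (fun _ => (1 : ℤ)) v) := isWeightedHomogeneous_monomial _ _ _ rfl
    have h2 := fib_pullback (K := K) (d := d) h1
    by_cases hn : n = Finsupp.weight (fun _ : Var d => (1 : ℤ)) v
    · rw [hn, weightedHomogeneousComponent_eq_self h1, weightedHomogeneousComponent_eq_self h2]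
    · rw [h1.weightedHomogeneousComponent_ne n hn, h2.weightedHomogeneousComponent_ne n hn,
        map_zero]
  | add f g hf hg => simp only [map_add, hf, hg]

lemma exists_mem_grading_pullback_eq {n : ℤ} {f : Cox K k} (hn : Fib n f) (hf : Tot d 0 f) :
    ∃ g ∈ grading K d n, pullback K d g = f := by
  obtain ⟨g, rfl⟩ := exists_pullback_eq hf
  exact ⟨_, weightedHomogeneousComponent_isWeightedHomogeneous n g, by
    rw [pullback_component, weightedHomogeneousComponent_eq_self hn]⟩

variable (K d) in
/-- The ideal of the scroll. -/
def minorIdeal : Ideal (Amb K d) := Ideal.span {f | ∃ α β, f = minor K d α β}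

lemma minor_mem (α β : Col d) : minor K d α β ∈ minorIdeal K d := Ideal.subset_span ⟨α, β, rfl⟩

lemma pullback_eq_zero_of_mem {f : Amb K d} (hf : f ∈ minorIdeal K d) : pullback K d f = 0 := by
  have : minorIdeal K d ≤ RingHom.ker (pullback K d) := by
    rw [minorIdeal, Ideal.span_le]
    rintro _ ⟨α, β, rfl⟩
    exact pullback_minor α β
  exact this hf

lemma pullExp_inl_one (v : Var d →₀ ℕ) :
    pullExp v (Sum.inl 1) = Finsupp.weight (fun x : Var d => (x.2 : ℕ)) v := by
  induction v using Finsupp.induction_linear with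
  | zero => simp
  | add u v hu hv => simp only [map_add, Finsupp.add_apply, hu, hv]
  | single x n =>
    rw [pullExp_single, Finsupp.weight_single]
    simp [varExp]

lemma pullExp_inr (v : Var d →₀ ℕ) (i : Fin k) (h : pullExp v (Sum.inr i) ≠ 0) :
    ∃ j, v ⟨i, j⟩ ≠ 0 := by
  contrapose! h
  induction v using Finsupp.induction_linear with
  | zero => simp
  | add u v hu hv =>
    rw [map_add, Finsupp.add_apply, hu fun j => ?_, hv fun j => ?_]
    · have := h j; simp only [Finsupp.add_apply] at this; omega
    · have := h j; simp only [Finsupp.add_apply] at this; omega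
  | single x n =>
    classical
    rw [pullExp_single]
    by_cases hx : x.1 = i
    · subst hx
      have := h x.2
      rw [Finsupp.single_eq_same] at this
      simp [this]
    · simp [varExp, hx]

/-- Modulo the minors the second index of a variable in a monomial can be raised. -/
lemma exists_sub_mem_minorIdeal_of_lt {w : Var d →₀ ℕ} {i : Fin k} {j : ℕ} (hj : j < d i)
    (hT : j < pullExp (w + Finsupp.single ⟨i, j, by omega⟩ 1) (Sum.inl 1)) :
    ∃ w' : Var d →₀ ℕ, pullExp (w' + Finsupp.single ⟨i, j + 1, by omega⟩ 1) =
        pullExp (w + Finsupp.single ⟨i, j, by omega⟩ 1) ∧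
      (monomial (w + Finsupp.single ⟨i, j, by omega⟩ 1) 1 -
        monomial (w' + Finsupp.single ⟨i, j + 1, by omega⟩ 1) 1 : Amb K d) ∈ minorIdeal K d := by
  rw [pullExp_inl_one, map_add, Finsupp.weight_single, one_smul] at hT
  obtain ⟨⟨i', j'⟩, hx, hj'⟩ : ∃ x : Var d, w x ≠ 0 ∧ (x.2 : ℕ) ≠ 0 := by
    by_contra! h
    have : Finsupp.weight (fun x : Var d => (x.2 : ℕ)) w = 0 := by
      rw [Finsupp.weight_apply]
      exact Finset.sum_eq_zero fun x hx => by simp [h x (Finsupp.mem_support_iff.mp hx)]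
    simp only [this] at hT
    omega
  obtain ⟨u, rfl⟩ := exists_add_of_le
    (show Finsupp.single ⟨i', j'⟩ 1 ≤ w by simpa [Nat.one_le_iff_ne_zero] using hx)
  let α : Col d := ⟨i, j, hj⟩
  let β : Col d := ⟨i', (j' : ℕ) - 1, by have := j'.2; simp only at hj'; omega⟩
  have hβ : β.bot = ⟨i', j'⟩ := by
    simp only [Col.bot, β, Sigma.mk.injEq, heq_eq_eq, true_and, Fin.ext_iff, Fin.val_succ]
    simp only at hj'; omega
  have hα : α.top = ⟨i, j, by omega⟩ := rfl
  have hα' : α.bot = ⟨i, j + 1, by omega⟩ := rfl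
  have e1 : Finsupp.single ⟨i', j'⟩ 1 + u + Finsupp.single ⟨i, j, by omega⟩ 1 = u + diag α β := by
    rw [diag, hβ, hα]; abel
  have e2 : u + Finsupp.single β.top 1 + Finsupp.single ⟨i, j + 1, by omega⟩ 1 = u + diag β α := by
    rw [diag, hα']; abel
  have hmem : (monomial (u + diag α β) 1 - monomial (u + diag β α) 1 : Amb K d) ∈
      minorIdeal K d := by
    rw [← monomial_mul_minor]
    exact Ideal.mul_mem_left _ _ (minor_mem α β)
  refine ⟨u + Finsupp.single β.top 1, ?_, ?_⟩
  · rw [e1, e2]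
    have := pullback_eq_zero_of_mem hmem
    rw [map_sub, pullback_monomial, pullback_monomial, sub_eq_zero] at this
    exact (monomial_left_injective one_ne_zero this).symm
  · rw [e1, e2]
    exact hmem

/-- The target index min (d_i, T) depends only on the block and on the exponent T of t in the
pullback. So two monomials with the same pullback can be brought to share a variable. -/
lemma exists_sub_mem_minorIdeal {w : Var d →₀ ℕ} {i : Fin k} {j : ℕ} (hj : j ≤ d i) {T : ℕ}
    (hT : pullExp (w + Finsupp.single ⟨i, j, by omega⟩ 1) (Sum.inl 1) = T) :
    ∃ w' : Var d →₀ ℕ, pullExp (w' + Finsupp.single ⟨i, min (d i) T, by omega⟩ 1) =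
        pullExp (w + Finsupp.single ⟨i, j, by omega⟩ 1) ∧
      (monomial (w + Finsupp.single ⟨i, j, by omega⟩ 1) 1 -
        monomial (w' + Finsupp.single ⟨i, min (d i) T, by omega⟩ 1) 1 : Amb K d) ∈
          minorIdeal K d := by
  have hjT : j ≤ T := by
    rw [pullExp_inl_one, map_add, Finsupp.weight_single, one_smul] at hT
    simp only at hT
    omega
  obtain ⟨n, hn⟩ : ∃ n, min (d i) T = j + n := ⟨min (d i) T - j, by omega⟩
  induction n generalizing w j with
  | zero =>
    refine ⟨w, ?_, ?_⟩
    · simp only [hn, add_zero]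
    · simp only [hn, add_zero, sub_self]; exact zero_mem _
  | succ n ih =>
    obtain ⟨w', hw', hm⟩ := exists_sub_mem_minorIdeal_of_lt (K := K) (w := w) (i := i) (j := j)
      (by omega) (by omega)
    obtain ⟨w'', hw'', hm'⟩ := ih (w := w') (j := j + 1) (by omega) (by rw [hw', hT]) (by omega)
      (by omega)
    exact ⟨w'', by rw [hw'', hw'], by simpa using add_mem hm hm'⟩

/-- Induction on the degree: equal pullbacks involve the same blocks, so modulo the minors both
monomials acquire the same variable of a block, which is then cancelled. -/
lemma monomial_sub_monomial_mem {v v' : Var d →₀ ℕ} (h : pullExp v = pullExp v') :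
    (monomial v 1 - monomial v' 1 : Amb K d) ∈ minorIdeal K d := by
  obtain ⟨n, hn⟩ : ∃ n, v.degree = n := ⟨_, rfl⟩
  have hzero : ∀ v : Var d →₀ ℕ, pullExp v = 0 → v = 0 := by
    intro v hv
    by_contra hne
    obtain ⟨x, hx⟩ := Finsupp.ne_iff.mp hne
    obtain ⟨u, rfl⟩ := exists_add_of_le
      (show Finsupp.single x 1 ≤ v by simpa [Nat.one_le_iff_ne_zero] using hx)
    have := DFunLike.congr_fun hv (Sum.inr x.1)
    rw [map_add, pullExp_single, one_smul] at this
    simp [varExp] at this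
  induction n generalizing v v' with
  | zero =>
    rw [Finsupp.degree_eq_zero_iff] at hn
    subst hn
    rw [map_zero] at h
    rw [hzero v' h.symm, sub_self]
    exact zero_mem _
  | succ n ih =>
    obtain ⟨⟨i, j⟩, hx⟩ : ∃ x, v x ≠ 0 := by
      by_contra! h0
      rw [show v = 0 from Finsupp.ext h0] at hn
      simp at hn
    obtain ⟨w, rfl⟩ := exists_add_of_le
      (show Finsupp.single ⟨i, j⟩ 1 ≤ v by simpa [Nat.one_le_iff_ne_zero] using hx)
    obtain ⟨j', hj'⟩ := pullExp_inr v' i (by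
      rw [← h, map_add, pullExp_single, one_smul]; simp [varExp])
    obtain ⟨w', rfl⟩ := exists_add_of_le
      (show Finsupp.single ⟨i, j'⟩ 1 ≤ v' by simpa [Nat.one_le_iff_ne_zero] using hj')
    rw [add_comm _ w] at h hn ⊢
    rw [add_comm _ w'] at h ⊢
    obtain ⟨u, hu, hm⟩ := exists_sub_mem_minorIdeal (K := K) (w := w) (i := i) (j := j)
      (by omega) rfl
    obtain ⟨u', hu', hm'⟩ := exists_sub_mem_minorIdeal (K := K) (w := w') (i := i) (j := j')
      (by omega) (T := pullExp (w + Finsupp.single ⟨i, j⟩ 1) (Sum.inl 1)) (by rw [h])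
    have huu : pullExp u = pullExp u' := by
      have h1 := (hu.trans h).trans hu'.symm
      rw [map_add _ u, map_add _ u'] at h1
      exact add_right_cancel h1
    have hdeg : u.degree = n := by
      have h1 : ∀ v : Var d →₀ ℕ, (v.degree : ℤ) = Finsupp.weight (fibWeight k) (pullExp v) := by
        intro v
        rw [weight_pullExp weight_fib_varExp, Finsupp.degree_eq_weight_one, Finsupp.weight_apply,
          Finsupp.weight_apply, Finsupp.sum, Finsupp.sum]
        simp
      have h2 := h1 (w + Finsupp.single ⟨i, j⟩ 1)
      have h3 := hu
      rw [h3.symm, ← h1, hn, map_add, Finsupp.degree_single] at h2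
      omega
    have h4 := ih huu hdeg
    have h5 := Ideal.mul_mem_left _ (monomial (Finsupp.single
      ⟨i, min (d i) (pullExp (w + Finsupp.single ⟨i, j⟩ 1) (Sum.inl 1)), by omega⟩ 1) 1) h4
    rw [mul_sub, monomial_mul, monomial_mul, one_mul, add_comm _ u, add_comm _ u'] at h5
    have := sub_mem (add_mem hm h5) hm'
    convert this using 1
    simp only [Fin.eta]
    ring

/-- The minors generate the ideal of the scroll. -/
lemma mem_minorIdeal_of_pullback_eq_zero {f : Amb K d} (hf : pullback K d f = 0) :
    f ∈ minorIdeal K d := by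
  -- A left inverse of the pullback modulo the minors: a monomial goes to the class of some monomial
  -- above it. The choice does not matter on the image, and values off the image are never used.
  let G : Cox K k →ₗ[K] Amb K d ⧸ minorIdeal K d :=
    (basisMonomials (Fin 2 ⊕ Fin k) K).constr K fun u =>
      Ideal.Quotient.mk _ (monomial (Function.invFun (pullExp (d := d)) u) 1)
  have hG : ∀ u, G (monomial u 1) =
      Ideal.Quotient.mk _ (monomial (Function.invFun (pullExp (d := d)) u) 1) := fun u => by
    have := (basisMonomials (Fin 2 ⊕ Fin k) K).constr_basis K (fun u =>
      Ideal.Quotient.mk (minorIdeal K d) (monomial (Function.invFun (pullExp (d := d)) u) 1)) u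
    rwa [coe_basisMonomials] at this
  have key : ∀ f : Amb K d, G (pullback K d f) = Ideal.Quotient.mkₐ K _ f := by
    intro f
    induction f using MvPolynomial.induction_on' with
    | monomial v c =>
      rw [pullback_monomial, show (monomial (pullExp v) c : Cox K k) = c • monomial (pullExp v) 1 by
        rw [smul_monomial]; simp, show (monomial v c : Amb K d) = c • monomial v 1 by
        rw [smul_monomial]; simp, map_smul, map_smul, hG]
      congr 1
      refine Ideal.Quotient.eq.mpr (monomial_sub_monomial_mem ?_)
      exact Function.invFun_eq ⟨v, rfl⟩
    | add f g hf hg => simp only [map_add, hf, hg]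
  have := key f
  rw [hf, map_zero] at this
  exact Ideal.Quotient.eq_zero_iff_mem.mp this.symm

lemma exists_eq_sum_minor {n : ℤ} {f : Amb K d} (hn : f ∈ grading K d n)
    (hf : pullback K d f = 0) :
    ∃ c : Col d → Col d → Amb K d, (∀ α β, c α β ∈ grading K d (n - 2)) ∧
      f = ∑ α, ∑ β, c α β * minor K d α β := by
  have h := mem_minorIdeal_of_pullback_eq_zero hf
  have hset : {f | ∃ α β, f = minor K d α β} =
      Set.range fun p : Col d × Col d => minor K d p.1 p.2 := by
    ext f; simp [eq_comm]
  rw [minorIdeal, hset] at h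
  obtain ⟨c, hc⟩ := (Ideal.mem_span_range_iff_exists_fun).mp h
  refine ⟨fun α β => weightedHomogeneousComponent (fun _ => (1 : ℤ)) (n - 2) (c (α, β)),
    fun α β => weightedHomogeneousComponent_isWeightedHomogeneous _ _, ?_⟩
  rw [← weightedHomogeneousComponent_eq_self hn, ← hc, map_sum, Fintype.sum_prod_type]
  refine Finset.sum_congr rfl fun α _ => Finset.sum_congr rfl fun β _ => ?_
  rw [mul_comm, weightedHomogeneousComponent_mul_left' (minor_mem_grading α β), mul_comm]

section Cone

variable {P : Fin l → Cox K k} {a : ℕ} {b : Fin l → ℕ}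

/-- In a member of J of total degree 0, the coefficient of P_i has total degree b_i. It is therefore
a combination of the s^(b_i-m) t^m with pulled-back coefficients, which is a combination of rolling
factors equations. The remaining ambiguity lies in the ideal of the scroll. -/
lemma mem_coneIdeal_iff (hP : ∀ i, Tot d (-(b i : ℤ)) (P i)) {f : Amb K d} :
    f ∈ coneIdeal d b P ↔ pullback K d f ∈ idealOf P := by
  constructor
  · intro h
    have : coneIdeal d b P ≤ (idealOf P).comap (pullback K d) := by
      rw [coneIdeal, Ideal.span_le]
      rintro _ (⟨α, β, rfl⟩ | ⟨i, m, -, hm⟩)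
      · rw [SetLike.mem_coe, Ideal.mem_comap, pullback_minor]
        exact zero_mem _
      · rw [SetLike.mem_coe, Ideal.mem_comap, hm]
        exact Ideal.mul_mem_left _ _ (mem_idealOf i)
    exact this h
  · intro h
    obtain ⟨c, hc, hf⟩ := exists_eq_sum_of_mem_idealOf hP (tot_pullback f) h
    choose c' hc' hcc using fun i => Tot.exists_eq_sum le_rfl (b i) (hc i)
    choose g hg using fun i m => exists_pullback_eq (hc' i m)
    have htot : ∀ i m, m ≤ b i → Tot d 0 (s K k ^ (b i - m) * t K k ^ m * P i) := by
      intro i m hm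
      have := (tot_st d (b i - m) m).mul (hP i)
      rwa [show ((b i - m : ℕ) : ℤ) + m + -(b i : ℤ) = 0 by omega] at this
    have hlift : ∀ i m, ∃ p : Amb K d, p ∈ coneIdeal d b P ∧
        (m ≤ b i → pullback K d p = s K k ^ (b i - m) * t K k ^ m * P i) := by
      intro i m
      by_cases hm : m ≤ b i
      · obtain ⟨p, hp⟩ := exists_pullback_eq (htot i m hm)
        exact ⟨p, Ideal.subset_span (Or.inr ⟨i, m, hm, hp⟩), fun _ => hp⟩
      · exact ⟨0, zero_mem _, fun h => absurd h hm⟩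
    choose p hp hpp using hlift
    have hsum : ∑ i, ∑ m ∈ Finset.range (b i + 1), p i m * g i m ∈ coneIdeal d b P :=
      sum_mem fun i _ => sum_mem fun m _ => Ideal.mul_mem_right _ _ (hp i m)
    have hle : minorIdeal K d ≤ coneIdeal d b P := Ideal.span_mono Set.subset_union_left
    have hker := hle (mem_minorIdeal_of_pullback_eq_zero (K := K) (d := d)
      (f := f - ∑ i, ∑ m ∈ Finset.range (b i + 1), p i m * g i m) (by
        rw [map_sub, sub_eq_zero, hf, map_sum]
        refine Finset.sum_congr rfl fun i _ => ?_
        rw [hcc, Finset.mul_sum, map_sum]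
        refine Finset.sum_congr rfl fun m hm => ?_
        rw [map_mul, hpp i m (by simp at hm; omega), hg]
        ring))
    simpa using add_mem hker hsum

end Cone

end Scroll

end

/-! ### Couplings and the homomorphisms they define -/

noncomputable section

namespace Scroll

open Cotangent

variable {K : Type*} [Field K] {k l : ℕ} {d : Fin k → ℕ} {P : Fin l → Cox K k} {a : ℕ}
  {b : Fin l → ℕ}

lemma component_st_mul {n : ℤ} (p q : ℕ) (f : Cox K k) :
    weightedHomogeneousComponent (fibWeight k) n (s K k ^ p * t K k ^ q * f) =
      s K k ^ p * t K k ^ q * weightedHomogeneousComponent (fibWeight k) n f := by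
  rw [weightedHomogeneousComponent_mul_left' (fib_st p q), sub_zero]

/-- Splitting elements of total degree `b` into elements of total degree zero. -/
lemma Tot.exists_eq_sum_pullback {n : ℤ} {c : ℕ} {f : Cox K k} (hf : Tot d c f) (hn : Fib n f) :
    ∃ g : ℕ → Amb K d, (∀ m, g m ∈ grading K d n) ∧
      f = ∑ m ∈ Finset.range (c + 1), s K k ^ (c - m) * t K k ^ m * pullback K d (g m) := by
  obtain ⟨h, hh, hfh⟩ := Tot.exists_eq_sum le_rfl c (by rwa [zero_add] : Tot d (0 + c) f)
  choose g hg hgh using fun m => exists_mem_grading_pullback_eq (K := K) (d := d)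
    (weightedHomogeneousComponent_isWeightedHomogeneous (w := fibWeight k) n (h m))
    (IsWeightedHomogeneous.component_of_isWeightedHomogeneous (hh m) n)
  refine ⟨g, hg, ?_⟩
  rw [← weightedHomogeneousComponent_eq_self hn, hfh, map_sum]
  exact Finset.sum_congr rfl fun m _ => by rw [component_st_mul, hgh]

lemma tot_sum_st {e : ℤ} {c : ℕ} {M : ℕ → Cox K k} (hM : ∀ m, Tot d e (M m)) :
    Tot d (c + e) (∑ m ∈ Finset.range (c + 1), s K k ^ (c - m) * t K k ^ m * M m) := by
  refine sum_mem (S := weightedHomogeneousSubmodule K (totWeight d) _) fun m hm => ?_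
  have h := (tot_st d (c - m) m).mul (hM m)
  rwa [show ((c - m : ℕ) : ℤ) + m = c by simp at hm; omega] at h

lemma fib_sum_st {n : ℤ} {c : ℕ} {M : ℕ → Cox K k} (hM : ∀ m, Fib n (M m)) :
    Fib n (∑ m ∈ Finset.range (c + 1), s K k ^ (c - m) * t K k ^ m * M m) := by
  refine sum_mem (S := weightedHomogeneousSubmodule K (fibWeight k) _) fun m hm => ?_
  have h := (fib_st (c - m) m).mul (hM m)
  rwa [zero_add] at h

lemma sum_mul_sum_sub_mul {R ι κ : Type*} [CommRing R] (S : Finset ι) (S' : Finset κ) (u : ι → R)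
    (u' : κ → R) (c : ι → κ → R) (c' : κ → ι → R) (p : R) :
    ∑ m ∈ S, u m * ∑ m' ∈ S', (c m m' - c' m' m) * (u' m' * p) =
      (∑ m ∈ S, u m * ∑ m' ∈ S', u' m' * c m m' - ∑ m' ∈ S', u' m' * ∑ m ∈ S, u m * c' m' m) *
        p := by
  simp only [Finset.mul_sum]
  rw [Finset.sum_comm (s := S'), ← Finset.sum_sub_distrib, Finset.sum_mul]
  refine Finset.sum_congr rfl fun m _ => ?_
  rw [← Finset.sum_sub_distrib, Finset.sum_mul]
  exact Finset.sum_congr rfl fun m' _ => by ring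

/-- A relation among the rolling factors equations is, up to Koszul relations, given by
differences. -/
lemma exists_differences (ha : 0 < a) (hP : ∀ i, IsDivisorEquation d a (b i) (P i))
    (hV : IsCompleteIntersection P) {M : Fin l → ℕ → Cox K k} (hM : ∀ i m, Tot d 0 (M i m))
    (h : ∑ i, P i * ∑ m ∈ Finset.range (b i + 1), s K k ^ (b i - m) * t K k ^ m * M i m = 0) :
    ∃ N : Fin l → ℕ → Cox K k, ∃ B : Fin l → Fin l → ℕ → ℕ → Amb K d,
      (∀ i m, Tot d (-1) (N i m)) ∧ (∀ i, N i 0 = 0) ∧ (∀ i, N i (b i + 1) = 0) ∧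
      ∀ i, ∀ m ≤ b i, M i m = t K k * N i (m + 1) - s K k * N i m +
        ∑ i', ∑ m' ∈ Finset.range (b i' + 1), (pullback K d (B i i' m m') -
          pullback K d (B i' i m' m)) * (s K k ^ (b i' - m') * t K k ^ m' * P i') := by
  -- The inner sums form a syzygy of the P_i, hence a Koszul one. Its entries have total degree b_i
  -- + b_{i'} and are split along the monomials in s and t for i and then for i', which turns them
  -- into Koszul coefficients for the rolling factors equations.
  obtain ⟨B, hB, hMB⟩ := exists_koszul ha hP hV (e := 0) (by omega)
    (m := fun i => ∑ m ∈ Finset.range (b i + 1), s K k ^ (b i - m) * t K k ^ m * M i m)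
    (fun i => tot_sum_st (hM i)) h
  choose B' hB' hBB' using fun i i' => Tot.exists_eq_sum (d := d) (e := b i') (by omega) (b i)
    (f := B i i') (by have := hB i i'; rwa [add_zero, add_comm] at this)
  choose B'' hB'' hBB'' using fun i i' m => Tot.exists_eq_sum (d := d) le_rfl (b i')
    (by rw [zero_add]; exact hB' i i' m)
  choose C hC using fun i i' m m' => exists_pullback_eq (hB'' i i' m m')
  let D : Fin l → ℕ → Cox K k := fun i m =>
    ∑ i', ∑ m' ∈ Finset.range (b i' + 1), (pullback K d (C i i' m m') -
          pullback K d (C i' i m' m)) * (s K k ^ (b i' - m') * t K k ^ m' * P i')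
  have hD : ∀ i, ∑ m ∈ Finset.range (b i + 1), s K k ^ (b i - m) * t K k ^ m * (M i m - D i m) =
      0 := by
    intro i
    simp only [mul_sub, Finset.sum_sub_distrib, hMB i, sub_eq_zero, D, Finset.mul_sum]
    rw [Finset.sum_comm]
    refine Finset.sum_congr rfl fun i' _ => ?_
    rw [hBB' i i', hBB' i' i]
    simp only [hBB'', hC]
    rw [← sum_mul_sum_sub_mul]
    simp only [Finset.mul_sum]
  have hDtot : ∀ i m, Tot d 0 (D i m) := by
    intro i m
    refine sum_mem (S := weightedHomogeneousSubmodule K (totWeight d) _) fun i' _ =>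
      sum_mem fun m' hm' => ?_
    have h := ((tot_pullback (C i i' m m')).sub (tot_pullback (C i' i m' m))).mul
      ((tot_st d (b i' - m') m').mul (hP i').tot)
    rwa [show (0 : ℤ) + (((b i' - m' : ℕ) : ℤ) + m' + -(b i' : ℤ)) = 0 by
      simp at hm'; omega] at h
  choose N hN0 hN1 hN using fun i => exists_eq_of_sum_eq_zero (b i) _ (hD i)
  refine ⟨fun i m => weightedHomogeneousComponent (totWeight d) (-1) (N i m), C,
    fun i m => weightedHomogeneousComponent_isWeightedHomogeneous _ _,
    fun i => by simp only [hN0, map_zero], fun i => by simp only [hN1, map_zero], ?_⟩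
  intro i m hm
  -- The N obtained from the syzygies of s and t need not be homogeneous; the equation survives
  -- passage to total degree -1, since its left side has total degree 0.
  have h1 := congrArg (weightedHomogeneousComponent (totWeight d) 0) (hN i m hm)
  rw [weightedHomogeneousComponent_eq_self ((hM i m).sub (hDtot i m)), map_sub,
    weightedHomogeneousComponent_mul_left' (tot_t d),
    weightedHomogeneousComponent_mul_left' (tot_s d)] at h1
  rw [← sub_eq_iff_eq_add]
  exact h1

/-- A choice of coefficients that express the equations of the cone by the rolling factors
equations. -/
structure IsFactorization (d : Fin k → ℕ) (a : ℕ) (b : Fin l → ℕ) (P : Fin l → Cox K k)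
    (q : Gen (grading K d) (coneIdeal d b P) → Fin l → ℕ → Amb K d) : Prop where
  mem : ∀ p i m, q p i m ∈ grading K d (p.deg - a)
  eq : ∀ p, pullback K d p.elt = ∑ i, P i * ∑ m ∈ Finset.range (b i + 1),
    s K k ^ (b i - m) * t K k ^ m * pullback K d (q p i m)
  zero : ∀ p, pullback K d p.elt = 0 → ∀ i m, q p i m = 0

lemma exists_isFactorization (hP : ∀ i, IsDivisorEquation d a (b i) (P i)) :
    ∃ q, IsFactorization d a b P q := by
  have H : ∀ p : Gen (grading K d) (coneIdeal d b P), ∃ q : Fin l → ℕ → Amb K d,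
      (∀ i m, q i m ∈ grading K d (p.deg - a)) ∧
      (pullback K d p.elt = ∑ i, P i * ∑ m ∈ Finset.range (b i + 1),
        s K k ^ (b i - m) * t K k ^ m * pullback K d (q i m)) ∧
      (pullback K d p.elt = 0 → ∀ i m, q i m = 0) := by
    intro p
    by_cases h0 : pullback K d p.elt = 0
    -- Elements of the ideal of the scroll get coefficients zero, so they contribute nothing to
    -- `factor`.
    · exact ⟨0, fun _ _ => zero_mem _, by simp [h0], fun _ _ _ => rfl⟩
    obtain ⟨c, hct, hcf, hc⟩ := exists_fib_eq_sum_of_mem_idealOf (fun i => (hP i).fib)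
      (fun i => (hP i).tot) (fib_pullback p.homogeneous) (tot_pullback p.elt)
      ((mem_coneIdeal_iff fun i => (hP i).tot).mp p.mem)
    choose q hq hcq using fun i => Tot.exists_eq_sum_pullback (by simpa using hct i) (hcf i)
    exact ⟨q, hq, by simp only [← hcq, hc], fun h => absurd h h0⟩
  choose q h1 h2 h3 using H
  exact ⟨q, h1, h2, h3⟩

variable {q : Gen (grading K d) (coneIdeal d b P) → Fin l → ℕ → Amb K d}

variable (q) in
/-- The coefficient of a rolling factors equation in an element of the free module. -/
def factor (i : Fin l) (m : ℕ) : Free (grading K d) (coneIdeal d b P) →ₗ[Amb K d] Amb K d :=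
  Finsupp.linearCombination (Amb K d) fun p => q p i m

lemma factor_basis (i : Fin l) (m : ℕ) (p : Gen (grading K d) (coneIdeal d b P)) :
    factor q i m (Free.basis p) = q p i m := by
  simp [factor, Free.basis, Finsupp.linearCombination_single]

lemma IsFactorization.factor_mem (hq : IsFactorization d a b P q)
    {r : Free (grading K d) (coneIdeal d b P)} {n : ℤ} (hr : r.IsHomogeneousOfDegree n)
    (i : Fin l) (m : ℕ) : factor q i m r ∈ grading K d (n - a) := by
  rw [factor, Finsupp.linearCombination_apply, Finsupp.sum]
  refine sum_mem fun p _ => ?_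
  have := mul_mem_grading (hr p) (hq.mem p i m)
  rwa [sub_add_sub_cancel] at this

lemma IsFactorization.pullback_eq (hq : IsFactorization d a b P q)
    (r : Free (grading K d) (coneIdeal d b P)) :
    pullback K d (Finsupp.linearCombination (Amb K d) (fun p => p.elt) r) =
      ∑ i, P i * ∑ m ∈ Finset.range (b i + 1),
        s K k ^ (b i - m) * t K k ^ m * pullback K d (factor q i m r) := by
  induction r using Finsupp.induction_linear with
  | zero => simp
  | add f g hf hg =>
    simp only [map_add, hf, hg, mul_add, Finset.sum_add_distrib]
  | single p c =>
    simp only [factor, Finsupp.linearCombination_single, smul_eq_mul, map_mul, hq.eq p,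
      Finset.mul_sum]
    exact Finset.sum_congr rfl fun i _ => Finset.sum_congr rfl fun m _ => by ring

variable (q) in
/-- `N` expresses the coefficients of the relation `r` as differences. -/
structure IsCoupling (r : Free (grading K d) (coneIdeal d b P)) (N : Fin l → ℕ → Cox K k) :
    Prop where
  tot : ∀ i m, Tot d (-1) (N i m)
  first : ∀ i, N i 0 = 0
  last : ∀ i, N i (b i + 1) = 0
  sub_mem : ∀ i, ∀ m ≤ b i, pullback K d (factor q i m r) -
    (t K k * N i (m + 1) - s K k * N i m) ∈ idealOf P

lemma IsCoupling.add {r r' : Free (grading K d) (coneIdeal d b P)} {N N' : Fin l → ℕ → Cox K k}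
    (h : IsCoupling q r N) (h' : IsCoupling q r' N') : IsCoupling q (r + r') (N + N') where
  tot i m := (h.tot i m).add (h'.tot i m)
  first i := by simp [h.first, h'.first]
  last i := by simp [h.last, h'.last]
  sub_mem i m hm := by
    convert add_mem (h.sub_mem i m hm) (h'.sub_mem i m hm) using 1
    simp only [map_add, Pi.add_apply]
    ring

lemma IsCoupling.smul {r : Free (grading K d) (coneIdeal d b P)} {N : Fin l → ℕ → Cox K k}
    (h : IsCoupling q r N) (g : Amb K d) :
    IsCoupling q (g • r) (fun i m => pullback K d g * N i m) where
  tot i m := by simpa using (tot_pullback g).mul (h.tot i m)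
  first i := by simp [h.first]
  last i := by simp [h.last]
  sub_mem i m hm := by
    convert Ideal.mul_mem_left _ (pullback K d g) (h.sub_mem i m hm) using 1
    simp only [map_smul, smul_eq_mul, map_mul]
    ring

/-- Applied to a difference of two couplings of one relation, this gives uniqueness modulo J;
applied to a Koszul relation, it gives vanishing. -/
lemma IsCoupling.mem_idealOf (ha : 0 < a) (hP : ∀ i, IsDivisorEquation d a (b i) (P i))
    (hV : IsCompleteIntersection P) {r : Free (grading K d) (coneIdeal d b P)}
    {N : Fin l → ℕ → Cox K k} (h : IsCoupling q r N)
    (hr : ∀ i, ∀ m ≤ b i, factor q i m r ∈ coneIdeal d b P) (i : Fin l) {m : ℕ}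
    (hm : m ≤ b i + 1) : N i m ∈ idealOf P := by
  refine mem_idealOf_of_differences ha hP hV (h.tot i) (by rw [h.first]; exact zero_mem _)
    (by rw [h.last]; exact zero_mem _) (fun m hm => ?_) hm
  have := _root_.sub_mem ((mem_coneIdeal_iff fun i => (hP i).tot).mp (hr i m hm)) (h.sub_mem i m hm)
  simpa using this

lemma tot_t_mul {N : Cox K k} (h : Tot d (-1) N) : Tot d 0 (t K k * N) := by
  simpa using (tot_t d).mul h

/-- The elements of total degree zero, modulo the equations of `V`, as elements of the
coordinate ring of the cone. -/
def toCone (b : Fin l → ℕ) (P : Fin l → Cox K k) (f : Cox K k) : Amb K d ⧸ coneIdeal d b P :=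
  open Classical in if h : ∃ g : Amb K d, pullback K d g = f then
    Ideal.Quotient.mk _ h.choose else 0

lemma toCone_eq (hP : ∀ i, IsDivisorEquation d a (b i) (P i)) {f : Cox K k} {g : Amb K d}
    (h : pullback K d g - f ∈ idealOf P) (hf : Tot d 0 f) :
    toCone b P f = Ideal.Quotient.mk (coneIdeal d b P) g := by
  have hex := exists_pullback_eq hf
  rw [toCone, dif_pos hex, Ideal.Quotient.eq, mem_coneIdeal_iff fun i => (hP i).tot, map_sub,
    hex.choose_spec, ← neg_mem_iff, neg_sub]
  exact h

lemma exists_isCoupling (ha : 0 < a) (hP : ∀ i, IsDivisorEquation d a (b i) (P i))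
    (hV : IsCompleteIntersection P) (hq : IsFactorization d a b P q)
    (r : relations (grading K d) (coneIdeal d b P)) :
    ∃ N, IsCoupling q (r : Free (grading K d) (coneIdeal d b P)) N := by
  obtain ⟨N, B, h1, h2, h3, h4⟩ := exists_differences ha hP hV
    (M := fun i m => pullback K d (factor q i m r)) (fun i m => tot_pullback _) (by
      rw [← hq.pullback_eq, show Finsupp.linearCombination _ _ _ = _ from r.2, map_zero])
  refine ⟨N, h1, h2, h3, fun i m hm => ?_⟩
  rw [h4 i m hm, add_sub_cancel_left]
  exact sum_mem fun i' _ => sum_mem fun m' _ => Ideal.mul_mem_left _ _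
    (Ideal.mul_mem_left _ _ (mem_idealOf i'))

lemma toCone_coupling_eq (ha : 0 < a) (hP : ∀ i, IsDivisorEquation d a (b i) (P i))
    (hV : IsCompleteIntersection P) {r : Free (grading K d) (coneIdeal d b P)}
    {N N' : Fin l → ℕ → Cox K k} (h : IsCoupling q r N) (h' : IsCoupling q r N') (i : Fin l)
    {m : ℕ} (hm : m ≤ b i) :
    toCone (d := d) b P (t K k * N i (m + 1)) = toCone b P (t K k * N' i (m + 1)) := by
  have h0 := (h.add (h'.smul (-1))).mem_idealOf ha hP hV (fun i m _ => by simp) i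
    (m := m + 1) (by omega)
  obtain ⟨g, hg⟩ := exists_pullback_eq (tot_t_mul (h'.tot i (m + 1)))
  rw [toCone_eq hP (by rw [hg, sub_self]; exact zero_mem _) (tot_t_mul (h'.tot i (m + 1))),
    toCone_eq hP (g := g) _ (tot_t_mul (h.tot i (m + 1)))]
  rw [hg, ← mul_sub, ← neg_mem_iff, ← mul_neg, neg_sub]
  refine Ideal.mul_mem_left _ _ ?_
  simpa [sub_eq_add_neg] using h0

/-- The homomorphisms on the module of relations that give the second cotangent module. -/
def couplingHom (ha : 0 < a) (hP : ∀ i, IsDivisorEquation d a (b i) (P i))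
    (hV : IsCompleteIntersection P) (hq : IsFactorization d a b P q) (i : Fin l) {m : ℕ}
    (hm : m ≤ b i) :
    relations (grading K d) (coneIdeal d b P) →ₗ[Amb K d] Amb K d ⧸ coneIdeal d b P where
  toFun r := toCone b P (t K k * (exists_isCoupling ha hP hV hq r).choose i (m + 1))
  map_add' r r' := by
    set N := (exists_isCoupling ha hP hV hq r).choose
    set N' := (exists_isCoupling ha hP hV hq r').choose
    have hN : IsCoupling q _ N := (exists_isCoupling ha hP hV hq r).choose_spec
    have hN' : IsCoupling q _ N' := (exists_isCoupling ha hP hV hq r').choose_spec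
    rw [toCone_coupling_eq ha hP hV (exists_isCoupling ha hP hV hq (r + r')).choose_spec
      (hN.add hN') i hm]
    obtain ⟨g, hg⟩ := exists_pullback_eq (tot_t_mul (hN.tot i (m + 1)))
    obtain ⟨g', hg'⟩ := exists_pullback_eq (tot_t_mul (hN'.tot i (m + 1)))
    rw [toCone_eq hP (by rw [hg, sub_self]; exact zero_mem _) (tot_t_mul (hN.tot i (m + 1))),
      toCone_eq hP (by rw [hg', sub_self]; exact zero_mem _) (tot_t_mul (hN'.tot i (m + 1))),
      ← map_add]
    refine toCone_eq hP ?_ (tot_t_mul ((hN.add hN').tot i (m + 1)))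
    rw [map_add, hg, hg', Pi.add_apply, Pi.add_apply, mul_add, sub_self]
    exact zero_mem _
  map_smul' c r := by
    set N := (exists_isCoupling ha hP hV hq r).choose
    have hN : IsCoupling q _ N := (exists_isCoupling ha hP hV hq r).choose_spec
    rw [toCone_coupling_eq ha hP hV (exists_isCoupling ha hP hV hq (c • r)).choose_spec
      (hN.smul c) i hm]
    obtain ⟨g, hg⟩ := exists_pullback_eq (tot_t_mul (hN.tot i (m + 1)))
    rw [toCone_eq hP (by rw [hg, sub_self]; exact zero_mem _) (tot_t_mul (hN.tot i (m + 1))),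
      RingHom.id_apply, ← Ideal.Quotient.mk_eq_mk, ← Submodule.Quotient.mk_smul,
      Ideal.Quotient.mk_eq_mk]
    refine toCone_eq hP ?_ (tot_t_mul ((hN.smul c).tot i (m + 1)))
    rw [smul_eq_mul, map_mul, hg, mul_left_comm, sub_self]
    exact zero_mem _

lemma couplingHom_eq (ha : 0 < a) (hP : ∀ i, IsDivisorEquation d a (b i) (P i))
    (hV : IsCompleteIntersection P) (hq : IsFactorization d a b P q) (i : Fin l) {m : ℕ}
    (hm : m ≤ b i) {r : relations (grading K d) (coneIdeal d b P)} {N : Fin l → ℕ → Cox K k}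
    (hN : IsCoupling q (r : Free (grading K d) (coneIdeal d b P)) N) :
    couplingHom ha hP hV hq i hm r = toCone b P (t K k * N i (m + 1)) :=
  toCone_coupling_eq ha hP hV (exists_isCoupling ha hP hV hq r).choose_spec hN i hm

/-- The condition covers Koszul relations, whose rolling coefficients are multiples of members of
the ideal, and also relations that involve only elements of the ideal of the scroll. -/
lemma couplingHom_eq_zero (ha : 0 < a) (hP : ∀ i, IsDivisorEquation d a (b i) (P i))
    (hV : IsCompleteIntersection P) (hq : IsFactorization d a b P q) (i : Fin l) {m : ℕ}
    (hm : m ≤ b i) {r : relations (grading K d) (coneIdeal d b P)}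
    (hr : ∀ i, ∀ m ≤ b i, factor q i m r ∈ coneIdeal d b P) :
    couplingHom ha hP hV hq i hm r = 0 := by
  obtain ⟨N, hN⟩ := exists_isCoupling ha hP hV hq r
  rw [couplingHom_eq ha hP hV hq i hm hN, toCone_eq hP (g := 0) _ (tot_t_mul (hN.tot _ _)),
    map_zero]
  rw [map_zero, zero_sub, neg_mem_iff]
  exact Ideal.mul_mem_left _ _ (hN.mem_idealOf ha hP hV hr i (by omega))

lemma couplingHom_mem (ha : 0 < a) (hP : ∀ i, IsDivisorEquation d a (b i) (P i))
    (hV : IsCompleteIntersection P) (hq : IsFactorization d a b P q) (i : Fin l) {m : ℕ}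
    (hm : m ≤ b i) :
    couplingHom ha hP hV hq i hm ∈ relHomPart (grading K d) (coneIdeal d b P) (-(a : ℤ)) := by
  refine ⟨fun r ⟨p, p', hr⟩ => couplingHom_eq_zero ha hP hV hq i hm fun i m _ => ?_,
    fun n r hr => ?_⟩
  · rw [hr, map_sub, map_smul, map_smul]
    exact sub_mem (Ideal.mul_mem_right _ _ p.mem) (Ideal.mul_mem_right _ _ p'.mem)
  · obtain ⟨N, hN⟩ := exists_isCoupling ha hP hV hq r
    -- For homogeneous r the rolling coefficients have fibre degree n - a, so the components of N in
    -- that degree again form a coupling. It shows that the value is homogeneous.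
    have hN' : IsCoupling q (r : Free (grading K d) (coneIdeal d b P)) (fun i m =>
        weightedHomogeneousComponent (fibWeight k) (n + -(a : ℤ)) (N i m)) := by
      refine ⟨fun i m => IsWeightedHomogeneous.component_of_isWeightedHomogeneous (hN.tot i m) _,
        fun i => by simp only [hN.first, map_zero], fun i => by simp only [hN.last, map_zero],
        fun i m hm => ?_⟩
      have := component_mem_idealOf (fun i => ⟨_, (hP i).fib⟩) (hN.sub_mem i m hm)
        (n + -(a : ℤ))
      rwa [map_sub, map_sub, weightedHomogeneousComponent_eq_self
        (fib_pullback (by rw [← sub_eq_add_neg]; exact hq.factor_mem hr i m)),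
        weightedHomogeneousComponent_mul_left' fib_t,
        weightedHomogeneousComponent_mul_left' fib_s, sub_zero] at this
    obtain ⟨g, hgn, hg⟩ := exists_mem_grading_pullback_eq (d := d) (n := n + -(a : ℤ))
      (f := t K k * weightedHomogeneousComponent (fibWeight k) (n + -(a : ℤ)) (N i (m + 1)))
      (by
        have := (fib_t (K := K) (k := k)).mul (weightedHomogeneousComponent_isWeightedHomogeneous
          (w := fibWeight k) (n + -(a : ℤ)) (N i (m + 1)))
        rwa [zero_add] at this)
      (tot_t_mul (hN'.tot i (m + 1)))
    rw [couplingHom_eq ha hP hV hq i hm hN', toCone_eq hP (g := g)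
      (by rw [hg, sub_self]; exact zero_mem _) (tot_t_mul (hN'.tot _ _))]
    exact ⟨g, hgn, rfl⟩

end Scroll

end

/-! ### Independence of the coupling classes -/

noncomputable section

namespace Cotangent

variable {K S : Type*} [Field K] [CommRing S] [Algebra K S] {𝒮 : ℤ → Submodule K S} {I : Ideal S}

lemma linearCombination_basis (p : Gen 𝒮 I) :
    Finsupp.linearCombination S (fun p : Gen 𝒮 I => p.elt) (Free.basis p) = p.elt := by
  simp [Free.basis]

end Cotangent

namespace Scroll

open Cotangent

variable {K : Type*} [Field K] {k l : ℕ} {d : Fin k → ℕ} {P : Fin l → Cox K k} {a : ℕ}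
  {b : Fin l → ℕ}

lemma exists_eq_C_of_mem_grading {f : Amb K d} (hf : f ∈ grading K d 0) : ∃ c : K, f = C c := by
  refine ⟨coeff 0 f, ?_⟩
  ext v
  rw [coeff_C]
  split_ifs with h
  · rw [h]
  · by_contra hne
    have h1 := hf hne
    rw [Finsupp.weight_apply, Finsupp.sum, Finset.sum_eq_zero_iff_of_nonneg
      (fun _ _ => by positivity)] at h1
    refine h (Finsupp.ext fun x => ?_)
    by_contra hx
    have := h1 x (Finsupp.mem_support_iff.mpr (Ne.symm hx))
    simp at this
    exact hx this.symm

lemma eq_zero_of_pullback_eq_zero {n : ℤ} (hn : n < 2) {f : Amb K d} (hf : f ∈ grading K d n)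
    (h : pullback K d f = 0) : f = 0 := by
  obtain ⟨c, hc, rfl⟩ := exists_eq_sum_minor hf h
  exact Finset.sum_eq_zero fun α _ => Finset.sum_eq_zero fun β _ => by
    rw [eq_zero_of_mem_grading (by omega) (hc α β), zero_mul]

lemma pullback_eq_zero_of_mk_eq_zero (hP : ∀ i, IsDivisorEquation d a (b i) (P i)) {n : ℤ}
    (hn : n < a) {f : Amb K d} (hf : f ∈ grading K d n)
    (h : Ideal.Quotient.mk (coneIdeal d b P) f = 0) : pullback K d f = 0 :=
  (fib_pullback hf).eq_zero_of_mem (fun i => (hP i).fib) hn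
    ((mem_coneIdeal_iff fun i => (hP i).tot).mp (Ideal.Quotient.eq_zero_iff_mem.mp h))

lemma minor_ne_zero {α β : Col d} (h : α ≠ β) : minor K d α β ≠ 0 := by
  rw [minor_eq, sub_ne_zero]
  intro h1
  have h2 : (X α.top : Amb K d) ∣ X α.bot * X β.top := ⟨_, h1.symm⟩
  rcases (X_prime.dvd_mul).mp h2 with h3 | h3
  · exact top_ne_bot_self α (by simpa [X_dvd_X] using h3)
  · exact h (top_injective (by simpa [X_dvd_X] using h3))

lemma minor_self (α : Col d) : minor K d α α = 0 := by rw [minor_eq]; ring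

lemma minor_antisymm (α β : Col d) : minor K d α β = - minor K d β α := by
  rw [minor_eq, minor_eq]; ring

/-- A monomial of the nonzero P_i has total degree -b_i < 0, which is impossible when all d_i
vanish. -/
lemma exists_col (hb : ∀ i, 0 < b i) (ha : 0 < a) (hP : ∀ i, IsDivisorEquation d a (b i) (P i))
    (hV : IsCompleteIntersection P) (i : Fin l) : Nonempty (Col d) := by
  obtain ⟨u, hu⟩ := ne_zero_iff.mp (ne_zero ha hP hV i)
  have h1 := (hP i).tot hu
  rw [weight_tot_eq] at h1
  by_contra! h
  have hd : ∀ i, d i = 0 := fun i => by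
    by_contra hi
    exact h.false ⟨i, 0, by omega⟩
  simp only [hd, Nat.cast_zero, zero_mul, Finset.sum_const_zero] at h1
  have := hb i
  omega

lemma kernel_mem_coneIdeal {g : Amb K d} (h : pullback K d g = 0) : g ∈ coneIdeal d b P :=
  Ideal.span_mono Set.subset_union_left (mem_minorIdeal_of_pullback_eq_zero h)

/-- An element of the ideal of the scroll as an element of the ideal of the cone. -/
def kerGen (b : Fin l → ℕ) (P : Fin l → Cox K k) {n : ℤ} {g : Amb K d} (hg : g ∈ grading K d n)
    (h : pullback K d g = 0) : Gen (grading K d) (coneIdeal d b P) :=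
  ⟨n, g, kernel_mem_coneIdeal h, hg⟩

/-- The minors as elements of the ideal of the cone. -/
def minorGen (b : Fin l → ℕ) (P : Fin l → Cox K k) (α β : Col d) :
    Gen (grading K d) (coneIdeal d b P) :=
  kerGen b P (minor_mem_grading α β) (pullback_minor α β)

/-- A choice of rolling factors equations. -/
def IsRolling (d : Fin k → ℕ) (a : ℕ) (b : Fin l → ℕ) (P : Fin l → Cox K k)
    (e : Fin l → ℕ → Gen (grading K d) (coneIdeal d b P)) : Prop :=
  ∀ i m, m ≤ b i → (e i m).deg = a ∧
    pullback K d (e i m).elt = s K k ^ (b i - m) * t K k ^ m * P i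

lemma exists_isRolling (hP : ∀ i, IsDivisorEquation d a (b i) (P i)) :
    ∃ e, IsRolling d a b P e := by
  have H : ∀ i m, ∃ p : Gen (grading K d) (coneIdeal d b P), m ≤ b i → p.deg = a ∧
      pullback K d p.elt = s K k ^ (b i - m) * t K k ^ m * P i := by
    intro i m
    by_cases hm : m ≤ b i
    · obtain ⟨g, hg, h⟩ := exists_mem_grading_pullback_eq (d := d) (n := a)
        (f := s K k ^ (b i - m) * t K k ^ m * P i)
        (by simpa using (fib_st (b i - m) m).mul (hP i).fib) (by
          have := (tot_st d (b i - m) m).mul (hP i).tot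
          rwa [show ((b i - m : ℕ) : ℤ) + m + -(b i : ℤ) = 0 by omega] at this)
      exact ⟨⟨a, g, Ideal.subset_span (Or.inr ⟨i, m, hm, h⟩), hg⟩, fun _ => ⟨rfl, h⟩⟩
    · exact ⟨⟨0, 0, zero_mem _, zero_mem _⟩, fun h => absurd h hm⟩
  choose e he using H
  exact ⟨e, he⟩

variable {e : Fin l → ℕ → Gen (grading K d) (coneIdeal d b P)}

lemma IsRolling.pullback_col (he : IsRolling d a b P e) (α : Col d) {i : Fin l} {m : ℕ}
    (hm : m < b i) :
    pullback K d (X α.bot * (e i m).elt - X α.top * (e i (m + 1)).elt) = 0 := by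
  rw [map_sub, map_mul, map_mul, (he i m hm.le).2, (he i (m + 1) hm).2, pullback_bot,
    pullback_top, show b i - m = b i - (m + 1) + 1 by omega]
  ring

lemma IsRolling.elt_mem (he : IsRolling d a b P e) {i : Fin l} {m : ℕ}
    (hm : m ≤ b i) : (e i m).elt ∈ grading K d a := by
  have := (e i m).homogeneous
  rwa [(he i m hm).1] at this

lemma IsRolling.col_mem (he : IsRolling d a b P e) (α : Col d) {i : Fin l} {m : ℕ}
    (hm : m < b i) :
    X α.bot * (e i m).elt - X α.top * (e i (m + 1)).elt ∈ grading K d (1 + a) :=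
  sub_mem (mul_mem_grading (X_mem_grading _) (he.elt_mem hm.le))
    (mul_mem_grading (X_mem_grading _) (he.elt_mem hm))

/-- The element of the ideal of the scroll that comes from two consecutive rolling factors
equations. -/
def IsRolling.colGen (he : IsRolling d a b P e) (α : Col d) {i : Fin l} {m : ℕ} (hm : m < b i) :
    Gen (grading K d) (coneIdeal d b P) :=
  kerGen b P (he.col_mem α hm) (he.pullback_col α hm)

/-- The relation between two consecutive rolling factors equations. -/
def IsRolling.colRelation (he : IsRolling d a b P e) (α : Col d) {i : Fin l} {m : ℕ}
    (hm : m < b i) : relations (grading K d) (coneIdeal d b P) :=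
  ⟨(X α.bot : Amb K d) • Free.basis (e i m) - (X α.top : Amb K d) • Free.basis (e i (m + 1)) -
    Free.basis (he.colGen α hm), by
      rw [relations, LinearMap.mem_ker]
      simp only [map_sub, map_smul, linearCombination_basis, smul_eq_mul]
      exact sub_self _⟩

variable {q : Gen (grading K d) (coneIdeal d b P) → Fin l → ℕ → Amb K d}

lemma IsFactorization.factor_kerGen (hq : IsFactorization d a b P q) {n : ℤ} {g : Amb K d}
    (hg : g ∈ grading K d n) (h : pullback K d g = 0) (i : Fin l) (m : ℕ) :
    factor q i m (Free.basis (kerGen b P hg h)) = 0 := by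
  rw [factor_basis]
  exact hq.zero (kerGen b P hg h) h i m

lemma sum_st_C_eq_zero {c : ℕ} {x : ℕ → K}
    (h : ∑ m ∈ Finset.range (c + 1), s K k ^ (c - m) * t K k ^ m * C (x m) = 0) {m : ℕ}
    (hm : m ≤ c) : x m = 0 := by
  classical
  have h1 := congrArg (coeff (Finsupp.single (Sum.inl 0 : Fin 2 ⊕ Fin k) (c - m) +
    Finsupp.single (Sum.inl 1 : Fin 2 ⊕ Fin k) m)) h
  have h0 : ∀ m', s K k ^ (c - m') * t K k ^ m' * C (x m') =
      monomial (Finsupp.single (Sum.inl 0) (c - m') + Finsupp.single (Sum.inl 1) m') (x m') :=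
    fun m' => by rw [st_eq_monomial, mul_comm, C_mul_monomial, mul_one]
  simp only [h0, coeff_sum, coeff_monomial, coeff_zero] at h1
  rw [Finset.sum_eq_single m] at h1
  · simpa using h1
  · intro m' _ hne
    rw [if_neg]
    intro h2
    have := DFunLike.congr_fun h2 (Sum.inl 1)
    simp at this
    exact hne this
  · intro hn
    simp at hn
    omega

/-- The coefficients are constants by degree, and they are unique because P_1, …, P_l have no
syzygies of fibre degree 0. -/
lemma IsFactorization.factor_rolling (ha : 0 < a) (hP : ∀ i, IsDivisorEquation d a (b i) (P i))
    (hV : IsCompleteIntersection P) (hq : IsFactorization d a b P q) (he : IsRolling d a b P e)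
    {i i' : Fin l} {m m' : ℕ} (hm : m ≤ b i) (hm' : m' ≤ b i') :
    factor q i' m' (Free.basis (e i m)) = if i' = i ∧ m' = m then 1 else 0 := by
  have h1 := hq.eq (e i m)
  have hmem : ∀ i' m', q (e i m) i' m' ∈ grading K d 0 := fun i' m' => by
    have := hq.mem (e i m) i' m'
    rwa [(he i m hm).1, sub_self] at this
  choose c hc using fun i' m' => exists_eq_C_of_mem_grading (hmem i' m')
  have hsum : ∀ i', ∑ m' ∈ Finset.range (b i' + 1), s K k ^ (b i' - m') * t K k ^ m' *
      C (if i' = i ∧ m' = m then (1 : K) else 0) =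
      if i' = i then s K k ^ (b i - m) * t K k ^ m else 0 := by
    intro i'
    split_ifs with h
    · subst h
      rw [Finset.sum_eq_single m]
      · simp
      · intro m' _ hne; simp [hne]
      · intro hn; simp at hn; omega
    · simp [h]
  have h2 : ∑ i', P i' * ∑ m' ∈ Finset.range (b i' + 1), s K k ^ (b i' - m') * t K k ^ m' *
      C (c i' m' - if i' = i ∧ m' = m then (1 : K) else 0) = 0 := by
    simp only [map_sub, mul_sub, Finset.sum_sub_distrib, hsum]
    rw [sub_eq_zero]
    rw [(he i m hm).2] at h1
    simp only [hc, algHom_C, algebraMap_eq] at h1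
    rw [← h1]
    simp [mul_comm]
  have h3 := sum_st_C_eq_zero (eq_zero_of_sum_eq_zero ha hP hV (e := 0) (n := 0) (by omega)
    (by omega) (fun i => tot_sum_st fun m => isWeightedHomogeneous_C _ _)
    (fun i => fib_sum_st fun m => isWeightedHomogeneous_C _ _) h2 i') hm'
  rw [factor_basis, hc, sub_eq_zero.mp h3]
  split_ifs <;> simp

/-- The rolling coefficients of this relation pull back to t and -s times the column form, at m and
m + 1. The coupling is thus concentrated in the single place m + 1. -/
lemma IsFactorization.isCoupling_colRelation (ha : 0 < a)
    (hP : ∀ i, IsDivisorEquation d a (b i) (P i)) (hV : IsCompleteIntersection P)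
    (hq : IsFactorization d a b P q) (he : IsRolling d a b P e) (α : Col d) {i : Fin l} {m : ℕ}
    (hm : m < b i) :
    IsCoupling q (he.colRelation α hm : Free (grading K d) (coneIdeal d b P))
      (fun i' m' => if i' = i ∧ m' = m + 1 then colForm K d α else 0) where
  tot i' m' := by
    split_ifs
    · exact tot_colForm α
    · exact isWeightedHomogeneous_zero ..
  first i' := by simp
  last i' := by
    rw [if_neg]
    rintro ⟨rfl, h⟩
    omega
  sub_mem i' m' hm' := by
    convert zero_mem (idealOf P) using 1
    rw [sub_eq_zero, IsRolling.colRelation, map_sub, map_sub, map_sub, map_sub, (factor q i' m').map_smul,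
      (factor q i' m').map_smul, IsRolling.colGen, hq.factor_kerGen, hq.factor_rolling ha hP hV he hm.le hm',
      hq.factor_rolling ha hP hV he hm hm']
    by_cases hi : i' = i
    · by_cases h1 : m' = m
      · simp [hi, h1, pullback_bot]
      · by_cases h2 : m' = m + 1
        · simp [hi, h2, pullback_top]
        · simp [hi, h1, h2]
    · simp [hi]

lemma couplingHom_colRelation (ha : 0 < a) (hP : ∀ i, IsDivisorEquation d a (b i) (P i))
    (hV : IsCompleteIntersection P) (hq : IsFactorization d a b P q) (he : IsRolling d a b P e)
    (α : Col d) {i i' : Fin l} {m m' : ℕ} (hm : m < b i) (hm' : m' ≤ b i') :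
    couplingHom ha hP hV hq i' hm' (he.colRelation α hm) =
      if i' = i ∧ m' = m then Ideal.Quotient.mk _ (X α.bot) else 0 := by
  rw [couplingHom_eq ha hP hV hq i' hm' (hq.isCoupling_colRelation ha hP hV he α hm)]
  simp only [add_left_inj]
  split_ifs
  · exact toCone_eq hP (by rw [pullback_bot, sub_self]; exact zero_mem _)
      (tot_t_mul (tot_colForm α))
  · rw [toCone_eq hP (g := 0) (by simp) (by rw [mul_zero]; exact isWeightedHomogeneous_zero ..),
      map_zero]

section Independence

variable {φ : Free (grading K d) (coneIdeal d b P) →ₗ[Amb K d] Amb K d ⧸ coneIdeal d b P}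

lemma exists_apply_basis_eq_C
    (hφ : ∀ p, φ (Free.basis p) ∈ quotPart (grading K d) (coneIdeal d b P) (p.deg + -(a : ℤ)))
    {p : Gen (grading K d) (coneIdeal d b P)} (hp : p.deg = a) :
    ∃ c : K, φ (Free.basis p) = Ideal.Quotient.mk _ (C c) := by
  obtain ⟨f, hf, h⟩ := hφ p
  rw [hp, add_neg_cancel] at hf
  obtain ⟨c, rfl⟩ := exists_eq_C_of_mem_grading hf
  exact ⟨c, h.symm⟩

lemma smul_mk (g f : Amb K d) : g • Ideal.Quotient.mk (coneIdeal d b P) f =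
    Ideal.Quotient.mk (coneIdeal d b P) (g * f) := rfl

/-- An expression of g by minors is a relation without rolling factors equations, hence one on which
φ vanishes. -/
lemma apply_kerGen
    (hz : ∀ r : relations (grading K d) (coneIdeal d b P),
      (∀ i m, m ≤ b i → factor q i m r ∈ coneIdeal d b P) → φ r = 0)
    (hq : IsFactorization d a b P q) {n : ℤ} {g : Amb K d} (hg : g ∈ grading K d n)
    (h : pullback K d g = 0) (c : Col d → Col d → Amb K d)
    (hc : g = ∑ α, ∑ β, c α β * minor K d α β) :
    φ (Free.basis (kerGen b P hg h)) = ∑ α, ∑ β, c α β • φ (Free.basis (minorGen b P α β)) := by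
  have h1 := hz ⟨Free.basis (kerGen b P hg h) - ∑ α, ∑ β, c α β • Free.basis (minorGen b P α β), by
    rw [relations, LinearMap.mem_ker]
    simp only [map_sub, map_sum, map_smul, linearCombination_basis, smul_eq_mul]
    exact sub_eq_zero.mpr hc⟩ (fun i m _ => by
      simp only [map_sub, map_sum, map_smul, hq.factor_kerGen, minorGen, smul_zero,
        Finset.sum_const_zero, sub_self]
      exact zero_mem _)
  simp only [map_sub, map_sum, map_smul] at h1
  exact sub_eq_zero.mp h1

/-- The value has degree 2 - a. For a > 2 it vanishes for that reason; for a = 2 it is a constant,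
to be excluded by a linear relation with a third column, or by direct elimination when there are
only two columns. -/
lemma apply_minorGen_eq_zero (hb : ∀ i, 0 < b i) (ha : 2 ≤ a)
    (hP : ∀ i, IsDivisorEquation d a (b i) (P i)) (hV : IsCompleteIntersection P)
    (hφ : ∀ p, φ (Free.basis p) ∈ quotPart (grading K d) (coneIdeal d b P) (p.deg + -(a : ℤ)))
    (hz : ∀ r : relations (grading K d) (coneIdeal d b P),
      (∀ i m, m ≤ b i → factor q i m r ∈ coneIdeal d b P) → φ r = 0)
    (hq : IsFactorization d a b P q) (he : IsRolling d a b P e) {i : Fin l} {x : K}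
    (hx : ∀ α, φ (he.colRelation α (hb i)) = Ideal.Quotient.mk _ (C x * X α.bot)) (α β : Col d) :
    φ (Free.basis (minorGen b P α β)) = 0 := by
  rcases ha.lt_or_eq with ha | rfl
  · obtain ⟨f, hf, h⟩ := hφ (minorGen b P α β)
    rw [eq_zero_of_mem_grading (by simp only [minorGen, kerGen]; omega) hf, map_zero] at h
    exact h.symm
  have hself : ∀ α, φ (Free.basis (minorGen b P α α)) = 0 := fun α => by
    have : φ (Free.basis (minorGen b P α α)) = _ := apply_kerGen hz hq (minor_mem_grading α α)
      (pullback_minor α α) 0 (by simp [minor_self])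
    simpa using this
  have h0 : ∀ {p : Gen (grading K d) (coneIdeal d b P)} (c : K), φ (Free.basis p) =
      Ideal.Quotient.mk _ (C c) → c = 0 → φ (Free.basis p) = 0 := by
    rintro p c h rfl
    rw [h, map_zero, map_zero]
  choose c hc using fun α β => exists_apply_basis_eq_C (a := 2) hφ (p := minorGen b P α β) rfl
  by_cases hαβ : α = β
  · rw [hαβ, hself]
  refine h0 _ (hc α β) ?_
  by_cases hγ : ∃ γ, γ ≠ α ∧ γ ≠ β
  · obtain ⟨γ, hγα, hγβ⟩ := hγ
    have h1 := hz ⟨(X α.top : Amb K d) • Free.basis (minorGen b P β γ) -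
      (X β.top : Amb K d) • Free.basis (minorGen b P α γ) +
      (X γ.top : Amb K d) • Free.basis (minorGen b P α β), by
        rw [relations, LinearMap.mem_ker]
        simp only [map_sub, map_add, map_smul, linearCombination_basis, smul_eq_mul, minorGen,
          kerGen, minor_eq]
        ring⟩ (fun i m _ => by
          simp only [map_sub, map_add, map_smul, hq.factor_kerGen, minorGen, smul_zero, sub_self,
            add_zero]
          exact zero_mem _)
    simp only [map_sub, map_add, map_smul, hc, smul_mk] at h1
    rw [← map_sub, ← map_add] at h1
    have hmem : ∀ (γ : Col d) (c : K), (X γ.top * C c : Amb K d) ∈ grading K d 1 := fun γ c => by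
      simpa using mul_mem_grading (X_mem_grading γ.top)
        (show (C c : Amb K d) ∈ grading K d 0 from isWeightedHomogeneous_C _ _)
    have hmem' := add_mem (sub_mem (hmem α (c β γ)) (hmem β (c α γ))) (hmem γ (c α β))
    have h2 := eq_zero_of_pullback_eq_zero (by norm_num) hmem'
      (pullback_eq_zero_of_mk_eq_zero hP (by norm_num) hmem' h1)
    have h3 := congrArg (coeff (Finsupp.single γ.top 1)) h2
    have e1 : α.top ≠ γ.top := top_injective.ne hγα.symm
    have e2 : β.top ≠ γ.top := top_injective.ne hγβ.symm
    simpa [mul_comm _ (C _), coeff_C_mul, coeff_X, Finsupp.single_left_inj, e1, e2] using h3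
  · push Not at hγ
    -- With two columns there is no linear relation among minors, but the ideal of the scroll is
    -- principal, so `colGen` is a multiple of the single minor.
    have hle : minorIdeal K d ≤ Ideal.span {minor K d α β} := by
      rw [minorIdeal, Ideal.span_le]
      rintro _ ⟨γ, δ, rfl⟩
      rw [SetLike.mem_coe]
      have hsp := Ideal.mem_span_singleton_self (minor K d α β)
      by_cases h1 : γ = α <;> by_cases h2 : δ = α
      · rw [h1, h2, minor_self]; exact zero_mem _
      · rwa [h1, hγ δ h2]
      · rw [h2, hγ γ h1, minor_antisymm β α]; exact neg_mem hsp
      · rw [hγ γ h1, hγ δ h2, minor_self]; exact zero_mem _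
    have hfac : ∀ γ : Col d, ∃ G ∈ grading K d 1,
        X γ.bot * (e i 0).elt - X γ.top * (e i 1).elt = minor K d α β * G := by
      intro γ
      obtain ⟨G, hG⟩ := Ideal.mem_span_singleton.mp
        (hle (mem_minorIdeal_of_pullback_eq_zero (he.pullback_col γ (hb i))))
      refine ⟨G, ?_, hG⟩
      refine IsWeightedHomogeneous.of_mul_left (minor_mem_grading α β) (minor_ne_zero hαβ) ?_
      rw [← hG]
      have := he.col_mem γ (hb i)
      rwa [show (1 : ℤ) + (2 : ℕ) = 2 + 1 by norm_num] at this
    choose G hG hGf using hfac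
    obtain ⟨c0, hc0⟩ := exists_apply_basis_eq_C hφ (he i 0 (by omega)).1
    obtain ⟨c1, hc1⟩ := exists_apply_basis_eq_C hφ (he i 1 (hb i)).1
    have hGe : ∀ γ : Col d, φ (Free.basis (he.colGen γ (hb i))) =
        Ideal.Quotient.mk _ (G γ * C (c α β)) := by
      intro γ
      have h1 := hz ⟨Free.basis (he.colGen γ (hb i)) - G γ • Free.basis (minorGen b P α β), by
        rw [relations, LinearMap.mem_ker]
        simp only [map_sub, map_smul, linearCombination_basis, smul_eq_mul]
        exact sub_eq_zero.mpr ((hGf γ).trans (mul_comm _ _))⟩ (fun i m _ => by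
          simp only [map_sub, map_smul, minorGen, IsRolling.colGen, hq.factor_kerGen, smul_zero,
            sub_self]
          exact zero_mem _)
      simp only [map_sub, map_smul, hc, smul_mk] at h1
      exact sub_eq_zero.mp h1
    have heq : ∀ γ : Col d, C x * X γ.bot = X γ.bot * C c0 - X γ.top * C c1 - G γ * C (c α β) := by
      intro γ
      have h1 := hx γ
      simp only [IsRolling.colRelation, map_sub, map_smul, hGe, hc0, hc1, zero_add, smul_mk] at h1
      rw [← map_sub, ← map_sub, ← sub_eq_zero, ← map_sub] at h1
      have hC : ∀ c : K, (C c : Amb K d) ∈ grading K d 0 := fun c => isWeightedHomogeneous_C _ _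
      have hmem : X γ.bot * C c0 - X γ.top * C c1 - G γ * C (c α β) - C x * X γ.bot ∈
          grading K d 1 := by
        refine sub_mem (sub_mem (sub_mem ?_ ?_) ?_) ?_
        · simpa using mul_mem_grading (X_mem_grading γ.bot) (hC c0)
        · simpa using mul_mem_grading (X_mem_grading γ.top) (hC c1)
        · simpa using mul_mem_grading (hG γ) (hC (c α β))
        · simpa using mul_mem_grading (hC x) (X_mem_grading γ.bot)
      exact (sub_eq_zero.mp (eq_zero_of_pullback_eq_zero (by norm_num) hmem
        (pullback_eq_zero_of_mk_eq_zero hP (by norm_num) hmem h1))).symm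
    -- Elimination of the first rolling factors equation between the two columns expresses the
    -- second one through G α and G β. Combined with `heq`, c(α, β) times this equation becomes a
    -- multiple of the minor, which pulls back to zero, so the constant vanishes.
    have h1 : minor K d α β * (X β.bot * G α - X α.bot * G β) =
        minor K d α β * (- (e i 1).elt) := by
      linear_combination (X α.bot : Amb K d) * hGf β - (X β.bot : Amb K d) * hGf α +
        (e i 1).elt * minor_eq (K := K) α β
    have h2 := mul_left_cancel₀ (minor_ne_zero hαβ) h1
    have h3 : C (c α β) * (e i 1).elt = C c1 * minor K d α β := by
      linear_combination C (c α β) * h2 - (X β.bot) * heq α + (X α.bot) * heq β +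
        (- C c1) * minor_eq (K := K) α β
    have h4 := congrArg (pullback K d) h3
    rw [map_mul, map_mul, pullback_minor, mul_zero, (he i 1 (hb i)).2, algHom_C, algebraMap_eq,
      mul_eq_zero, C_eq_zero] at h4
    exact h4.resolve_right (mul_ne_zero (mul_ne_zero (pow_ne_zero _ s_ne_zero)
      (pow_ne_zero _ t_ne_zero)) (ne_zero (by norm_num) hP hV i))

/-- The homomorphisms defined by couplings are linearly independent modulo the induced ones. -/
lemma eq_zero_of_sum_couplingHom_mem (hb : ∀ i, 0 < b i) (ha : 2 ≤ a)
    (hP : ∀ i, IsDivisorEquation d a (b i) (P i)) (hV : IsCompleteIntersection P)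
    (hq : IsFactorization d a b P q) (x : (Σ i : Fin l, Fin (b i - 1)) → K)
    (h : ∑ j, x j • couplingHom (by omega) hP hV hq j.1
      (show (j.2 : ℕ) + 1 ≤ b j.1 by omega) ∈
        inducedPart (grading K d) (coneIdeal d b P) (-(a : ℤ))) : x = 0 := by
  obtain ⟨φ, hφ, hψ⟩ := h
  obtain ⟨e, he⟩ := exists_isRolling hP
  have hz : ∀ r : relations (grading K d) (coneIdeal d b P),
      (∀ i m, m ≤ b i → factor q i m r ∈ coneIdeal d b P) → φ r = 0 := by
    intro r hr
    rw [← hψ, LinearMap.sum_apply]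
    refine Finset.sum_eq_zero fun j _ => ?_
    rw [LinearMap.smul_apply, couplingHom_eq_zero _ hP hV hq _ _ hr, smul_zero]
  -- The index j of x stands for the homomorphism with m = j + 1. The extension is by zero, in
  -- particular at m = 0, where the homomorphism is induced and not listed.
  let x' : Fin l → ℕ → K := fun i m => if hm : m ≠ 0 ∧ m < b i then x ⟨i, m - 1, by omega⟩ else 0
  have hx' : ∀ i m (hm : m < b i) (α : Col d), φ (he.colRelation α hm) =
      Ideal.Quotient.mk _ (C (x' i m) * X α.bot) := by
    intro i m hm α
    rw [← hψ, LinearMap.sum_apply]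
    simp only [LinearMap.smul_apply, couplingHom_colRelation _ hP hV hq he α hm]
    have hsm : ∀ y : K, y • (Ideal.Quotient.mk (coneIdeal d b P) (X α.bot)) =
        Ideal.Quotient.mk _ (C y * X α.bot) := fun y => by
      rw [← smul_eq_C_mul]; rfl
    simp only [x']
    split_ifs with h0
    · rw [Finset.sum_eq_single ⟨i, m - 1, by omega⟩, if_pos ⟨rfl, by simp only; omega⟩, hsm]
      · rintro ⟨i', m'⟩ _ hne
        rw [if_neg, smul_zero]
        rintro ⟨rfl, h1⟩
        refine hne ?_
        simp only at h1
        simp only [Sigma.mk.injEq, heq_eq_eq, true_and]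
        ext
        simp only; omega
      · intro hn
        exact absurd (Finset.mem_univ _) hn
    · rw [map_zero, zero_mul, map_zero]
      refine Finset.sum_eq_zero fun j _ => ?_
      rw [if_neg, smul_zero]
      rintro ⟨rfl, h1⟩
      omega
  -- Comparison of the two entries of a column in the value on `colRelation`. The relation at m
  -- gives c_m = x'_m and c_{m+1} = 0, so the relations at m - 1 and m together give x'_m = 0 for 1
  -- ≤ m < b_i.
  have key : ∀ i, ∀ m < b i, ∀ c0 c1 : K, φ (Free.basis (e i m)) = Ideal.Quotient.mk _ (C c0) →
      φ (Free.basis (e i (m + 1))) = Ideal.Quotient.mk _ (C c1) → c0 = x' i m ∧ c1 = 0 := by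
    intro i m hm c0 c1 h0 h1
    obtain ⟨α⟩ := exists_col hb (by omega) hP hV i
    obtain ⟨c, -, hc⟩ := exists_eq_sum_minor (he.col_mem α hm) (he.pullback_col α hm)
    have h2 : φ (Free.basis (he.colGen α hm)) = 0 := by
      rw [IsRolling.colGen, apply_kerGen hz hq _ _ c hc]
      simp only [apply_minorGen_eq_zero hb ha hP hV hφ hz hq he (hx' i 0 (hb i)), smul_zero,
        Finset.sum_const_zero]
    have h3 := hx' i m hm α
    simp only [IsRolling.colRelation, map_sub, map_smul, h0, h1, h2, sub_zero, smul_mk] at h3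
    rw [← map_sub, ← sub_eq_zero, ← map_sub] at h3
    have hC : ∀ c : K, (C c : Amb K d) ∈ grading K d 0 := fun c => isWeightedHomogeneous_C _ _
    have hmem : X α.bot * C c0 - X α.top * C c1 - C (x' i m) * X α.bot ∈ grading K d 1 := by
      refine sub_mem (sub_mem ?_ ?_) ?_
      · simpa using mul_mem_grading (X_mem_grading α.bot) (hC c0)
      · simpa using mul_mem_grading (X_mem_grading α.top) (hC c1)
      · simpa using mul_mem_grading (hC (x' i m)) (X_mem_grading α.bot)
    have h4 := eq_zero_of_pullback_eq_zero (by norm_num) hmem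
      (pullback_eq_zero_of_mk_eq_zero hP (by omega) hmem h3)
    have h5 := congrArg (coeff (Finsupp.single α.top 1)) h4
    have h6 := congrArg (coeff (Finsupp.single α.bot 1)) h4
    have e1 := top_ne_bot_self α
    simp only [mul_comm _ (C _), coeff_sub, coeff_C_mul, coeff_X, Finsupp.single_left_inj,
      one_ne_zero, ne_eq, not_false_eq_true, e1, e1.symm, if_true, if_false, coeff_zero] at h5 h6
    constructor
    · linear_combination h6
    · linear_combination -h5
  funext ⟨i, m⟩
  obtain ⟨c0, hc0⟩ := exists_apply_basis_eq_C hφ (he i m (by omega)).1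
  obtain ⟨c1, hc1⟩ := exists_apply_basis_eq_C hφ (he i (m + 1) (by omega)).1
  obtain ⟨c2, hc2⟩ := exists_apply_basis_eq_C hφ (he i (m + 2) (by omega)).1
  have h1 := (key i m (by omega) c0 c1 hc0 hc1).2
  have h2 := (key i (m + 1) (by omega) c1 c2 hc1 hc2).1
  rw [h1] at h2
  simp only [x'] at h2
  rw [dif_pos ⟨by omega, by omega⟩] at h2
  exact h2.symm

end Independence

end Scroll

end

/-! ### For a > 2: vanishing on relations among the minors and on Koszul relations -/

noncomputable section

namespace Cotangent

variable {K S : Type*} [Field K] [CommRing S] [Algebra K S] {𝒮 : ℤ → Submodule K S} {I : Ideal S}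

namespace Free.IsHomogeneousOfDegree

variable {r r' : Free 𝒮 I} {n : ℤ}

lemma add (h : r.IsHomogeneousOfDegree n) (h' : r'.IsHomogeneousOfDegree n) :
    (r + r').IsHomogeneousOfDegree n := fun p => add_mem (h p) (h' p)

lemma sub (h : r.IsHomogeneousOfDegree n) (h' : r'.IsHomogeneousOfDegree n) :
    (r - r').IsHomogeneousOfDegree n := fun p => sub_mem (h p) (h' p)

lemma sum {ι : Type*} {T : Finset ι} {f : ι → Free 𝒮 I}
    (h : ∀ i ∈ T, (f i).IsHomogeneousOfDegree n) :
    (∑ i ∈ T, f i).IsHomogeneousOfDegree n := fun p => by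
  rw [Finsupp.finsetSum_apply]
  exact sum_mem fun i hi => h i hi p

lemma smul_basis {c : S} {p : Gen 𝒮 I} (h : c ∈ 𝒮 (n - p.deg)) :
    (c • Free.basis p).IsHomogeneousOfDegree n := fun p' => by
  classical
  rw [Free.basis, Finsupp.smul_single, smul_eq_mul, mul_one, Finsupp.single_apply]
  split_ifs with hp
  · rwa [← hp]
  · exact zero_mem _

end Free.IsHomogeneousOfDegree

/-- The relations on which a homomorphism vanishes. -/
def killed (ψ : relations 𝒮 I →ₗ[S] S ⧸ I) : Submodule S (Free 𝒮 I) :=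
  (LinearMap.ker ψ).map (relations 𝒮 I).subtype

variable {ψ : relations 𝒮 I →ₗ[S] S ⧸ I}

lemma mem_killed_iff {r : Free 𝒮 I} (hr : r ∈ relations 𝒮 I) :
    r ∈ killed ψ ↔ ψ ⟨r, hr⟩ = 0 := by
  constructor
  · rintro ⟨r', h, rfl⟩
    exact h
  · exact fun h => ⟨⟨r, hr⟩, h, rfl⟩

lemma mem_relations_iff {r : Free 𝒮 I} :
    r ∈ relations 𝒮 I ↔ Finsupp.linearCombination S (fun p : Gen 𝒮 I => p.elt) r = 0 := Iff.rfl

lemma koszul_mem_killed (hψ : ∀ r, IsKoszul 𝒮 I r → ψ r = 0) (p p' : Gen 𝒮 I) :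
    p.elt • Free.basis p' - p'.elt • Free.basis p ∈ killed ψ := by
  have hr : p.elt • Free.basis p' - p'.elt • Free.basis p ∈ relations 𝒮 I := by
    rw [mem_relations_iff]
    simp only [map_sub, map_smul, linearCombination_basis, smul_eq_mul]
    ring
  rw [mem_killed_iff hr]
  exact hψ _ ⟨p, p', rfl⟩

/-- In the quotient of F by the relations that ψ kills, Koszul relations become a rule for
exchanging factors. Vanishing of ψ on a relation is then checked by computation in this quotient. -/
lemma smul_mkQ_basis_comm (hψ : ∀ r, IsKoszul 𝒮 I r → ψ r = 0) (p p' : Gen 𝒮 I) :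
    p.elt • (killed ψ).mkQ (Free.basis p') = p'.elt • (killed ψ).mkQ (Free.basis p) := by
  rw [← sub_eq_zero, ← map_smul, ← map_smul, ← map_sub]
  exact (Submodule.Quotient.mk_eq_zero _).mpr (koszul_mem_killed hψ p p')

end Cotangent

namespace Scroll

open Cotangent

variable {K : Type*} [Field K] {k l : ℕ} {d : Fin k → ℕ} {P : Fin l → Cox K k} {a : ℕ}
  {b : Fin l → ℕ} {ψ : relations (grading K d) (coneIdeal d b P) →ₗ[Amb K d]
    Amb K d ⧸ coneIdeal d b P}

lemma apply_eq_zero_of_degree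
    (hψ : ψ ∈ relHomPart (grading K d) (coneIdeal d b P) (-(a : ℤ))) {n : ℤ} (hn : n < a)
    {r : relations (grading K d) (coneIdeal d b P)}
    (hr : (r : Free (grading K d) (coneIdeal d b P)).IsHomogeneousOfDegree n) : ψ r = 0 := by
  obtain ⟨f, hf, h⟩ := hψ.2 n r hr
  rw [← h, eq_zero_of_mem_grading (by omega) hf, map_zero]

lemma homogeneous_smul_minorGen {c : Amb K d} {n : ℤ} (hc : c ∈ grading K d (n - 2)) (α β : Col d) :
    (c • Free.basis (minorGen b P α β)).IsHomogeneousOfDegree n :=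
  Free.IsHomogeneousOfDegree.smul_basis hc

lemma linear_relation_mem (v : Col d → Var d) (hv : v = Col.top ∨ v = Col.bot) (α β γ : Col d) :
    (X (v α) : Amb K d) • Free.basis (minorGen b P β γ) -
      (X (v β) : Amb K d) • Free.basis (minorGen b P α γ) +
      (X (v γ) : Amb K d) • Free.basis (minorGen b P α β) ∈
        relations (grading K d) (coneIdeal d b P) := by
  rw [mem_relations_iff]
  simp only [map_sub, map_add, map_smul, linearCombination_basis, smul_eq_mul, minorGen,
    kerGen, minor_eq]
  rcases hv with rfl | rfl <;> ring

lemma apply_linear_relation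
    (hψ : ψ ∈ relHomPart (grading K d) (coneIdeal d b P) (-(a : ℤ))) (v : Col d → Var d)
    (hv : v = Col.top ∨ v = Col.bot) (α β γ : Col d) :
    ∃ f ∈ grading K d (3 - a), ψ ⟨_, linear_relation_mem v hv α β γ⟩ =
      Ideal.Quotient.mk (coneIdeal d b P) f := by
  have h1 : ∀ x : Var d, (X x : Amb K d) ∈ grading K d (3 - 2) := X_mem_grading
  obtain ⟨f, hf, h⟩ := hψ.2 3 ⟨_, linear_relation_mem v hv α β γ⟩
    (((homogeneous_smul_minorGen (h1 _) _ _).sub (homogeneous_smul_minorGen (h1 _) _ _)).add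
      (homogeneous_smul_minorGen (h1 _) _ _))
  exact ⟨f, hf, h.symm⟩

/-- The values have degree 3 - a, so they vanish for a > 3 and are constants for a = 3. The lower
entry of α times the upper relation minus the upper entry times the lower relation is a Koszul
relation between minors, and a linear identity between the two entries forces both constants to be
zero. -/
lemma apply_linear_relation_eq_zero (ha : 2 < a) (hP : ∀ i, IsDivisorEquation d a (b i) (P i))
    (hψ : ψ ∈ relHomPart (grading K d) (coneIdeal d b P) (-(a : ℤ))) (α β γ : Col d) :
    ψ ⟨_, linear_relation_mem Col.top (Or.inl rfl) α β γ⟩ = 0 ∧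
      ψ ⟨_, linear_relation_mem Col.bot (Or.inr rfl) α β γ⟩ = 0 := by
  obtain ⟨f, hf, h⟩ := apply_linear_relation hψ Col.top (Or.inl rfl) α β γ
  obtain ⟨g, hg, h'⟩ := apply_linear_relation hψ Col.bot (Or.inr rfl) α β γ
  rw [h, h']
  have hfg : X α.bot * f - X α.top * g = 0 := by
    have h1 : (X α.bot : Amb K d) • ψ ⟨_, linear_relation_mem Col.top (Or.inl rfl) α β γ⟩ -
        (X α.top : Amb K d) • ψ ⟨_, linear_relation_mem Col.bot (Or.inr rfl) α β γ⟩ = 0 := by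
      rw [← map_smul, ← map_smul, ← map_sub]
      refine hψ.1 _ ⟨minorGen b P α β, minorGen b P α γ, ?_⟩
      simp only [AddSubgroupClass.coe_sub, Submodule.coe_smul, minorGen, kerGen, minor_eq]
      module
    rw [h, h', smul_mk, smul_mk, ← map_sub] at h1
    have hmem := sub_mem (mul_mem_grading (X_mem_grading α.bot) hf)
      (mul_mem_grading (X_mem_grading α.top) hg)
    exact eq_zero_of_pullback_eq_zero (by omega) hmem
      (pullback_eq_zero_of_mk_eq_zero hP (by omega) hmem h1)
  rcases (show 3 ≤ a from ha).lt_or_eq with h3 | rfl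
  · rw [eq_zero_of_mem_grading (by omega) hf, eq_zero_of_mem_grading (by omega) hg]
    simp
  · obtain ⟨x, rfl⟩ := exists_eq_C_of_mem_grading hf
    obtain ⟨y, rfl⟩ := exists_eq_C_of_mem_grading hg
    have h5 := congrArg (coeff (Finsupp.single α.top 1)) hfg
    have h6 := congrArg (coeff (Finsupp.single α.bot 1)) hfg
    have e1 := top_ne_bot_self α
    simp only [mul_comm _ (C _), coeff_sub, coeff_C_mul, coeff_X, Finsupp.single_left_inj,
      one_ne_zero, ne_eq, not_false_eq_true, e1, e1.symm, if_true, if_false, coeff_zero, mul_one,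
      mul_zero, sub_zero, zero_sub, neg_eq_zero] at h5 h6
    simp [h5, h6]

/-- Antisymmetry and the vanishing of diagonal symbols are relations of degree 2 < a, so they are
killed by degree. -/
lemma isMinorSymbol_mkQ (ha : 2 < a) (hP : ∀ i, IsDivisorEquation d a (b i) (P i))
    (hψ : ψ ∈ relHomPart (grading K d) (coneIdeal d b P) (-(a : ℤ))) :
    IsMinorSymbol (K := K) fun α β => (killed ψ).mkQ (Free.basis (minorGen b P α β)) where
  antisymm α β := by
    rw [← sub_eq_zero, sub_neg_eq_add, ← map_add]
    refine (Submodule.Quotient.mk_eq_zero _).mpr ?_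
    have hr : Free.basis (minorGen b P α β) + Free.basis (minorGen b P β α) ∈
        relations (grading K d) (coneIdeal d b P) := by
      rw [mem_relations_iff]
      simp only [map_add, linearCombination_basis, minorGen, kerGen]
      rw [minor_antisymm, neg_add_cancel]
    rw [mem_killed_iff hr]
    refine apply_eq_zero_of_degree hψ (n := 2) (by omega) ?_
    have h1 : (1 : Amb K d) ∈ grading K d (2 - 2) := isWeightedHomogeneous_one _ _
    have := (homogeneous_smul_minorGen (b := b) (P := P) h1 α β).add
      (homogeneous_smul_minorGen h1 β α)
    rwa [one_smul, one_smul] at this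
  self α := by
    refine (Submodule.Quotient.mk_eq_zero _).mpr ?_
    have hr : Free.basis (minorGen b P α α) ∈ relations (grading K d) (coneIdeal d b P) := by
      rw [mem_relations_iff, linearCombination_basis]
      exact minor_self α
    rw [mem_killed_iff hr]
    refine apply_eq_zero_of_degree hψ (n := 2) (by omega) ?_
    have h1 : (1 : Amb K d) ∈ grading K d (2 - 2) := isWeightedHomogeneous_one _ _
    have := homogeneous_smul_minorGen (b := b) (P := P) h1 α α
    rwa [one_smul] at this
  top α β γ := by
    simp only [← map_smul, ← map_sub, ← map_add]
    exact (Submodule.Quotient.mk_eq_zero _).mpr ((mem_killed_iff _).mpr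
      (apply_linear_relation_eq_zero ha hP hψ α β γ).1)
  bot α β γ := by
    simp only [← map_smul, ← map_sub, ← map_add]
    exact (Submodule.Quotient.mk_eq_zero _).mpr ((mem_killed_iff _).mpr
      (apply_linear_relation_eq_zero ha hP hψ α β γ).2)
  koszul α β γ δ := smul_mkQ_basis_comm hψ.1 (minorGen b P α β) (minorGen b P γ δ)

/-- The index set of the rolling factors equations. -/
abbrev Eqn (b : Fin l → ℕ) : Type := Σ i : Fin l, Fin (b i + 1)

lemma sum_eqn {M : Type*} [AddCommMonoid M] (F : Fin l → ℕ → M) :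
    ∑ x : Eqn b, F x.1 x.2 = ∑ i, ∑ m ∈ Finset.range (b i + 1), F i m := by
  rw [Fintype.sum_sigma]
  exact Finset.sum_congr rfl fun i _ => by rw [Finset.sum_range]

lemma sum_sub_smul_eq_zero {R M ι : Type*} [CommRing R] [AddCommGroup M] [Module R M] [Fintype ι]
    (B : ι → ι → R) (p : ι → R) (v : ι → M) (h : ∀ x y, p x • v y = p y • v x) :
    ∑ x, (∑ y, (B x y - B y x) * p y) • v x = 0 := by
  simp only [Finset.sum_smul, sub_mul, sub_smul, Finset.sum_sub_distrib]
  rw [sub_eq_zero, Finset.sum_comm]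
  refine Finset.sum_congr rfl fun x _ => Finset.sum_congr rfl fun y _ => ?_
  rw [mul_smul, mul_smul, h]

variable {e : Fin l → ℕ → Gen (grading K d) (coneIdeal d b P)}

variable (e) in
/-- A combination of rolling factors equations and minors in the free module. -/
def assemble (g : Eqn b → Amb K d) (c : Col d → Col d → Amb K d) :
    Free (grading K d) (coneIdeal d b P) :=
  ∑ x, g x • Free.basis (e x.1 x.2) + ∑ α, ∑ β, c α β • Free.basis (minorGen b P α β)

lemma linearCombination_assemble (g : Eqn b → Amb K d) (c : Col d → Col d → Amb K d) :
    Finsupp.linearCombination (Amb K d) (fun p : Gen (grading K d) (coneIdeal d b P) => p.elt)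
      (assemble e g c) = ∑ x, g x * (e x.1 x.2).elt + ∑ α, ∑ β, c α β * minor K d α β := by
  simp only [assemble, map_add, map_sum, map_smul, linearCombination_basis, smul_eq_mul]
  rfl

/-- Relations among rolling factors equations and minors that come from Koszul relations modulo
the ideal of the scroll are mapped to zero. -/
lemma apply_assemble_eq_zero (ha : 2 < a) (hP : ∀ i, IsDivisorEquation d a (b i) (P i))
    (hψ : ψ ∈ relHomPart (grading K d) (coneIdeal d b P) (-(a : ℤ))) {g : Eqn b → Amb K d}
    {c : Col d → Col d → Amb K d}
    (hr : assemble e g c ∈ relations (grading K d) (coneIdeal d b P))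
    (B : Eqn b → Eqn b → Amb K d) (h : ∀ x, pullback K d (g x) =
      pullback K d (∑ y, (B x y - B y x) * (e y.1 y.2).elt)) : ψ ⟨_, hr⟩ = 0 := by
  rw [← mem_killed_iff hr, ← Submodule.ker_mkQ (killed ψ), LinearMap.mem_ker]
  set π := (killed ψ).mkQ
  -- The same alternating identity is used for the classes of basis vectors here and for the
  -- equations themselves in `hS`.
  have hK := sum_sub_smul_eq_zero B (fun x => (e x.1 x.2).elt)
    (fun x => π (Free.basis (e x.1 x.2))) (fun x y => smul_mkQ_basis_comm hψ.1 _ _)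
  have hS := sum_sub_smul_eq_zero B (fun x => (e x.1 x.2).elt)
    (fun x => (e x.1 x.2).elt) (fun x y => mul_comm _ _)
  have hker : ∀ x, ∃ c' : Col d → Col d → Amb K d,
      g x - ∑ y, (B x y - B y x) * (e y.1 y.2).elt = ∑ α, ∑ β, c' α β * minor K d α β := by
    intro x
    have h1 := mem_minorIdeal_of_pullback_eq_zero (K := K) (d := d)
      (f := g x - ∑ y, (B x y - B y x) * (e y.1 y.2).elt) (by rw [map_sub, h, sub_self])
    have hset : {f | ∃ α β, f = minor K d α β} =
        Set.range fun p : Col d × Col d => minor K d p.1 p.2 := by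
      ext f; simp [eq_comm]
    rw [minorIdeal, hset] at h1
    obtain ⟨c, hc⟩ := (Ideal.mem_span_range_iff_exists_fun).mp h1
    exact ⟨fun α β => c (α, β), by rw [← hc, Fintype.sum_prod_type]⟩
  choose c' hc' using hker
  -- Once its Koszul part is removed, each rolling coefficient is a combination of minors.
  -- Exchanging minor and rolling factors equation leaves a relation among the minors alone.
  have hsum := (isMinorSymbol_mkQ ha hP hψ).sum_smul_eq_zero
    (fun α β => ∑ x, c' x α β * (e x.1 x.2).elt + c α β) (by
      have h1 := linearCombination_assemble (e := e) g c
      rw [mem_relations_iff.mp hr] at h1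
      have h2 : ∑ x, (g x - ∑ y, (B x y - B y x) * (e y.1 y.2).elt) * (e x.1 x.2).elt +
          ∑ α, ∑ β, c α β * minor K d α β = 0 := by
        rw [h1, ← sub_zero (∑ x, g x * _), ← hS, ← Finset.sum_sub_distrib]
        simp only [sub_mul _ _ (e _ _).elt, smul_eq_mul]
      rw [← h2]
      simp only [hc', add_mul, Finset.sum_add_distrib, Finset.sum_mul]
      congr 1
      rw [Finset.sum_comm_cycle]
      refine Finset.sum_congr rfl fun α _ => Finset.sum_congr rfl fun β _ =>
        Finset.sum_congr rfl fun x _ => by ring)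
  have h3 : ∀ x, (g x - ∑ y, (B x y - B y x) * (e y.1 y.2).elt) • π (Free.basis (e x.1 x.2)) =
      ∑ α, ∑ β, (c' x α β * (e x.1 x.2).elt) • π (Free.basis (minorGen b P α β)) := by
    intro x
    rw [hc', Finset.sum_smul]
    refine Finset.sum_congr rfl fun α _ => ?_
    rw [Finset.sum_smul]
    refine Finset.sum_congr rfl fun β _ => ?_
    rw [mul_smul, mul_smul]
    exact congrArg _ (smul_mkQ_basis_comm hψ.1 (minorGen b P α β) (e x.1 x.2))
  rw [assemble, map_add, map_sum, map_sum]
  simp only [map_sum, map_smul]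
  rw [← hsum]
  simp only [add_smul, Finset.sum_add_distrib, Finset.sum_smul]
  congr 1
  rw [Finset.sum_comm_cycle, ← sub_zero (∑ x, g x • _), ← hK, ← Finset.sum_sub_distrib]
  refine Finset.sum_congr rfl fun x _ => ?_
  rw [← sub_smul, h3]

end Scroll

end

/-! ### Reduction to rolling coefficients and the values on consecutive relations -/

noncomputable section

namespace Scroll

open Cotangent

variable {K : Type*} [Field K] {k l : ℕ} {d : Fin k → ℕ} {P : Fin l → Cox K k} {a : ℕ}
  {b : Fin l → ℕ} {q : Gen (grading K d) (coneIdeal d b P) → Fin l → ℕ → Amb K d}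
  {e : Fin l → ℕ → Gen (grading K d) (coneIdeal d b P)}
  {c : Gen (grading K d) (coneIdeal d b P) → Col d → Col d → Amb K d}

/-- A choice of coefficients of the minors in the equations of the cone. -/
structure IsReduction (q : Gen (grading K d) (coneIdeal d b P) → Fin l → ℕ → Amb K d)
    (e : Fin l → ℕ → Gen (grading K d) (coneIdeal d b P))
    (c : Gen (grading K d) (coneIdeal d b P) → Col d → Col d → Amb K d) : Prop where
  mem : ∀ p α β, c p α β ∈ grading K d (p.deg - 2)
  eq : ∀ p, p.elt = ∑ x : Eqn b, q p x.1 x.2 * (e x.1 x.2).elt +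
    ∑ α, ∑ β, c p α β * minor K d α β

lemma exists_isReduction (hq : IsFactorization d a b P q) (he : IsRolling d a b P e) :
    ∃ c, IsReduction q e c := by
  have H : ∀ p : Gen (grading K d) (coneIdeal d b P), ∃ c : Col d → Col d → Amb K d,
      (∀ α β, c α β ∈ grading K d (p.deg - 2)) ∧
      p.elt - ∑ x : Eqn b, q p x.1 x.2 * (e x.1 x.2).elt =
        ∑ α, ∑ β, c α β * minor K d α β := by
    intro p
    refine exists_eq_sum_minor (sub_mem p.homogeneous (sum_mem fun x _ => ?_)) ?_
    · have := mul_mem_grading (hq.mem p x.1 x.2) (he.elt_mem (Nat.lt_succ_iff.mp x.2.2))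
      rwa [sub_add_cancel] at this
    · rw [map_sub, map_sum, sub_eq_zero, hq.eq p]
      rw [sum_eqn (fun i m => pullback K d (q p i m * (e i m).elt))]
      refine Finset.sum_congr rfl fun i _ => ?_
      rw [Finset.mul_sum]
      refine Finset.sum_congr rfl fun m hm => ?_
      rw [map_mul, (he i m (by simp at hm; omega)).2]
      ring
  choose c hc hc' using H
  exact ⟨c, hc, fun p => by rw [← hc' p]; ring⟩

variable (q e c) in
/-- The projection of the free module to the part that belongs to the rolling factors equations
and to the minors. -/
def reduce : Free (grading K d) (coneIdeal d b P) →ₗ[Amb K d]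
    Free (grading K d) (coneIdeal d b P) :=
  Finsupp.linearCombination (Amb K d) fun p => assemble e (fun x => q p x.1 x.2) (c p)

lemma assemble_add (g g' : Eqn b → Amb K d) (h h' : Col d → Col d → Amb K d) :
    assemble e (g + g') (h + h') = assemble e g h + assemble e g' h' := by
  simp only [assemble, Pi.add_apply, add_smul, Finset.sum_add_distrib]
  abel

lemma assemble_smul (f : Amb K d) (g : Eqn b → Amb K d) (h : Col d → Col d → Amb K d) :
    assemble e (f • g) (f • h) = f • assemble e g h := by
  simp only [assemble, Pi.smul_apply, smul_assoc, Finset.smul_sum, smul_add]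

lemma reduce_eq (r : Free (grading K d) (coneIdeal d b P)) :
    reduce q e c r = assemble e (fun x => factor q x.1 x.2 r)
      (Finsupp.linearCombination (Amb K d) c r) := by
  induction r using Finsupp.induction_linear with
  | zero => simp [assemble]
  | add f g hf hg =>
    rw [map_add, hf, hg, map_add, ← assemble_add]
    congr 1
    funext x
    simp
  | single p f =>
    simp only [reduce, factor, Finsupp.linearCombination_single]
    rw [← assemble_smul]
    rfl

lemma IsReduction.linearCombination_reduce (hc : IsReduction q e c)
    (r : Free (grading K d) (coneIdeal d b P)) :
    Finsupp.linearCombination (Amb K d) (fun p : Gen (grading K d) (coneIdeal d b P) => p.elt)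
      (reduce q e c r) = Finsupp.linearCombination (Amb K d) (fun p => p.elt) r := by
  induction r using Finsupp.induction_linear with
  | zero => simp
  | add f g hf hg => rw [map_add, map_add, hf, hg, map_add]
  | single p f =>
    rw [reduce, Finsupp.linearCombination_single, Finsupp.linearCombination_single, map_smul,
      linearCombination_assemble, ← hc.eq p]

lemma IsReduction.sub_reduce_mem (hc : IsReduction q e c)
    (r : Free (grading K d) (coneIdeal d b P)) :
    r - reduce q e c r ∈ relations (grading K d) (coneIdeal d b P) := by
  rw [mem_relations_iff, map_sub, hc.linearCombination_reduce, sub_self]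

/-- The restriction of `reduce` to the relations. -/
def IsReduction.reduceRel (hc : IsReduction q e c) :
    relations (grading K d) (coneIdeal d b P) →ₗ[Amb K d]
      relations (grading K d) (coneIdeal d b P) :=
  (reduce q e c).restrict fun r hr => by
    rw [mem_relations_iff, hc.linearCombination_reduce]
    exact hr

lemma homogeneous_assemble (he : IsRolling d a b P e) {n : ℤ} {g : Eqn b → Amb K d}
    {h : Col d → Col d → Amb K d} (hg : ∀ x, g x ∈ grading K d (n - a))
    (hh : ∀ α β, h α β ∈ grading K d (n - 2)) : (assemble e g h).IsHomogeneousOfDegree n :=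
  .add (.sum fun x _ => .smul_basis (by
      rw [(he x.1 x.2 (Nat.lt_succ_iff.mp x.2.2)).1]; exact hg x))
    (.sum fun α _ => .sum fun β _ => homogeneous_smul_minorGen (hh α β) α β)

lemma linearCombination_apply_apply_mem {r : Free (grading K d) (coneIdeal d b P)} {n : ℤ}
    (hc : IsReduction q e c) (hr : r.IsHomogeneousOfDegree n) (α β : Col d) :
    Finsupp.linearCombination (Amb K d) c r α β ∈ grading K d (n - 2) := by
  rw [Finsupp.linearCombination_apply, Finsupp.sum, Finset.sum_apply, Finset.sum_apply]
  refine sum_mem fun p _ => ?_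
  have := mul_mem_grading (hr p) (hc.mem p α β)
  rwa [show n - p.deg + (p.deg - 2) = n - 2 by ring] at this

lemma homogeneous_reduce (hq : IsFactorization d a b P q) (he : IsRolling d a b P e)
    (hc : IsReduction q e c) {r : Free (grading K d) (coneIdeal d b P)} {n : ℤ}
    (hr : r.IsHomogeneousOfDegree n) : (reduce q e c r).IsHomogeneousOfDegree n := by
  rw [reduce_eq]
  exact homogeneous_assemble he (fun x => hq.factor_mem hr _ _)
    (linearCombination_apply_apply_mem hc hr)

lemma homogeneous_basis (p : Gen (grading K d) (coneIdeal d b P)) :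
    (Free.basis p).IsHomogeneousOfDegree p.deg := by
  have h1 : (1 : Amb K d) ∈ grading K d (p.deg - p.deg) := by
    rw [sub_self]; exact isWeightedHomogeneous_one _ _
  have := Free.IsHomogeneousOfDegree.smul_basis h1
  rwa [one_smul] at this

lemma homogeneous_colRelation (he : IsRolling d a b P e) (α : Col d) {i : Fin l} {m : ℕ}
    (hm : m < b i) :
    (he.colRelation α hm : Free (grading K d) (coneIdeal d b P)).IsHomogeneousOfDegree
      (1 + a) := by
  refine .sub (.sub (.smul_basis ?_) (.smul_basis ?_)) (homogeneous_basis _)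
  · rw [(he i m hm.le).1, add_sub_cancel_right]; exact X_mem_grading _
  · rw [(he i (m + 1) hm).1, add_sub_cancel_right]; exact X_mem_grading _

variable {ψ : relations (grading K d) (coneIdeal d b P) →ₗ[Amb K d] Amb K d ⧸ coneIdeal d b P}

/-- The map r - `reduce` r is defined on all of F and takes values in the relations, so its
composite with ψ is a homomorphism on F of degree -a. -/
lemma sub_reduceRel_mem (hq : IsFactorization d a b P q) (he : IsRolling d a b P e)
    (hc : IsReduction q e c)
    (hψ : ψ ∈ relHomPart (grading K d) (coneIdeal d b P) (-(a : ℤ))) :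
    ψ - ψ ∘ₗ hc.reduceRel ∈ inducedPart (grading K d) (coneIdeal d b P) (-(a : ℤ)) := by
  refine ⟨ψ ∘ₗ (LinearMap.id - reduce q e c).codRestrict _ hc.sub_reduce_mem, fun p => ?_,
    fun r => ?_⟩
  · exact hψ.2 p.deg _ ((homogeneous_basis p).sub (homogeneous_reduce hq he hc
      (homogeneous_basis p)))
  · rw [LinearMap.sub_apply, LinearMap.comp_apply, LinearMap.comp_apply, ← map_sub]
    rfl

/-- A homomorphism on the relations that depends, up to Koszul relations, only on the
coefficients of the rolling factors equations. -/
structure IsReducedHom (q : Gen (grading K d) (coneIdeal d b P) → Fin l → ℕ → Amb K d)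
    {a : ℕ} (he : IsRolling d a b P e)
    (ψ : relations (grading K d) (coneIdeal d b P) →ₗ[Amb K d] Amb K d ⧸ coneIdeal d b P) :
    Prop where
  eq_zero : ∀ (r : relations (grading K d) (coneIdeal d b P)) (B : Eqn b → Eqn b → Amb K d),
    (∀ x : Eqn b, pullback K d (factor q x.1 x.2 r) =
      pullback K d (∑ y, (B x y - B y x) * (e y.1 y.2).elt)) → ψ r = 0
  mem : ∀ (α : Col d) (i : Fin l) (m : ℕ) (hm : m < b i),
    ψ (he.colRelation α hm) ∈ quotPart (grading K d) (coneIdeal d b P) 1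

lemma isReducedHom_comp_reduceRel (ha : 2 < a) (hP : ∀ i, IsDivisorEquation d a (b i) (P i))
    (hq : IsFactorization d a b P q) (he : IsRolling d a b P e) (hc : IsReduction q e c)
    (hψ : ψ ∈ relHomPart (grading K d) (coneIdeal d b P) (-(a : ℤ))) :
    IsReducedHom q he (ψ ∘ₗ hc.reduceRel) where
  eq_zero r B h := by
    have hr : (hc.reduceRel r : Free (grading K d) (coneIdeal d b P)) = _ :=
      reduce_eq (q := q) (e := e) (c := c) (r : Free (grading K d) (coneIdeal d b P))
    have hmem := (hc.reduceRel r).2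
    rw [hr] at hmem
    rw [LinearMap.comp_apply, ← apply_assemble_eq_zero ha hP hψ hmem B h]
    exact congrArg ψ (Subtype.ext hr)
  mem α i m hm := by
    have := hψ.2 (1 + a) (hc.reduceRel (he.colRelation α hm))
      (homogeneous_reduce hq he hc (homogeneous_colRelation he α hm))
    rwa [add_neg_cancel_right] at this

lemma factor_colRelation (ha : 0 < a) (hP : ∀ i, IsDivisorEquation d a (b i) (P i))
    (hV : IsCompleteIntersection P) (hq : IsFactorization d a b P q) (he : IsRolling d a b P e)
    (α : Col d) {i i' : Fin l} {m m' : ℕ} (hm : m < b i) (hm' : m' ≤ b i') :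
    factor q i' m' (he.colRelation α hm : Free (grading K d) (coneIdeal d b P)) =
      X α.bot * (if i' = i ∧ m' = m then 1 else 0) -
        X α.top * (if i' = i ∧ m' = m + 1 then 1 else 0) := by
  rw [IsRolling.colRelation, map_sub, map_sub, (factor q i' m').map_smul,
    (factor q i' m').map_smul, IsRolling.colGen, hq.factor_kerGen,
    hq.factor_rolling ha hP hV he hm.le hm', hq.factor_rolling ha hP hV he hm hm', sub_zero]
  rfl

lemma Tot.exists_eq_sum_colForm_pullback {n : ℤ} {f : Cox K k} (hf : Tot d (-1) f)
    (hn : Fib n f) : ∃ ν : Col d → Amb K d, (∀ α, ν α ∈ grading K d (n - 1)) ∧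
      f = ∑ α, colForm K d α * pullback K d (ν α) := by
  obtain ⟨g, hg, hfg⟩ := hf.exists_eq_sum_colForm
  choose ν hν hνg using fun α => exists_mem_grading_pullback_eq (K := K) (d := d)
    (weightedHomogeneousComponent_isWeightedHomogeneous (w := fibWeight k) (n - 1) (g α))
    (IsWeightedHomogeneous.component_of_isWeightedHomogeneous (hg α) _)
  refine ⟨ν, hν, ?_⟩
  rw [← weightedHomogeneousComponent_eq_self hn, hfg, map_sum]
  exact Finset.sum_congr rfl fun α _ => by
    rw [weightedHomogeneousComponent_mul_left' (fib_colForm α), hνg]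

section

variable (ha : 0 < a) (hP : ∀ i, IsDivisorEquation d a (b i) (P i))
  (hV : IsCompleteIntersection P) (hq : IsFactorization d a b P q) {he : IsRolling d a b P e}
include ha hP hV hq

/-- The lower entry of β times the relation of α minus the lower entry of α times the relation of β
has rolling coefficients that vanish on the scroll. Hence the quotient of g α by the column form
does not depend on α. -/
lemma IsReducedHom.colForm_mul_eq (ha2 : 2 < a) (hψ : IsReducedHom q he ψ) {i : Fin l} {m : ℕ}
    (hm : m < b i) {g : Col d → Amb K d} (hg : ∀ α, g α ∈ grading K d 1)
    (hψg : ∀ α, ψ (he.colRelation α hm) = Ideal.Quotient.mk _ (g α)) (α β : Col d) :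
    colForm K d β * pullback K d (g α) = colForm K d α * pullback K d (g β) := by
  have h1 : (X β.bot : Amb K d) • ψ (he.colRelation α hm) -
      (X α.bot : Amb K d) • ψ (he.colRelation β hm) = 0 := by
    rw [← map_smul, ← map_smul, ← map_sub]
    refine hψ.eq_zero _ 0 fun x => ?_
    have hx := Nat.lt_succ_iff.mp x.2.2
    simp only [AddSubgroupClass.coe_sub, Submodule.coe_smul, map_sub, map_smul, smul_eq_mul,
      factor_colRelation ha hP hV hq he _ hm hx, Pi.zero_apply, sub_self, zero_mul,
      Finset.sum_const_zero, map_zero, map_mul, pullback_bot, pullback_top]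
    ring
  rw [hψg, hψg, smul_mk, smul_mk, ← map_sub] at h1
  have h2 := pullback_eq_zero_of_mk_eq_zero hP (by omega)
    (sub_mem (mul_mem_grading (X_mem_grading β.bot) (hg α))
      (mul_mem_grading (X_mem_grading α.bot) (hg β))) h1
  rw [map_sub, map_mul, map_mul, pullback_bot, pullback_bot, mul_assoc, mul_assoc, ← mul_sub,
    mul_eq_zero] at h2
  exact sub_eq_zero.mp (h2.resolve_left t_ne_zero)

/-- This limits the denominator of the common quotient. Writing s^(b_i-1-m) t^m P_i = ∑ colForm_α
ν_α, the combination ∑ ν_α `colRelation` α has the rolling coefficients of the Koszul relation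
between the equations m and m + 1. So ψ kills it, and ∑ ν_α g_α lies in J; its coefficient at P_i is
p. -/
lemma IsReducedHom.exists_mul_eq (ha2 : 2 < a) (hψ : IsReducedHom q he ψ) {i : Fin l} {m : ℕ}
    (hm : m < b i) {g : Col d → Amb K d} (hg : ∀ α, g α ∈ grading K d 1)
    (hψg : ∀ α, ψ (he.colRelation α hm) = Ideal.Quotient.mk _ (g α)) :
    ∃ p : Cox K k, Fib 0 p ∧ Tot d (b i) p ∧
      ∀ β, s K k ^ (b i - 1 - m) * t K k ^ m * pullback K d (g β) = colForm K d β * p := by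
  have htot : Tot d (-1) (s K k ^ (b i - 1 - m) * t K k ^ m * P i) := by
    have := (tot_st d (b i - 1 - m) m).mul (hP i).tot
    rwa [show ((b i - 1 - m : ℕ) : ℤ) + m + -(b i : ℤ) = -1 by omega] at this
  have hfib : Fib (a : ℤ) (s K k ^ (b i - 1 - m) * t K k ^ m * P i) := by
    simpa using (fib_st (b i - 1 - m) m).mul (hP i).fib
  obtain ⟨ν, hν, hνP⟩ := htot.exists_eq_sum_colForm_pullback hfib
  let x₀ : Eqn b := ⟨i, m, by omega⟩
  let x₁ : Eqn b := ⟨i, m + 1, by omega⟩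
  have hx₀ : ∀ x : Eqn b, (x.1 = i ∧ (x.2 : ℕ) = m) ↔ x = x₀ := by
    rintro ⟨i', m'⟩
    constructor
    · rintro ⟨rfl, rfl⟩; rfl
    · rintro h; rw [h]; exact ⟨rfl, rfl⟩
  have hx₁ : ∀ x : Eqn b, (x.1 = i ∧ (x.2 : ℕ) = m + 1) ↔ x = x₁ := by
    rintro ⟨i', m'⟩
    constructor
    · rintro ⟨rfl, h⟩
      simp only at h
      simp only [x₁, Sigma.mk.injEq, heq_eq_eq, true_and, Fin.ext_iff, h]
    · rintro h; rw [h]; exact ⟨rfl, rfl⟩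
  have hne : x₀ ≠ x₁ := by simp [x₀, x₁]
  have hB : ∀ x, ∑ y, ((if x = x₀ then (if y = x₁ then 1 else 0) else 0) -
      (if y = x₀ then (if x = x₁ then 1 else 0) else 0)) * (e y.1 y.2).elt =
      (if x = x₀ then (e i (m + 1)).elt else 0) - if x = x₁ then (e i m).elt else 0 := by
    intro x
    simp only [sub_mul, Finset.sum_sub_distrib]
    congr 1
    · split_ifs
      · simp only [ite_mul, one_mul, zero_mul, Finset.sum_ite_eq', Finset.mem_univ, if_true]
        rfl
      · simp
    · simp only [ite_mul, one_mul, zero_mul, Finset.sum_ite_eq', Finset.mem_univ, if_true]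
      rfl
  have hsum : ∀ f : Cox K k, ∑ α, pullback K d (ν α) * (f * colForm K d α) =
      f * (s K k ^ (b i - 1 - m) * t K k ^ m * P i) := fun f => by
    rw [hνP, Finset.mul_sum]
    exact Finset.sum_congr rfl fun α _ => by ring
  have h1 := hψ.eq_zero (∑ α, ν α • he.colRelation α hm)
    (fun x y => if x = x₀ then (if y = x₁ then 1 else 0) else 0) (fun x => by
      have hx := Nat.lt_succ_iff.mp x.2.2
      simp only [hB, Submodule.coe_sum, Submodule.coe_smul, map_sum, map_smul, smul_eq_mul,
        factor_colRelation ha hP hV hq he _ hm hx, hx₀, hx₁, map_sub]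
      by_cases h0 : x = x₀
      · simp only [h0, if_true, hne, if_false, mul_one, mul_zero, sub_zero, map_mul,
          pullback_bot, hsum, map_zero, (he i (m + 1) hm).2]
        rw [show b i - 1 - m = b i - (m + 1) by omega]
        ring
      · by_cases h1 : x = x₁
        · simp only [h1, if_true, hne.symm, if_false, mul_one, mul_zero, zero_sub, map_mul, map_neg,
            pullback_top, hsum, (he i m hm.le).2, map_zero, mul_neg, Finset.sum_neg_distrib]
          rw [show b i - m = b i - 1 - m + 1 by omega]
          ring
        · simp [h0, h1])
  have h2 : ∑ α, pullback K d (ν α) * pullback K d (g α) ∈ idealOf P := by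
    simp only [map_sum, map_smul, hψg, smul_mk] at h1
    rw [← map_sum] at h1
    have := (mem_coneIdeal_iff fun i => (hP i).tot).mp (Ideal.Quotient.eq_zero_iff_mem.mp h1)
    simpa only [map_sum, map_mul] using this
  have hmem : ∑ α, ν α * g α ∈ grading K d a := sum_mem fun α _ => by
    have := mul_mem_grading (hν α) (hg α)
    rwa [sub_add_cancel] at this
  have h3 : pullback K d (∑ α, ν α * g α) = ∑ α, pullback K d (ν α) * pullback K d (g α) := by
    simp only [map_sum, map_mul]
  obtain ⟨u, hut, huf, hu⟩ := exists_fib_eq_sum_of_mem_idealOf (fun i => (hP i).fib)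
    (fun i => (hP i).tot) (fib_pullback hmem) (tot_pullback _) (by rwa [h3])
  refine ⟨u i, by simpa using huf i, by simpa using hut i, fun β => ?_⟩
  -- A syzygy of P_1, …, P_l of fibre degree 1 < a, in the lowest total degree e = -1 where syzygies
  -- are known to be Koszul; so it vanishes.
  have h4 : ∑ j, P j * ((if j = i then s K k ^ (b i - 1 - m) * t K k ^ m * pullback K d (g β)
      else 0) - colForm K d β * u j) = 0 := by
    simp only [mul_sub, mul_ite, mul_zero, Finset.sum_sub_distrib, Finset.sum_ite_eq',
      Finset.mem_univ, if_true]
    rw [sub_eq_zero]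
    calc P i * (s K k ^ (b i - 1 - m) * t K k ^ m * pullback K d (g β))
        = (s K k ^ (b i - 1 - m) * t K k ^ m * P i) * pullback K d (g β) := by ring
      _ = ∑ α, pullback K d (ν α) * (colForm K d α * pullback K d (g β)) := by
        rw [hνP, Finset.sum_mul]
        exact Finset.sum_congr rfl fun α _ => by ring
      _ = colForm K d β * ∑ α, pullback K d (ν α) * pullback K d (g α) := by
        rw [Finset.mul_sum]
        refine Finset.sum_congr rfl fun α _ => ?_
        rw [← hψ.colForm_mul_eq ha hP hV hq ha2 hm hg hψg α β]
        ring
      _ = ∑ j, P j * (colForm K d β * u j) := by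
        rw [← h3, hu, Finset.mul_sum]
        exact Finset.sum_congr rfl fun j _ => by ring
  have h5 := eq_zero_of_sum_eq_zero ha hP hV (e := -1) (n := 1) le_rfl (by omega) (fun j => by
      have hu' := (tot_colForm (K := K) β).mul (hut j)
      rw [show (-1 : ℤ) + (0 + b j) = b j + -1 by ring] at hu'
      refine IsWeightedHomogeneous.sub ?_ hu'
      split_ifs with hj
      · subst hj
        have := (tot_st d (b j - 1 - m) m).mul (tot_pullback (g β))
        rwa [show ((b j - 1 - m : ℕ) : ℤ) + m + 0 = b j + -1 by omega] at this
      · exact isWeightedHomogeneous_zero ..) (fun j => by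
      have hu' := (fib_colForm (K := K) β).mul (huf j)
      rw [sub_self, add_zero] at hu'
      refine IsWeightedHomogeneous.sub ?_ hu'
      split_ifs with hj
      · simpa using (fib_st (b i - 1 - m) m).mul (fib_pullback (hg β))
      · exact isWeightedHomogeneous_zero ..) h4 i
  rw [if_pos rfl, sub_eq_zero] at h5
  exact h5

end

/-- In one block the first column form is prime to t and the last one is prime to s. -/
lemma pow_dvd_of_forall_colForm {p q : ℕ} {f : Cox K k} (hcol : Nonempty (Col d))
    (h : ∀ β, s K k ^ p * t K k ^ q ∣ colForm K d β * f) : s K k ^ p * t K k ^ q ∣ f := by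
  obtain ⟨⟨i, j⟩⟩ := hcol
  have hd : 0 < d i := j.pos
  have h0 := (Dvd.intro_left _ rfl).trans (h ⟨i, 0, hd⟩)
  have h1 := (Dvd.intro _ rfl).trans (h ⟨i, d i - 1, Nat.sub_one_lt hd.ne'⟩)
  simp only [colForm, pow_zero, mul_one, Nat.sub_self, one_mul] at h0 h1
  have hts : ¬ t K k ∣ z K i * s K k ^ (d i - 1 - 0) := fun h =>
    (t_prime.dvd_or_dvd h).elim (not_t_dvd_z i) fun h => not_t_dvd_s (t_prime.dvd_of_dvd_pow h)
  have hst : ¬ s K k ∣ z K i * t K k ^ (d i - 1) := fun h =>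
    (s_prime.dvd_or_dvd h).elim (not_s_dvd_z i) fun h => not_s_dvd_t (s_prime.dvd_of_dvd_pow h)
  have h2 := t_prime.pow_dvd_of_dvd_mul_left q hts h0
  have h3 := s_prime.pow_dvd_of_dvd_mul_left p hst h1
  obtain ⟨f', rfl⟩ := h2
  have h4 := s_prime.pow_dvd_of_dvd_mul_left p
    (fun h => not_s_dvd_t (s_prime.dvd_of_dvd_pow h)) h3
  rw [mul_comm]
  exact mul_dvd_mul_left _ h4

/-- The common quotient is a polynomial of fibre degree 0 and total degree 1, that is, x t + y s.
Times a column form, t gives the lower and s the upper entry. -/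
lemma IsReducedHom.exists_apply_colRelation (hb : ∀ i, 0 < b i) (ha : 2 < a)
    (hP : ∀ i, IsDivisorEquation d a (b i) (P i)) (hV : IsCompleteIntersection P)
    (hq : IsFactorization d a b P q) {he : IsRolling d a b P e} (hψ : IsReducedHom q he ψ)
    {i : Fin l} {m : ℕ} (hm : m < b i) :
    ∃ x y : K, ∀ α, ψ (he.colRelation α hm) =
      Ideal.Quotient.mk _ (C x * X α.bot + C y * X α.top) := by
  have ha0 : 0 < a := by omega
  choose g hg hψg using fun α => hψ.mem α i m hm
  obtain ⟨p, hpf, hpt, hp⟩ := hψ.exists_mul_eq ha0 hP hV hq ha hm hg (fun α => (hψg α).symm)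
  obtain ⟨h, rfl⟩ := pow_dvd_of_forall_colForm (exists_col hb ha0 hP hV i)
    (fun β => Dvd.intro _ (hp β))
  have hst : s K k ^ (b i - 1 - m) * t K k ^ m ≠ 0 :=
    mul_ne_zero (pow_ne_zero _ s_ne_zero) (pow_ne_zero _ t_ne_zero)
  have hgh : ∀ β, pullback K d (g β) = colForm K d β * h := fun β =>
    mul_left_cancel₀ hst (by rw [hp]; ring)
  have hhf : Fib 0 h := IsWeightedHomogeneous.of_mul_left (fib_st _ _) hst (by simpa using hpf)
  have hht : Tot d (1 : ℕ) h := IsWeightedHomogeneous.of_mul_left (tot_st d _ _) hst (by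
    rwa [show ((b i - 1 - m : ℕ) : ℤ) + m + (1 : ℕ) = b i by omega])
  obtain ⟨v, hv, rfl⟩ := Tot.exists_eq_sum_pullback hht hhf
  obtain ⟨y, hy⟩ := exists_eq_C_of_mem_grading (hv 0)
  obtain ⟨x, hx⟩ := exists_eq_C_of_mem_grading (hv 1)
  refine ⟨x, y, fun α => ?_⟩
  rw [← hψg]
  refine Ideal.Quotient.eq.mpr ((mem_coneIdeal_iff fun i => (hP i).tot).mpr ?_)
  convert zero_mem (idealOf P) using 1
  rw [map_sub, sub_eq_zero, hgh, map_add, map_mul, map_mul, pullback_bot, pullback_top, ← hx, ← hy]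
  simp only [Finset.sum_range_succ, Finset.sum_range_zero, Nat.sub_zero, pow_one, pow_zero,
    Nat.sub_self, mul_one, one_mul, zero_add]
  ring

end Scroll

end

/-! ### Spanning by couplings, and the dimension -/

noncomputable section

namespace Scroll

open Cotangent

variable {K : Type*} [Field K] {k l : ℕ} {d : Fin k → ℕ} {P : Fin l → Cox K k} {a : ℕ}
  {b : Fin l → ℕ} {q : Gen (grading K d) (coneIdeal d b P) → Fin l → ℕ → Amb K d}
  {e : Fin l → ℕ → Gen (grading K d) (coneIdeal d b P)}
  {ψ : relations (grading K d) (coneIdeal d b P) →ₗ[Amb K d] Amb K d ⧸ coneIdeal d b P}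

variable (q) in
/-- The class of the coefficient of a rolling factors equation. -/
def factorHom (i : Fin l) (m : ℕ) :
    relations (grading K d) (coneIdeal d b P) →ₗ[Amb K d] Amb K d ⧸ coneIdeal d b P :=
  (Algebra.linearMap (Amb K d) (Amb K d ⧸ coneIdeal d b P)) ∘ₗ factor q i m ∘ₗ
    (relations (grading K d) (coneIdeal d b P)).subtype

lemma factorHom_mem (hq : IsFactorization d a b P q) (i : Fin l) (m : ℕ) :
    factorHom q i m ∈ inducedPart (grading K d) (coneIdeal d b P) (-(a : ℤ)) :=
  ⟨(Algebra.linearMap (Amb K d) (Amb K d ⧸ coneIdeal d b P)) ∘ₗ factor q i m, fun p =>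
    ⟨q p i m, hq.mem p i m, by rw [LinearMap.comp_apply, factor_basis]; rfl⟩, fun _ => rfl⟩

lemma tot_s_mul {N : Cox K k} (h : Tot d (-1) N) : Tot d 0 (s K k * N) := by
  simpa using (tot_s d).mul h

/-- With s in place of t one obtains the next coupling, up to the rolling coefficient, which defines
an induced homomorphism. -/
lemma toCone_s_mul (hP : ∀ i, IsDivisorEquation d a (b i) (P i))
    {r : Free (grading K d) (coneIdeal d b P)} {N : Fin l → ℕ → Cox K k}
    (hN : IsCoupling q r N) {i : Fin l} {m : ℕ} (hm : m < b i) :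
    toCone b P (s K k * N i (m + 1)) = toCone b P (t K k * N i (m + 2)) -
      Ideal.Quotient.mk (coneIdeal d b P) (factor q i (m + 1) r) := by
  obtain ⟨g, hg⟩ := exists_pullback_eq (tot_t_mul (hN.tot i (m + 2)))
  rw [toCone_eq hP (g := g) (by rw [hg, sub_self]; exact zero_mem _)
    (tot_t_mul (hN.tot i (m + 2))), ← map_sub]
  refine toCone_eq hP ?_ (tot_s_mul (hN.tot i (m + 1)))
  have := neg_mem (hN.sub_mem i (m + 1) hm)
  convert this using 1
  rw [map_sub, hg]
  ring

/-- The boundary value at b_i vanishes, so a sum over the consecutive relations, 0 ≤ m < b_i,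
reaches all equations 0 ≤ m ≤ b_i; the companion lemma does the same at the other end after a shift.
-/
lemma sum_ite_eq_of_last {M : Type*} [AddCommMonoid M] (F : Fin l → ℕ → M)
    (hF : ∀ i, F i (b i) = 0) (i : Fin l) {m : ℕ} (hm : m ≤ b i) :
    ∑ j : Σ i : Fin l, Fin (b i), (if i = j.1 ∧ m = j.2 then F j.1 j.2 else 0) = F i m := by
  rcases hm.lt_or_eq with h | rfl
  · rw [Finset.sum_eq_single ⟨i, m, h⟩]
    · simp
    · rintro ⟨i', m'⟩ _ hne
      rw [if_neg]
      rintro ⟨rfl, rfl⟩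
      exact hne rfl
    · intro hn
      exact absurd (Finset.mem_univ _) hn
  · rw [hF]
    refine Finset.sum_eq_zero fun j _ => if_neg ?_
    rintro ⟨rfl, h⟩
    omega

lemma sum_ite_eq_of_first {M : Type*} [AddCommMonoid M] (F : Fin l → ℕ → M)
    (hF : ∀ i, F i 0 = 0) (i : Fin l) {m : ℕ} (hm : m ≤ b i) :
    ∑ j : Σ i : Fin l, Fin (b i), (if i = j.1 ∧ m = j.2 + 1 then F j.1 (j.2 + 1) else 0) =
      F i m := by
  rcases Nat.eq_zero_or_pos m with rfl | h
  · rw [hF]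
    exact Finset.sum_eq_zero fun j _ => if_neg (by omega)
  · rw [Finset.sum_eq_single ⟨i, m - 1, by omega⟩]
    · simp only [Nat.sub_add_cancel h, and_self, if_true]
    · rintro ⟨i', m'⟩ _ hne
      rw [if_neg]
      rintro ⟨rfl, h⟩
      refine hne ?_
      simp only [h, Nat.add_sub_cancel]
    · intro hn
      exact absurd (Finset.mem_univ _) hn

lemma IsRolling.pullback_elt_sum {he : IsRolling d a b P e} (B : Fin l → Fin l → ℕ → ℕ → Amb K d)
    (x : Eqn b) : ∑ i', ∑ m' ∈ Finset.range (b i' + 1), (pullback K d (B x.1 i' x.2 m') -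
      pullback K d (B i' x.1 m' x.2)) * (s K k ^ (b i' - m') * t K k ^ m' * P i') =
      pullback K d (∑ y : Eqn b, (B x.1 y.1 x.2 y.2 - B y.1 x.1 y.2 x.2) * (e y.1 y.2).elt) := by
  rw [sum_eqn (fun i' m' => (B x.1 i' x.2 m' - B i' x.1 m' x.2) * (e i' m').elt), map_sum]
  refine Finset.sum_congr rfl fun i' _ => ?_
  rw [map_sum]
  refine Finset.sum_congr rfl fun m' hm' => ?_
  rw [map_mul, map_sub, (he i' m' (by simp at hm'; omega)).2]

section

variable (ha : 0 < a) (hP : ∀ i, IsDivisorEquation d a (b i) (P i))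
  (hV : IsCompleteIntersection P) (hq : IsFactorization d a b P q)

/-- The span of the homomorphisms defined by couplings and the induced homomorphisms. -/
def couplingSpan : Submodule K
    (relations (grading K d) (coneIdeal d b P) →ₗ[Amb K d] Amb K d ⧸ coneIdeal d b P) :=
  Submodule.span K (Set.range fun j : Σ i : Fin l, Fin (b i - 1) =>
    couplingHom ha hP hV hq j.1 (show (j.2 : ℕ) + 1 ≤ b j.1 by omega)) ⊔
    inducedPart (grading K d) (coneIdeal d b P) (-(a : ℤ))

/-- At m = 0 the value t N_1 is the coefficient Q_0, because N_0 = 0, so the homomorphism is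
induced. At m = b_i it is zero, because N_{b_i+1} = 0. -/
lemma couplingHom_mem_couplingSpan (i : Fin l) {m : ℕ} (hm : m ≤ b i) :
    couplingHom ha hP hV hq i hm ∈ couplingSpan ha hP hV hq := by
  rcases Nat.eq_zero_or_pos m with rfl | h0
  · refine Submodule.mem_sup_right ?_
    convert factorHom_mem hq i 0 using 1
    refine LinearMap.ext fun r => ?_
    obtain ⟨N, hN⟩ := exists_isCoupling ha hP hV hq r
    rw [couplingHom_eq ha hP hV hq i hm hN, toCone_eq hP _ (tot_t_mul (hN.tot _ _))]
    · rfl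
    · have := hN.sub_mem i 0 hm
      rwa [hN.first, mul_zero, sub_zero] at this
  rcases hm.lt_or_eq with h1 | rfl
  · refine Submodule.mem_sup_left (Submodule.subset_span ⟨⟨i, m - 1, by omega⟩, ?_⟩)
    simp only [Nat.sub_add_cancel h0]
  · convert zero_mem (couplingSpan ha hP hV hq)
    refine LinearMap.ext fun r => ?_
    obtain ⟨N, hN⟩ := exists_isCoupling ha hP hV hq r
    rw [couplingHom_eq ha hP hV hq i hm hN, hN.last, mul_zero,
      toCone_eq hP (g := 0) (by simp) (isWeightedHomogeneous_zero ..), map_zero]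
    rfl

/-- A reduced homomorphism is a combination of homomorphisms defined by couplings and of induced
homomorphisms. -/
lemma IsReducedHom.mem_couplingSpan (hb : ∀ i, 0 < b i) (ha2 : 2 < a) {he : IsRolling d a b P e}
    (hψ : IsReducedHom q he ψ) : ψ ∈ couplingSpan ha hP hV hq := by
  choose x y hxy using fun j : Σ i : Fin l, Fin (b i) =>
    hψ.exists_apply_colRelation hb ha2 hP hV hq j.2.2
  -- The coefficient x belongs to lower entries, that is, to t N_{m+1}. The coefficient y belongs to
  -- upper entries, that is, to s N_{m+1} = t N_{m+2} - Q_{m+1}.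
  have key : ψ = ∑ j : Σ i : Fin l, Fin (b i),
      (x j • couplingHom ha hP hV hq j.1 j.2.2.le +
        y j • (couplingHom ha hP hV hq j.1 (m := j.2 + 1) j.2.2 - factorHom q j.1 (j.2 + 1))) := by
    refine LinearMap.ext fun r => ?_
    obtain ⟨N, B, hN1, hN2, hN3, hN4⟩ := exists_differences ha hP hV
      (M := fun i m => pullback K d (factor q i m r)) (fun i m => tot_pullback _) (by
        rw [← hq.pullback_eq, mem_relations_iff.mp r.2, map_zero])
    have hN : IsCoupling q (r : Free (grading K d) (coneIdeal d b P)) N := by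
      refine ⟨hN1, hN2, hN3, fun i m hm => ?_⟩
      rw [hN4 i m hm, add_sub_cancel_left]
      exact sum_mem fun i' _ => sum_mem fun m' _ => Ideal.mul_mem_left _ _
        (Ideal.mul_mem_left _ _ (mem_idealOf i'))
    choose ν hν using fun (i : Fin l) (m : ℕ) =>
      let ⟨c, hc, h⟩ := (hN1 i m).exists_eq_sum_colForm
      (⟨fun α => (exists_pullback_eq (hc α)).choose, by
        simp only [fun α => (exists_pullback_eq (hc α)).choose_spec]; exact h⟩ :
        ∃ ν : Col d → Amb K d, N i m = ∑ α, colForm K d α * pullback K d (ν α))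
    have hsum : ∀ (f : Cox K k) (i : Fin l) (m : ℕ),
        ∑ α, pullback K d (ν i m α) * (f * colForm K d α) = f * N i m := fun f i m => by
      rw [hν i m, Finset.mul_sum]
      exact Finset.sum_congr rfl fun α _ => by ring
    -- Writing N through column forms, the relation r minus a combination of consecutive relations
    -- has exactly the Koszul coefficients B, and a reduced homomorphism kills it.
    have h1 : ψ r - ∑ j : Σ i : Fin l, Fin (b i), ∑ α,
        ν j.1 (j.2 + 1) α • ψ (he.colRelation α j.2.2) = 0 := by
      simp only [← map_smul, ← map_sum]
      rw [← map_sub]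
      refine hψ.eq_zero _ (fun x y => B x.1 y.1 x.2 y.2) fun x => ?_
      have hx := Nat.lt_succ_iff.mp x.2.2
      rw [← IsRolling.pullback_elt_sum (he := he)]
      simp only [AddSubgroupClass.coe_sub, Submodule.coe_sum, Submodule.coe_smul, map_sub, map_sum,
        map_smul, smul_eq_mul, factor_colRelation ha hP hV hq he _ _ hx]
      rw [hN4 x.1 x.2 hx, ← sum_ite_eq_of_last (fun i m => t K k * N i (m + 1))
        (fun i => by simp only [hN3, mul_zero]) x.1 hx,
        ← sum_ite_eq_of_first (fun i m => s K k * N i m)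
        (fun i => by simp only [hN2, mul_zero]) x.1 hx, ← Finset.sum_sub_distrib,
        sub_eq_iff_eq_add, add_comm]
      congr 1
      refine Finset.sum_congr rfl fun j _ => ?_
      simp only [mul_sub, map_sub, map_mul, Finset.sum_sub_distrib, pullback_bot, pullback_top]
      congr 1
      · split_ifs
        · simp only [map_one, mul_one, hsum]
        · simp
      · split_ifs
        · simp only [map_one, mul_one, hsum]
        · simp
    rw [sub_eq_zero.mp h1, LinearMap.sum_apply]
    refine Finset.sum_congr rfl fun j _ => ?_
    have hbot : toCone b P (t K k * N j.1 (j.2 + 1)) = Ideal.Quotient.mk (coneIdeal d b P)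
        (∑ α, ν j.1 (j.2 + 1) α * X α.bot) := by
      refine toCone_eq hP ?_ (tot_t_mul (hN1 _ _))
      simp only [map_sum, map_mul, pullback_bot, hsum, sub_self, zero_mem]
    have htop : toCone b P (s K k * N j.1 (j.2 + 1)) = Ideal.Quotient.mk (coneIdeal d b P)
        (∑ α, ν j.1 (j.2 + 1) α * X α.top) := by
      refine toCone_eq hP ?_ (tot_s_mul (hN1 _ _))
      simp only [map_sum, map_mul, pullback_top, hsum, sub_self, zero_mem]
    have hC : ∀ (z : K) (f : Amb K d), z • (Ideal.Quotient.mk (coneIdeal d b P) f) =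
        Ideal.Quotient.mk _ (C z * f) := fun z f => by rw [← smul_eq_C_mul]; rfl
    have hs := toCone_s_mul hP hN j.2.2
    rw [LinearMap.add_apply, LinearMap.smul_apply, LinearMap.smul_apply, LinearMap.sub_apply,
      couplingHom_eq ha hP hV hq j.1 _ hN, couplingHom_eq ha hP hV hq j.1 _ hN,
      show factorHom q j.1 (j.2 + 1) r =
        Ideal.Quotient.mk _ (factor q j.1 (j.2 + 1) r) from rfl, ← hs, hbot, htop, hC, hC,
      ← map_add]
    simp only [hxy, smul_mk]
    rw [← map_sum]
    congr 1
    rw [Finset.mul_sum, Finset.mul_sum, ← Finset.sum_add_distrib]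
    exact Finset.sum_congr rfl fun α _ => by ring
  rw [key]
  refine sum_mem fun j _ => add_mem (Submodule.smul_mem _ _ ?_) (Submodule.smul_mem _ _
    (sub_mem ?_ (Submodule.mem_sup_right (factorHom_mem hq _ _))))
  · exact couplingHom_mem_couplingSpan ha hP hV hq _ _
  · exact couplingHom_mem_couplingSpan ha hP hV hq _ _

lemma relHomPart_le_couplingSpan (hb : ∀ i, 0 < b i) (ha2 : 2 < a) :
    relHomPart (grading K d) (coneIdeal d b P) (-(a : ℤ)) ≤ couplingSpan ha hP hV hq := by
  intro ψ hψ
  obtain ⟨e, he⟩ := exists_isRolling hP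
  obtain ⟨c, hc⟩ := exists_isReduction hq he
  have h1 : ψ - ψ ∘ₗ hc.reduceRel ∈ couplingSpan ha hP hV hq :=
    Submodule.mem_sup_right (sub_reduceRel_mem hq he hc hψ)
  have h2 := (isReducedHom_comp_reduceRel ha2 hP hq he hc hψ).mem_couplingSpan ha hP hV hq hb ha2
  simpa using add_mem h1 h2

/-- The map that sends the coordinates to a class in the second cotangent module. -/
def couplingClass : ((Σ i : Fin l, Fin (b i - 1)) → K) →ₗ[K] T2Cone d b P (-(a : ℤ)) :=
  ((inducedPart (grading K d) (coneIdeal d b P) (-(a : ℤ))).mkQ ∘ₗ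
    Fintype.linearCombination K fun j : Σ i : Fin l, Fin (b i - 1) =>
      couplingHom ha hP hV hq j.1 (show (j.2 : ℕ) + 1 ≤ b j.1 by omega)).codRestrict _ fun x =>
    Submodule.mem_map_of_mem (by
      rw [Fintype.linearCombination_apply]
      exact sum_mem fun j _ => Submodule.smul_mem _ _ (couplingHom_mem ha hP hV hq _ _))

lemma coe_couplingClass (x : (Σ i : Fin l, Fin (b i - 1)) → K) :
    (couplingClass ha hP hV hq x).1 =
      (inducedPart (grading K d) (coneIdeal d b P) (-(a : ℤ))).mkQ
        (∑ j, x j • couplingHom ha hP hV hq j.1 (show (j.2 : ℕ) + 1 ≤ b j.1 by omega)) :=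
  congrArg _ (Fintype.linearCombination_apply ..)

lemma couplingClass_injective (hb : ∀ i, 0 < b i) (ha2 : 2 ≤ a) :
    Function.Injective (couplingClass ha hP hV hq) := by
  rw [← LinearMap.ker_eq_bot, LinearMap.ker_eq_bot']
  intro x hx
  have h1 := congrArg Subtype.val hx
  rw [coe_couplingClass] at h1
  exact eq_zero_of_sum_couplingHom_mem hb ha2 hP hV hq x
    ((Submodule.Quotient.mk_eq_zero _).mp h1)

lemma couplingClass_surjective (hb : ∀ i, 0 < b i) (ha2 : 2 < a) :
    Function.Surjective (couplingClass ha hP hV hq) := by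
  rintro ⟨_, ψ, hψ, rfl⟩
  obtain ⟨ψ₁, h₁, ψ₂, h₂, rfl⟩ :=
    Submodule.mem_sup.mp (relHomPart_le_couplingSpan ha hP hV hq hb ha2 hψ)
  obtain ⟨x, rfl⟩ := (Submodule.mem_span_range_iff_exists_fun K).mp h₁
  refine ⟨x, Subtype.ext ?_⟩
  have h0 : ∀ ψ₁, (inducedPart (grading K d) (coneIdeal d b P) (-(a : ℤ))).mkQ ψ₁ =
      (inducedPart (grading K d) (coneIdeal d b P) (-(a : ℤ))).mkQ (ψ₁ + ψ₂) := fun ψ₁ => by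
    rw [map_add, left_eq_add]
    exact (Submodule.Quotient.mk_eq_zero _).mpr h₂
  exact (coe_couplingClass ha hP hV hq x).trans (h0 _)

end

lemma rank_fun_sigma (K : Type*) [Field K] (b : Fin l → ℕ) :
    Module.rank K ((Σ i : Fin l, Fin (b i - 1)) → K) = ((∑ i, (b i - 1) : ℕ) : Cardinal) := by
  rw [rank_fun', Fintype.card_sigma]
  simp only [Fintype.card_fin]

end Scroll

end

theorem proposition3p1 {K : Type*} [Field K] {k l : ℕ} (d : Fin k → ℕ) (a : ℕ) (ha : 2 ≤ a)
    (b : Fin l → ℕ) (hb : ∀ i, 0 < b i) (P : Fin l → Scroll.Cox K k)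
    (hP : ∀ i, Scroll.IsDivisorEquation d a (b i) (P i))
    (hV : Scroll.IsCompleteIntersection P) :
    (2 < a → Module.rank K (Scroll.T2Cone d b P (-(a : ℤ))) =
      ((∑ i, (b i - 1) : ℕ) : Cardinal)) ∧
    (a = 2 → ((∑ i, (b i - 1) : ℕ) : Cardinal) ≤
      Module.rank K (Scroll.T2Cone d b P (-2))) := by
  have ha0 : 0 < a := by omega
  obtain ⟨q, hq⟩ := Scroll.exists_isFactorization hP
  have hinj := Scroll.couplingClass_injective ha0 hP hV hq hb ha
  rw [← Scroll.rank_fun_sigma K b]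
  refine ⟨fun h => ?_, fun h => ?_⟩
  · exact (LinearEquiv.ofBijective _
      ⟨hinj, Scroll.couplingClass_surjective ha0 hP hV hq hb h⟩).rank_eq.symm
  · have := LinearMap.rank_le_of_injective _ hinj
    subst h
    exact this
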